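/- Let $N\ge 1$, let $\lambda$ be a partition of $N$, and let $K$ be a field of characteristic $0$ with an element $\alpha\in K$ transcendental over $\mathbb Q$ (for instance $K=\mathbb Q(\alpha)$). Rows of the shape $\lambda$ are counted from the bottom; the content of a cell is (column) $-$ (row). For a vector $w$ write $ws_i$ for $w$ with entries $i,i+1$ exchanged. **Tableaux.** A reverse standard tableau (RST) of shape $\lambda$ is a bijective filling with $1,\dots,N$ strictly decreasing in rows and columns; $\mathrm{CT}_\tau[i]$ is the content of the cell of $i$ in $\tau$, and $\tau^{(a,b)}$ is $\tau$ with $a,b$ exchanged. $\tau_\lambda$ is the RST filled with $N,N-1,\dots,1$ column by column (from left to right, each from bottom to top). The group $\mathfrak S_N$ acts on the right on the space $V_\lambda$ with basis the RST by: with $b=1/(\mathrm{CT}_\tau[i]-\mathrm{CT}_\tau[i+1])$, $\tau s_i=b\tau$ if $b^2=1$, $\tau s_i=b\tau+\tau^{(i,i+1)}$ if $0<b\le\frac12$, and $\tau s_i=b\tau+(1-b^2)\tau^{(i,i+1)}$ otherwise. It acts on $K[x_1,\dots,x_N]$ on the right by $x^v s_i=x^{vs_i}$. On $M_\lambda=K[x_1,\dots,x_N]\otimes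 V_\lambda$ put $\Psi=(\theta\otimes\theta)x_N$ (apply $\theta\otimes\theta$, then multiply by $x_N$), with $\theta=s_1s_2\cdots s_{N-1}$, and $\mathcal S=\sum_{\omega\in\mathfrak S_N}\omega\otimes\omega$. An element of $M_\lambda$ is symmetric if it is invariant under every $s_i\otimes s_i$. **Graphs.** On 4-tuples $(\tau,\zeta,v,\sigma)$ ($\tau$ an RST of shape $\lambda$, $\zeta\in\mathbb Z[\alpha]^N$, $v\in\mathbb N^N$, $\sigma\in\mathfrak S_N$) let $(\tau,\zeta,v,\sigma)s_i$ be $(\tau,\zeta s_i,vs_i,\sigma s_i)$ if $v[i]\ne v[i+1]$; $(\tau^{(\sigma[i],\sigma[i+1])},\zeta s_i,v,\sigma)$ if $v[i]=v[i+1]$ and $\tau^{(\sigma[i],\sigma[i+1])}$ is an RST; and $(\tau,\zeta,v,\sigma)$ otherwise. Let $(\tau,\zeta,v,\sigma)\Psi=(\tau,[\zeta_2,\dots,\zeta_N,\zeta_1+\alpha],[v_2,\dots,v_N,v_1+1],[\sigma_2,\dots,\sigma_N,\sigma_1])$. The graph $G_\lambda$ is generated from the root $(\tau_\lambda,\mathrm{CT}_{\tau_\lambda},0^N,\mathrm{id})$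 by the arrows $x\xrightarrow{s_i}xs_i$ when $v[i]<v[i+1]$ (steps), or when $v[i]=v[i+1]$ and $xs_i$ has tableau $\tau^{(k,\ell)}$ for some $k<\ell$ with $\mathrm{CT}_\tau[k]\ge\mathrm{CT}_\tau[\ell]+2$ (jumps); the arrows $x\xrightarrow{\Psi}x\Psi$ (affine arrows); and arrows $x\xrightarrow{s_i}\varnothing$ when $xs_i=x$ (falls). The non-affine graph $H_\lambda$ is $G_\lambda$ with the affine arrows, the falls and $\varnothing$ removed. **Jack polynomials.** For a path from the root put $J_{[]}=1\otimes\tau_\lambda$, $J_{[a_1,\dots,a_{k-1},\Psi]}=J_{[a_1,\dots,a_{k-1}]}\Psi$ and $J_{[a_1,\dots,a_{k-1},s_i]}=J_{[a_1,\dots,a_{k-1}]}\bigl(s_i\otimes s_i+\frac1{\zeta[i+1]-\zeta[i]}\bigr)$, where $\zeta$ is the spectral vector of the end point of $[a_1,\dots,a_{k-1}]$. Every pair $(v,\tau)$ belongs to exactly one vertex $(\tau,\zeta,v,\sigma)$ of $G_\lambda$, and $J_{v,\tau}$ is the value of $J_{\mathcal P}$ on the paths $\mathcal P$ from the root to it.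 **Components.** $T(\tau,v)$ is the filling of $\lambda$ obtained from $\tau$ by replacing each $i$ by the $i$-th entry of the decreasing rearrangement of $v$; it is constant on connected components of $H_\lambda$, and $H_T$ denotes the component on which it equals $T$. $\lambda_T$ is the vector of all entries of $T$ in decreasing order, and $\mathrm{std}\,T$ is the RST which labels the cells by $N,N-1,\dots,1$ in the increasing order of their entries in $T$, equal entries being taken row by row from bottom to top and from left to right in each row. $H_T$ is called $1$-compatible if $T$ is column-strict (strictly increasing upwards in each column). **Theorem.** Let $H_T$ be a connected component of $H_\lambda$. 1. For every vertex $(\tau,\zeta,v,\sigma)$ of $H_T$ there is a nonzero constant $c\in K$ with $J_{v,\tau}\mathcal S=c\,J_{\lambda_T,\mathrm{std}\,T}\mathcal S$. 2. $J_{\lambda_T,\mathrm{std}\,T}\mathcal S\ne0$ if and only if $H_T$ is $1$-compatible. 3. If $H_T$ is $1$-compatible, then $H_T$ is finite, there is a unique family $\mathcal E_{v,\tau}\in K$, indexed by the vertices of $H_T$, such that $\mathcal E_{v,\tau}=1$ at each vertex without inward arrow in $H_T$ and $$\mathcal E_{v,\tau}=\frac{\zeta'[i+1]-\zeta'[i]}{\zeta'[i+1]-\zeta'[i]-1}\,\mathcal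 E_{v',\tau'}$$ for each arrow $(\tau',\zeta',v',\sigma')\xrightarrow{s_i}(\tau,\zeta,v,\sigma)$ of $H_T$, and the polynomial $J_T=\sum_{(\tau,\zeta,v,\sigma)\in H_T}\mathcal E_{v,\tau}J_{v,\tau}$ is symmetric. -/

import Mathlib

open scoped TensorProduct

noncomputable section

namespace VVJack

/-! Conventions.  `N = n + 1 ≥ 1`; positions and labels `1, …, N` are the elements of `Fin (n + 1)`
and `s_1, …, s_{N-1}` are indexed by `Fin n`.  A shape is a `YoungDiagram`, the cell `(r, c)` lies in
row `r` and column `c`, rows being counted from the bottom (French notation).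
`K` is the field of coefficients and `α : K` is the Jack parameter. -/

/-- The elementary transposition `s_i = (i, i+1)`. -/
def sPerm {n : ℕ} (i : Fin n) : Equiv.Perm (Fin (n + 1)) := Equiv.swap i.castSucc i.succ

/-- The decreasing rearrangement `v⁺` of a vector `v`. -/
def sortDesc {N : ℕ} (v : Fin N → ℕ) : Fin N → ℕ := fun i => v (Tuple.sort v (Fin.rev i))

lemma sortDesc_antitone {N : ℕ} (v : Fin N → ℕ) {a b : Fin N} (h : a ≤ b) :
    sortDesc v b ≤ sortDesc v a :=
  Tuple.monotone_sort v (Fin.rev_le_rev.mpr h)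

/-! ### Tableaux -/

/-- A bijective filling of the shape `lam` with the labels; it sends a label to the cell which
contains it. -/
abbrev Filling (n : ℕ) (lam : YoungDiagram) := Fin (n + 1) ≃ lam.cells

/-- The row of the label `a`. -/
def Filling.row {n : ℕ} {lam : YoungDiagram} (f : Filling n lam) (a : Fin (n + 1)) : ℕ :=
  (f a).1.1

/-- The column of the label `a`. -/
def Filling.col {n : ℕ} {lam : YoungDiagram} (f : Filling n lam) (a : Fin (n + 1)) : ℕ :=
  (f a).1.2

/-- The content `column - row` of the label `a`. -/
def Filling.content {n : ℕ} {lam : YoungDiagram} (f : Filling n lam) (a : Fin (n + 1)) : ℤ :=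
  (f.col a : ℤ) - (f.row a : ℤ)

/-- The filling `τ^{(a,b)}` in which the labels `a` and `b` are exchanged. -/
def Filling.exchange {n : ℕ} {lam : YoungDiagram} (f : Filling n lam) (a b : Fin (n + 1)) :
    Filling n lam :=
  (Equiv.swap a b).trans f

/-- Labels are strictly decreasing along the rows and along the columns. -/
def Filling.IsRST {n : ℕ} {lam : YoungDiagram} (f : Filling n lam) : Prop :=
  ∀ a b : Fin (n + 1),
    (f.row a = f.row b → f.col a < f.col b → b < a) ∧
    (f.col a = f.col b → f.row a < f.row b → b < a)

/-- Reverse standard tableaux of shape `lam`. -/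
abbrev RST (n : ℕ) (lam : YoungDiagram) := {f : Filling n lam // f.IsRST}

/-- The filling which labels the cells in the increasing order of the value of `key`. -/
def fillingOfKey {n : ℕ} {lam : YoungDiagram} (hlam : lam.card = n + 1) {L : Type*} [LinearOrder L]
    (key : lam.cells → L) (hkey : Function.Injective key) : Filling n lam :=
  letI : LinearOrder lam.cells := LinearOrder.lift' key hkey
  (Fintype.orderIsoFinOfCardEq lam.cells
    ((Fintype.card_coe lam.cells).trans hlam)).toEquiv

lemma fillingOfKey_lt {n : ℕ} {lam : YoungDiagram} (hlam : lam.card = n + 1) {L : Type*}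
    [LinearOrder L] (key : lam.cells → L) (hkey : Function.Injective key) {a b : Fin (n + 1)}
    (h : key (fillingOfKey hlam key hkey b) < key (fillingOfKey hlam key hkey a)) : b < a := by
  let I : LinearOrder lam.cells := LinearOrder.lift' key hkey
  let e : @OrderIso (Fin (n + 1)) lam.cells _ I.toLE :=
    @Fintype.orderIsoFinOfCardEq lam.cells I _ _ ((Fintype.card_coe lam.cells).trans hlam)
  by_contra hab
  have h1 : I.le (e a) (e b) := (@OrderIso.le_iff_le _ _ _ I.toLE e a b).mpr (not_lt.mp hab)
  exact absurd h (not_lt_of_ge h1)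

/-- The key for `τ_λ`: cells which are later in the column by column order (columns from left to
right, each one read from bottom to top) have a smaller key, hence a smaller label. -/
def rootKey {lam : YoungDiagram} (c : lam.cells) : (ℕ ×ₗ ℕ)ᵒᵈ :=
  OrderDual.toDual (toLex (c.1.2, c.1.1))

lemma rootKey_injective {lam : YoungDiagram} : Function.Injective (rootKey (lam := lam)) := by
  intro c d h
  have h' : (c.1.2, c.1.1) = (d.1.2, d.1.1) := toLex.injective (OrderDual.toDual.injective h)
  rw [Prod.mk.injEq] at h'
  exact Subtype.ext (Prod.ext h'.2 h'.1)

/-- The tableau `τ_λ`: the shape filled column by column with `N, N-1, …, 1`. -/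
def rootTab {n : ℕ} {lam : YoungDiagram} (hlam : lam.card = n + 1) : RST n lam :=
  ⟨fillingOfKey hlam rootKey rootKey_injective, by
    intro a b
    refine ⟨fun _ hc => ?_, fun hc hr => ?_⟩
    · exact fillingOfKey_lt hlam rootKey rootKey_injective
        (OrderDual.toDual_lt_toDual.mpr (Prod.Lex.toLex_lt_toLex.mpr (Or.inl hc)))
    · exact fillingOfKey_lt hlam rootKey rootKey_injective
        (OrderDual.toDual_lt_toDual.mpr (Prod.Lex.toLex_lt_toLex.mpr (Or.inr ⟨hc, hr⟩)))⟩

/-- A tableau of shape `lam`: a filling with natural numbers, weakly increasing along the rows and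
along the columns. -/
@[ext] structure Tableau (lam : YoungDiagram) where
  entry : lam.cells → ℕ
  row_weak : ∀ c d : lam.cells, c.1.1 = d.1.1 → c.1.2 < d.1.2 → entry c ≤ entry d
  col_weak : ∀ c d : lam.cells, c.1.2 = d.1.2 → c.1.1 < d.1.1 → entry c ≤ entry d

/-- Strictly increasing in each column. -/
def Tableau.ColumnStrict {lam : YoungDiagram} (T : Tableau lam) : Prop :=
  ∀ c d : lam.cells, c.1.2 = d.1.2 → c.1.1 < d.1.1 → T.entry c < T.entry d

/-- The tableau `T(τ, v)`, obtained by replacing each label `i` of `τ` by `v⁺[i]`. -/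
def tabOf {n : ℕ} {lam : YoungDiagram} (τ : RST n lam) (v : Fin (n + 1) → ℕ) : Tableau lam where
  entry c := sortDesc v (τ.1.symm c)
  row_weak c d h1 h2 := sortDesc_antitone v (le_of_lt
    ((τ.2 (τ.1.symm c) (τ.1.symm d)).1
      (by simpa [Filling.row] using h1) (by simpa [Filling.col] using h2)))
  col_weak c d h1 h2 := sortDesc_antitone v (le_of_lt
    ((τ.2 (τ.1.symm c) (τ.1.symm d)).2
      (by simpa [Filling.col] using h1) (by simpa [Filling.row] using h2)))

/-- The key for the standardization: cells are compared by their entry, ties being broken by the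
reading order (rows from bottom to top, each one read from left to right); a greater triple gets a
smaller label. -/
def Tableau.stdKey {lam : YoungDiagram} (T : Tableau lam) (c : lam.cells) : (ℕ ×ₗ (ℕ ×ₗ ℕ))ᵒᵈ :=
  OrderDual.toDual (toLex (T.entry c, toLex (c.1.1, c.1.2)))

lemma Tableau.stdKey_injective {lam : YoungDiagram} (T : Tableau lam) :
    Function.Injective T.stdKey := by
  intro c d h
  have h' : (T.entry c, toLex (c.1.1, c.1.2)) = (T.entry d, toLex (d.1.1, d.1.2)) :=
    toLex.injective (OrderDual.toDual.injective h)
  rw [Prod.mk.injEq] at h'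
  exact Subtype.ext (toLex.injective h'.2)

lemma Tableau.stdKey_lt {lam : YoungDiagram} (T : Tableau lam) {c d : lam.cells}
    (h1 : T.entry c ≤ T.entry d)
    (h2 : toLex (c.1.1, c.1.2) < toLex (d.1.1, d.1.2)) : T.stdKey d < T.stdKey c := by
  refine OrderDual.toDual_lt_toDual.mpr (Prod.Lex.toLex_lt_toLex.mpr ?_)
  rcases h1.lt_or_eq with h | h
  · exact Or.inl h
  · exact Or.inr ⟨h, h2⟩

/-- The standardization `std T`. -/
def Tableau.std {n : ℕ} {lam : YoungDiagram} (hlam : lam.card = n + 1) (T : Tableau lam) :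
    RST n lam :=
  ⟨fillingOfKey hlam T.stdKey T.stdKey_injective, by
    intro a b
    refine ⟨fun hr hc => ?_, fun hc hr => ?_⟩
    · exact fillingOfKey_lt hlam T.stdKey T.stdKey_injective
        (T.stdKey_lt (T.row_weak _ _ hr hc) (Prod.Lex.toLex_lt_toLex.mpr (Or.inr ⟨hr, hc⟩)))
    · exact fillingOfKey_lt hlam T.stdKey T.stdKey_injective
        (T.stdKey_lt (T.col_weak _ _ hc hr) (Prod.Lex.toLex_lt_toLex.mpr (Or.inl hr)))⟩

/-- The partition `λ_T`: the entries of `T`, sorted in the decreasing order. -/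
def Tableau.sorted {n : ℕ} {lam : YoungDiagram} (hlam : lam.card = n + 1) (T : Tableau lam) :
    Fin (n + 1) → ℕ :=
  sortDesc fun i => T.entry ((T.std hlam).1 i)

/-! ### Vector-valued polynomials and the operators acting on them

All the groups act on the right: a product `A B` of operators means `A` first, then `B`. -/

/-- The space `V_λ` with basis the reverse standard tableaux of shape `lam`. -/
abbrev TabSpace (K : Type*) [Field K] (n : ℕ) (lam : YoungDiagram) := RST n lam →₀ K

/-- The space `M_λ` of polynomials in `x_1, …, x_N` with values in `V_λ`. -/
abbrev VPoly (K : Type*) [Field K] (n : ℕ) (lam : YoungDiagram) :=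
  MvPolynomial (Fin (n + 1)) K ⊗[K] TabSpace K n lam

open Classical in
/-- The vector `τ^{(a,b)}` of `V_λ`.  (It is only used when this filling is a reverse standard
tableau.) -/
def exchangeVec (K : Type*) [Field K] {n : ℕ} {lam : YoungDiagram} (τ : RST n lam)
    (a b : Fin (n + 1)) : TabSpace K n lam :=
  if h : (τ.1.exchange a b).IsRST then Finsupp.single ⟨τ.1.exchange a b, h⟩ 1 else 0

/-- The number `b_τ[i] = 1 / (CT_τ[i] - CT_τ[i+1])` (two consecutive labels of a reverse standard
tableau never have the same content). -/
def murphyB {n : ℕ} {lam : YoungDiagram} (τ : RST n lam) (i : Fin n) : ℚ :=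
  1 / ((τ.1.content i.castSucc : ℚ) - (τ.1.content i.succ : ℚ))

/-- The vector `τ s_i` (Young seminormal representation in the form given by Murphy). -/
def murphyVec (K : Type*) [Field K] [Algebra ℚ K] {n : ℕ} {lam : YoungDiagram} (i : Fin n)
    (τ : RST n lam) : TabSpace K n lam :=
  if murphyB τ i ^ 2 = 1 then
    Finsupp.single τ (algebraMap ℚ K (murphyB τ i))
  else if 0 < murphyB τ i ∧ murphyB τ i ≤ 1 / 2 then
    Finsupp.single τ (algebraMap ℚ K (murphyB τ i)) + exchangeVec K τ i.castSucc i.succ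
  else
    Finsupp.single τ (algebraMap ℚ K (murphyB τ i)) +
      algebraMap ℚ K (1 - murphyB τ i ^ 2) • exchangeVec K τ i.castSucc i.succ

/-- The action of `s_i` on `V_λ`. -/
def murphy (K : Type*) [Field K] [Algebra ℚ K] {n : ℕ} {lam : YoungDiagram} (i : Fin n) :
    TabSpace K n lam →ₗ[K] TabSpace K n lam :=
  Finsupp.linearCombination K (murphyVec K i)

/-- The action on `V_λ` of a word `s_{i_1} s_{i_2} ⋯ s_{i_k}` (`s_{i_1}` acts first). -/
def wordAct (K : Type*) [Field K] [Algebra ℚ K] {n : ℕ} {lam : YoungDiagram} :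
    List (Fin n) → (TabSpace K n lam →ₗ[K] TabSpace K n lam)
  | [] => LinearMap.id
  | i :: w => wordAct K w ∘ₗ murphy K i

lemma exists_word {n : ℕ} (ω : Equiv.Perm (Fin (n + 1))) :
    ∃ w : List (Fin n), (w.map sPerm).prod = ω := by
  have h : ω ∈ Submonoid.closure (Set.range fun i : Fin n => Equiv.swap i.castSucc i.succ) := by
    rw [Equiv.Perm.mclosure_swap_castSucc_succ]; trivial
  induction h using Submonoid.closure_induction with
  | mem x hx => obtain ⟨i, rfl⟩ := hx; exact ⟨[i], by simp [sPerm]⟩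
  | one => exact ⟨[], rfl⟩
  | mul x y _ _ hx hy =>
    obtain ⟨u, rfl⟩ := hx
    obtain ⟨w, rfl⟩ := hy
    exact ⟨u ++ w, by simp⟩

/-- The action of a permutation on `V_λ`: the action of a word in the `s_i` whose product is the
permutation (the operators `murphy K i` satisfy the relations of the symmetric group, so any such
word gives the same operator). -/
def tabAct (K : Type*) [Field K] [Algebra ℚ K] {n : ℕ} {lam : YoungDiagram}
    (ω : Equiv.Perm (Fin (n + 1))) : TabSpace K n lam →ₗ[K] TabSpace K n lam :=
  wordAct K (exists_word ω).choose

/-- The right action of a permutation on polynomials, by permutation of the positions of the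
exponents: `x^v ω = x^{v ω}` with `(v ω)[i] = v[ω(i)]`. -/
def polyAct (K : Type*) [Field K] {n : ℕ} (ω : Equiv.Perm (Fin (n + 1))) :
    MvPolynomial (Fin (n + 1)) K →ₗ[K] MvPolynomial (Fin (n + 1)) K :=
  (MvPolynomial.rename (R := K) (ω⁻¹ : Equiv.Perm (Fin (n + 1)))).toLinearMap

/-- The operator `s_i ⊗ s_i`. -/
def sOp (K : Type*) [Field K] [Algebra ℚ K] {n : ℕ} {lam : YoungDiagram} (i : Fin n) :
    VPoly K n lam →ₗ[K] VPoly K n lam :=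
  TensorProduct.map (polyAct K (sPerm i)) (murphy K i)

/-- The affine operator `Ψ = (θ ⊗ θ) x_N`, where `θ = s_1 s_2 ⋯ s_{N-1}`. -/
def psiOp (K : Type*) [Field K] [Algebra ℚ K] {n : ℕ} {lam : YoungDiagram} :
    VPoly K n lam →ₗ[K] VPoly K n lam :=
  TensorProduct.map
    (LinearMap.mulLeft K (MvPolynomial.X (Fin.last n)) ∘ₗ
      polyAct K ((List.finRange n).map sPerm).prod)
    (wordAct K (List.finRange n))

/-- The symmetrization operator `𝒮 = ∑_{ω ∈ 𝔖_N} ω ⊗ ω`. -/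
def symOp (K : Type*) [Field K] [Algebra ℚ K] {n : ℕ} {lam : YoungDiagram} :
    VPoly K n lam →ₗ[K] VPoly K n lam :=
  ∑ ω : Equiv.Perm (Fin (n + 1)), TensorProduct.map (polyAct K ω) (tabAct K ω)

/-- Invariance under `s_i ⊗ s_i` for each `i < N`. -/
def IsSymmetric {K : Type*} [Field K] [Algebra ℚ K] {n : ℕ} {lam : YoungDiagram}
    (P : VPoly K n lam) : Prop :=
  ∀ i : Fin n, sOp K i P = P

/-! ### The Yang--Baxter graph `G_λ` -/

/-- The 4-tuples `(τ, ζ, v, σ)`. -/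
@[ext] structure Quad (K : Type*) (n : ℕ) (lam : YoungDiagram) where
  tab : RST n lam
  spec : Fin (n + 1) → K
  wt : Fin (n + 1) → ℕ
  perm : Equiv.Perm (Fin (n + 1))

/-- The labels of the arrows: `s_i` or `Ψ`. -/
inductive Label (n : ℕ) where
  | s (i : Fin n) : Label n
  | psi : Label n

open Classical in
/-- The action of `s_i` on the 4-tuples. -/
def Quad.actS {K : Type*} {n : ℕ} {lam : YoungDiagram} (q : Quad K n lam) (i : Fin n) :
    Quad K n lam :=
  if q.wt i.castSucc ≠ q.wt i.succ then
    ⟨q.tab, q.spec ∘ sPerm i, q.wt ∘ sPerm i, q.perm * sPerm i⟩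
  else if h : (q.tab.1.exchange (q.perm i.castSucc) (q.perm i.succ)).IsRST then
    ⟨⟨q.tab.1.exchange (q.perm i.castSucc) (q.perm i.succ), h⟩, q.spec ∘ sPerm i, q.wt, q.perm⟩
  else q

/-- The action of `Ψ` on the 4-tuples:
`(τ, [ζ_2, …, ζ_N, ζ_1 + α], [v_2, …, v_N, v_1 + 1], [σ_2, …, σ_N, σ_1])`. -/
def Quad.actPsi {K : Type*} [Field K] (α : K) {n : ℕ} {lam : YoungDiagram} (q : Quad K n lam) :
    Quad K n lam :=
  ⟨q.tab, Fin.snoc (α := fun _ => K) (Fin.tail q.spec) (q.spec 0 + α),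
    Fin.snoc (α := fun _ => ℕ) (Fin.tail q.wt) (q.wt 0 + 1), q.perm * finRotate (n + 1)⟩

/-- The action of a generator on the 4-tuples. -/
def Quad.act {K : Type*} [Field K] (α : K) {n : ℕ} {lam : YoungDiagram} (q : Quad K n lam) :
    Label n → Quad K n lam
  | .s i => q.actS i
  | .psi => q.actPsi α

/-- The root `(τ_λ, CT_{τ_λ}, 0^N, [1, …, N])`. -/
def rootQuad (K : Type*) [Field K] {n : ℕ} {lam : YoungDiagram} (hlam : lam.card = n + 1) :
    Quad K n lam :=
  ⟨rootTab hlam, fun i => ((rootTab hlam).1.content i : K), fun _ => 0, 1⟩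

/-- The arrows of `G_λ`; the target `none` is the extra vertex `∅`. -/
inductive Arrow {K : Type*} [Field K] (α : K) {n : ℕ} {lam : YoungDiagram} :
    Quad K n lam → Label n → Option (Quad K n lam) → Prop
  | step (q : Quad K n lam) (i : Fin n) (hv : q.wt i.castSucc < q.wt i.succ) :
      Arrow α q (.s i) (some (q.actS i))
  | jump (q : Quad K n lam) (i : Fin n) (hv : q.wt i.castSucc = q.wt i.succ)
      (k l : Fin (n + 1)) (hkl : k < l) (htab : (q.actS i).tab.1 = q.tab.1.exchange k l)
      (hct : q.tab.1.content l + 2 ≤ q.tab.1.content k) :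
      Arrow α q (.s i) (some (q.actS i))
  | affine (q : Quad K n lam) : Arrow α q .psi (some (q.actPsi α))
  | fall (q : Quad K n lam) (i : Fin n) (h : q.actS i = q) : Arrow α q (.s i) none

/-- `IsPath α hlam P q`: the list `P` of labels is a path in `G_λ` from the root to `q`. -/
inductive IsPath {K : Type*} [Field K] (α : K) {n : ℕ} {lam : YoungDiagram}
    (hlam : lam.card = n + 1) : List (Label n) → Quad K n lam → Prop
  | nil : IsPath α hlam [] (rootQuad K hlam)
  | snoc {P : List (Label n)} {q q' : Quad K n lam} {a : Label n} (hP : IsPath α hlam P q)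
      (ha : Arrow α q a (some q')) : IsPath α hlam (P ++ [a]) q'

/-- The vertices of `G_λ` other than `∅`. -/
abbrev Vertex {K : Type*} [Field K] (α : K) {n : ℕ} {lam : YoungDiagram}
    (hlam : lam.card = n + 1) := {q : Quad K n lam // ∃ P, IsPath α hlam P q}

/-! ### Jack polynomials -/

/-- The passage from `J_{[a_1, …, a_{k-1}]}` (paired with the 4-tuple `root a_1 ⋯ a_{k-1}`) to
`J_{[a_1, …, a_k]}` (paired with `root a_1 ⋯ a_k`). -/
def jackStep {K : Type*} [Field K] [Algebra ℚ K] (α : K) {n : ℕ} {lam : YoungDiagram}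
    (x : Quad K n lam × VPoly K n lam) (a : Label n) : Quad K n lam × VPoly K n lam :=
  (x.1.act α a,
    match a with
    | .s i => sOp K i x.2 + (1 / (x.1.spec i.succ - x.1.spec i.castSucc)) • x.2
    | .psi => psiOp K x.2)

/-- The polynomial `J_P` of a path `P`, with `J_{[]} = 1 ⊗ τ_λ`. -/
def pathJack {K : Type*} [Field K] [Algebra ℚ K] (α : K) {n : ℕ} {lam : YoungDiagram}
    (hlam : lam.card = n + 1) (P : List (Label n)) : VPoly K n lam :=
  (P.foldl (jackStep α) (rootQuad K hlam, 1 ⊗ₜ[K] Finsupp.single (rootTab hlam) 1)).2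

open Classical in
/-- The Jack polynomial `J_{v,τ}`: the polynomial `J_P` of a path `P` from the root to the vertex
`(τ, ζ, v, σ)` of `G_λ`.  (Every pair `(τ, v)` belongs to exactly one vertex, and `J_P` depends only
on the end point of `P`.) -/
def jack {K : Type*} [Field K] [Algebra ℚ K] (α : K) {n : ℕ} {lam : YoungDiagram}
    (hlam : lam.card = n + 1) (v : Fin (n + 1) → ℕ) (τ : RST n lam) : VPoly K n lam :=
  if h : ∃ (P : List (Label n)) (q : Quad K n lam), IsPath α hlam P q ∧ q.wt = v ∧ q.tab = τ then
    pathJack α hlam h.choose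
  else 0

/-! ### The non-affine graph `H_λ` and its components -/

/-- The arrows of `H_λ`: affine arrows, falls and `∅` are removed. -/
def HArrow {K : Type*} [Field K] {α : K} {n : ℕ} {lam : YoungDiagram} {hlam : lam.card = n + 1}
    (x : Vertex α hlam) (i : Fin n) (y : Vertex α hlam) : Prop :=
  Arrow α x.1 (.s i) (some y.1)

/-- The undirected graph underlying `H_λ`. -/
def nonAffineGraph {K : Type*} [Field K] (α : K) {n : ℕ} {lam : YoungDiagram}
    (hlam : lam.card = n + 1) : SimpleGraph (Vertex α hlam) :=
  SimpleGraph.fromRel fun x y => ∃ i, HArrow x i y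

/-- The recursive rules which define the coefficients `ℰ_{v,τ}` on a component `C` of `H_λ`:
`ℰ = 1` at a vertex without inward arrow in `C`, and
`ℰ_{v,τ} = (ζ'[i+1] - ζ'[i]) / (ζ'[i+1] - ζ'[i] - 1) · ℰ_{v',τ'}` for each arrow
`(τ',ζ',v',σ') --s_i--> (τ,ζ,v,σ)` in `C`. -/
structure IsSymCoeff {K : Type*} [Field K] {α : K} {n : ℕ} {lam : YoungDiagram}
    {hlam : lam.card = n + 1} (C : (nonAffineGraph α hlam).ConnectedComponent)
    (E : C.supp → K) : Prop where
  root : ∀ x : C.supp, (∀ (y : C.supp) (i : Fin n), ¬ HArrow y.1 i x.1) → E x = 1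
  arrow : ∀ (y x : C.supp) (i : Fin n), HArrow y.1 i x.1 →
    E x = (y.1.1.spec i.succ - y.1.1.spec i.castSucc) /
      (y.1.1.spec i.succ - y.1.1.spec i.castSucc - 1) * E y

end VVJack

end

open scoped TensorProduct

noncomputable section

namespace VVJack

/-! ### Words in the elementary transpositions -/

/-- The relations of the symmetric group `𝔖_{n+1}`, for elements `g 0, …, g (n-1)` of a monoid. -/
structure CoxeterRel {M : Type*} [Monoid M] (n : ℕ) (g : ℕ → M) : Prop where
  sq : ∀ i < n, g i * g i = 1
  comm : ∀ i j, i + 1 < j → j < n → g i * g j = g j * g i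
  braid : ∀ i, i + 1 < n → g i * g (i + 1) * g i = g (i + 1) * g i * g (i + 1)

/-- The word `g (k-1) ⋯ g 1 g 0`. -/
def descWord {M : Type*} [Monoid M] (g : ℕ → M) : ℕ → M
  | 0 => 1
  | k + 1 => g k * descWord g k

lemma CoxeterRel.mul_descWord_of_lt {M : Type*} [Monoid M] {n : ℕ} {g : ℕ → M}
    (h : CoxeterRel n g) {i : ℕ} (hi : i < n) : ∀ {k : ℕ}, k < i →
    g i * descWord g k = descWord g k * g i
  | 0, _ => by simp [descWord]
  | k + 1, hk => by
    rw [descWord, ← mul_assoc, ← h.comm k i hk hi, mul_assoc,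
      h.mul_descWord_of_lt hi (by omega), mul_assoc]

lemma CoxeterRel.mul_descWord_of_gt {M : Type*} [Monoid M] {n : ℕ} {g : ℕ → M}
    (h : CoxeterRel n g) {i : ℕ} : ∀ {k : ℕ}, k ≤ n → i + 1 < k →
    g i * descWord g k = descWord g k * g (i + 1)
  | k + 1, hk, hik => by
    rcases (show i + 1 < k ∨ k = i + 1 by omega) with hlt | rfl
    · rw [descWord, ← mul_assoc, h.comm i k hlt (by omega), mul_assoc,
        h.mul_descWord_of_gt (by omega) hlt, mul_assoc]
    · rw [descWord, descWord, ← mul_assoc, ← mul_assoc, h.braid i (by omega), mul_assoc,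
        h.mul_descWord_of_lt (by omega) (by omega)]
      simp only [mul_assoc]

lemma CoxeterRel.exists_normal_form {M : Type*} [Monoid M] {n : ℕ} {g : ℕ → M}
    (h : CoxeterRel (n + 1) g) (w : List ℕ) (hw : ∀ i ∈ w, i < n + 1) :
    ∃ k ≤ n + 1, ∃ u : List ℕ, (∀ i ∈ u, i < n) ∧
      (w.map g).prod = descWord g k * (u.map fun i => g (i + 1)).prod := by
  induction w with
  | nil => exact ⟨0, by omega, [], by simp, by simp [descWord]⟩
  | cons i w ih =>
    obtain ⟨k, hk, u, hu, e⟩ := ih fun j hj => hw j (List.mem_cons_of_mem _ hj)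
    have hi := hw i List.mem_cons_self
    rw [List.map_cons, List.prod_cons, e, ← mul_assoc]
    rcases lt_trichotomy k i with hlt | rfl | hgt
    · refine ⟨k, hk, (i - 1) :: u, ?_, ?_⟩
      · simp only [List.mem_cons, forall_eq_or_imp]
        exact ⟨by omega, hu⟩
      · rw [h.mul_descWord_of_lt hi hlt, List.map_cons, List.prod_cons,
          Nat.sub_add_cancel (by omega), mul_assoc]
    · exact ⟨k + 1, by omega, u, hu, by rw [descWord]⟩
    · rcases (show k = i + 1 ∨ i + 1 < k by omega) with rfl | hlt
      · exact ⟨i, by omega, u, hu, by rw [descWord, ← mul_assoc (g i), h.sq i hi, one_mul]⟩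
      · refine ⟨k, hk, i :: u, ?_, ?_⟩
        · simp only [List.mem_cons, forall_eq_or_imp]
          exact ⟨by omega, hu⟩
        · rw [h.mul_descWord_of_gt hk hlt, List.map_cons, List.prod_cons, mul_assoc]

/-- The transposition `(i, i+1)` of the natural numbers. -/
def natSwap (i : ℕ) : Equiv.Perm ℕ := Equiv.swap i (i + 1)

lemma natSwap_coxeterRel (n : ℕ) : CoxeterRel n natSwap where
  sq i _ := Equiv.swap_mul_self _ _
  comm i j hij _ := (Equiv.Perm.disjoint_swap_swap (by simp; omega)).commute
  braid i _ := by
    ext x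
    simp only [natSwap, Equiv.Perm.mul_apply, Equiv.swap_apply_def]
    split_ifs <;> omega

lemma descWord_natSwap_zero : ∀ k : ℕ, descWord natSwap k 0 = k
  | 0 => rfl
  | k + 1 => by
    rw [descWord, Equiv.Perm.mul_apply, descWord_natSwap_zero k, natSwap, Equiv.swap_apply_left]

lemma natSwap_succ_prod_succ (u : List ℕ) (x : ℕ) :
    (u.map fun i => natSwap (i + 1)).prod (x + 1) = (u.map natSwap).prod x + 1 := by
  induction u with
  | nil => rfl
  | cons i u ih =>
    rw [List.map_cons, List.prod_cons, Equiv.Perm.mul_apply, ih, List.map_cons, List.prod_cons,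
      Equiv.Perm.mul_apply]
    simp only [natSwap, Equiv.swap_apply_def]
    split_ifs <;> omega

lemma natSwap_succ_prod_zero (u : List ℕ) : (u.map fun i => natSwap (i + 1)).prod 0 = 0 := by
  induction u with
  | nil => rfl
  | cons i u ih =>
    rw [List.map_cons, List.prod_cons, Equiv.Perm.mul_apply, ih, natSwap,
      Equiv.swap_apply_of_ne_of_ne (by omega) (by omega)]

lemma CoxeterRel.prod_eq_one {M : Type*} [Monoid M] : ∀ {n : ℕ} {g : ℕ → M},
    CoxeterRel n g → ∀ w : List ℕ, (∀ i ∈ w, i < n) → (w.map natSwap).prod = 1 →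
      (w.map g).prod = 1
  | 0, g, _, w, hw, _ => by
    cases w with
    | nil => rfl
    | cons i w => exact absurd (hw i List.mem_cons_self) (by omega)
  | n + 1, g, h, w, hw, e => by
    have hs := natSwap_coxeterRel (n + 1)
    have hp : CoxeterRel (n + 1) fun i => (g i, natSwap i) :=
      { sq := fun i hi => Prod.ext (h.sq i hi) (hs.sq i hi)
        comm := fun i j hij hj => Prod.ext (h.comm i j hij hj) (hs.comm i j hij hj)
        braid := fun i hi => Prod.ext (h.braid i hi) (hs.braid i hi) }
    obtain ⟨k, -, u, hu, e'⟩ := hp.exists_normal_form w hw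
    have hfst : ∀ k, (descWord (fun i => (g i, natSwap i)) k).1 = descWord g k := by
      intro k
      induction k with
      | zero => rfl
      | succ k ih => rw [descWord, descWord, Prod.fst_mul, ih]
    have hsnd : ∀ k, (descWord (fun i => (g i, natSwap i)) k).2 = descWord natSwap k := by
      intro k
      induction k with
      | zero => rfl
      | succ k ih => rw [descWord, descWord, Prod.snd_mul, ih]
    have e1 : (w.map g).prod = descWord g k * (u.map fun i => g (i + 1)).prod := by
      have := congrArg (MonoidHom.fst M (Equiv.Perm ℕ)) e'
      rw [map_mul, map_list_prod, map_list_prod, List.map_map, List.map_map] at this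
      exact this.trans (by rw [MonoidHom.coe_fst, hfst]; rfl)
    have e2 : (w.map natSwap).prod =
        descWord natSwap k * (u.map fun i => natSwap (i + 1)).prod := by
      have := congrArg (MonoidHom.snd M (Equiv.Perm ℕ)) e'
      rw [map_mul, map_list_prod, map_list_prod, List.map_map, List.map_map] at this
      exact this.trans (by rw [MonoidHom.coe_snd, hsnd]; rfl)
    rw [e] at e2
    have hk : k = 0 := by
      have := DFunLike.congr_fun e2 0
      rw [Equiv.Perm.mul_apply, natSwap_succ_prod_zero, descWord_natSwap_zero] at this
      exact this.symm
    subst hk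
    rw [descWord, one_mul] at e1 e2
    have hshift : CoxeterRel n fun i => g (i + 1) :=
      { sq := fun i hi => h.sq _ (by omega)
        comm := fun i j hij hj => h.comm _ _ (by omega) (by omega)
        braid := fun i hi => h.braid _ (by omega) }
    rw [e1]
    refine hshift.prod_eq_one u hu (Equiv.ext fun x => ?_)
    have := natSwap_succ_prod_succ u x
    rw [← e2] at this
    simpa using this.symm

lemma val_sPerm_prod {n : ℕ} (w : List (Fin n)) (x : Fin (n + 1)) :
    (((w.map sPerm).prod x : Fin (n + 1)) : ℕ) =
      ((w.map fun i : Fin n => (i : ℕ)).map natSwap).prod x := by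
  induction w with
  | nil => rfl
  | cons i w ih =>
    simp only [List.map_cons, List.prod_cons, Equiv.Perm.mul_apply, ← ih]
    simp only [sPerm, natSwap, Equiv.swap_apply_def, Fin.ext_iff, Fin.val_castSucc, Fin.val_succ]
    split_ifs <;> simp

lemma natSwap_prod_of_gt {n : ℕ} (w : List (Fin n)) {x : ℕ} (hx : n < x) :
    ((w.map fun i : Fin n => (i : ℕ)).map natSwap).prod x = x := by
  induction w with
  | nil => rfl
  | cons i w ih =>
    simp only [List.map_cons, List.prod_cons, Equiv.Perm.mul_apply, ih]
    exact Equiv.swap_apply_of_ne_of_ne (by omega) (by omega)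

/-- Words in generators which satisfy the relations of the symmetric group take the same value as
soon as they represent the same permutation. -/
theorem CoxeterRel.prod_eq_of_sPerm_prod_eq {M : Type*} [Monoid M] {n : ℕ} {g : ℕ → M}
    (h : CoxeterRel n g) {w w' : List (Fin n)}
    (e : (w.map sPerm).prod = (w'.map sPerm).prod) :
    (w.map fun i : Fin n => g i).prod = (w'.map fun i : Fin n => g i).prod := by
  have hinv : ∀ u : List (Fin n),
      (u.reverse.map fun i : Fin n => g i).prod * (u.map fun i : Fin n => g i).prod = 1 := by
    intro u
    induction u with
    | nil => simp
    | cons i u ih =>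
      simp only [List.reverse_cons, List.map_append, List.map_cons, List.map_nil, List.prod_append,
        List.prod_cons, List.prod_nil, mul_one]
      rw [mul_assoc, ← mul_assoc (g i) (g i), h.sq i i.2, one_mul, ih]
  have hs : ∀ u : List (Fin n), (u.reverse.map sPerm).prod * (u.map sPerm).prod = 1 := by
    intro u
    induction u with
    | nil => simp
    | cons i u ih =>
      simp only [List.reverse_cons, List.map_append, List.map_cons, List.map_nil, List.prod_append,
        List.prod_cons, List.prod_nil, mul_one]
      rw [mul_assoc, ← mul_assoc (sPerm i) (sPerm i), sPerm, Equiv.swap_mul_self, one_mul, ih]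
  have key : ((w ++ w'.reverse).map fun i : Fin n => g i).prod = 1 := by
    have h0 := h.prod_eq_one ((w ++ w'.reverse).map fun i : Fin n => (i : ℕ)) (by
      intro i hi
      obtain ⟨j, -, rfl⟩ := List.mem_map.mp hi
      exact j.2) (by
      have e1 : ((w ++ w'.reverse).map sPerm).prod = 1 := by
        rw [List.map_append, List.prod_append, e]
        simpa using hs w'.reverse
      ext x
      by_cases hx : n < x
      · exact natSwap_prod_of_gt _ hx
      · have := val_sPerm_prod (w ++ w'.reverse) ⟨x, by omega⟩
        rw [e1] at this
        exact this.symm)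
    rw [List.map_map] at h0
    exact h0
  rw [List.map_append, List.prod_append] at key
  calc (w.map fun i : Fin n => g i).prod
      = (w.map fun i : Fin n => g i).prod *
          ((w'.reverse.map fun i : Fin n => g i).prod * (w'.map fun i : Fin n => g i).prod) := by
        rw [hinv, mul_one]
    _ = _ := by rw [← mul_assoc, key, one_mul]

/-! ### Local structure of reverse standard tableaux -/

section Tableaux

variable {n : ℕ} {lam : YoungDiagram}

lemma Filling.ext_row_col {f : Filling n lam} {a b : Fin (n + 1)} (h1 : f.row a = f.row b)
    (h2 : f.col a = f.col b) : a = b :=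
  f.injective (Subtype.ext (Prod.ext h1 h2))

lemma Filling.exists_label (f : Filling n lam) {r c : ℕ} {b : Fin (n + 1)} (hr : r ≤ f.row b)
    (hc : c ≤ f.col b) : ∃ a, f.row a = r ∧ f.col a = c := by
  have hmem : (r, c) ∈ lam.cells := lam.isLowerSet (show (r, c) ≤ (f b).1 from ⟨hr, hc⟩) (f b).2
  exact ⟨f.symm ⟨(r, c), hmem⟩, by simp [Filling.row], by simp [Filling.col]⟩

/-- Labels strictly decrease when moving weakly up and to the right. -/
lemma Filling.IsRST.lt {f : Filling n lam} (hf : f.IsRST) {a b : Fin (n + 1)} (hab : a ≠ b)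
    (hr : f.row a ≤ f.row b) (hc : f.col a ≤ f.col b) : b < a := by
  obtain ⟨d, hd1, hd2⟩ := f.exists_label hr le_rfl
  have h1 := (hf a d).1
  have h2 := (hf d b).2
  have e1 : f.row a = f.row d → f.col a = f.col d → a = d := Filling.ext_row_col
  have e2 : f.row d = f.row b → f.col d = f.col b → d = b := Filling.ext_row_col
  rcases hc.lt_or_eq with hc' | hc'
  · have h3 := h1 hd1.symm (by omega)
    rcases hr.lt_or_eq with hr' | hr'
    · exact (h2 hd2 (by omega)).trans h3
    · rwa [← e2 (by omega) (by omega)]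
  · rcases hr.lt_or_eq with hr' | hr'
    · rw [e1 (by omega) (by omega)]
      exact h2 hd2 (by omega)
    · exact absurd (Filling.ext_row_col hr' hc') hab

lemma Filling.isRST_iff {f : Filling n lam} : f.IsRST ↔
    ∀ a b, a ≠ b → f.row a ≤ f.row b → f.col a ≤ f.col b → b < a := by
  refine ⟨fun h a b hab hr hc => h.lt hab hr hc, fun h a b => ⟨fun hr hc => ?_, fun hc hr => ?_⟩⟩
  · exact h a b (by rintro rfl; omega) hr.le hc.le
  · exact h a b (by rintro rfl; omega) hr.le hc.le

lemma Filling.content_def (f : Filling n lam) (a : Fin (n + 1)) :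
    f.content a = (f.col a : ℤ) - f.row a := rfl

/-- Labels `a < b` on the same diagonal differ by at least three. -/
lemma Filling.IsRST.add_three_le {f : Filling n lam} (hf : f.IsRST) {a b : Fin (n + 1)}
    (hab : a < b) (h : f.content a = f.content b) : (a : ℕ) + 3 ≤ b := by
  rw [Filling.content_def, Filling.content_def] at h
  have hlt : f.row b < f.row a := by
    by_contra hcon
    exact absurd (hf.lt hab.ne (by omega) (by omega)) (by omega)
  have hlt' : f.col b < f.col a := by omega
  obtain ⟨d, hd1, hd2⟩ := f.exists_label (show f.row b + 1 ≤ f.row a by omega) hlt'.le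
  obtain ⟨e, he1, he2⟩ := f.exists_label hlt.le (show f.col b + 1 ≤ f.col a by omega)
  have h1 := hf.lt (a := b) (b := d) (by rintro rfl; omega) (by omega) (by omega)
  have h2 := hf.lt (a := d) (b := a) (by rintro rfl; omega) (by omega) (by omega)
  have h3 := hf.lt (a := b) (b := e) (by rintro rfl; omega) (by omega) (by omega)
  have h4 := hf.lt (a := e) (b := a) (by rintro rfl; omega) (by omega) (by omega)
  have h5 : (d : ℕ) ≠ e := fun h => by
    rw [Fin.val_inj] at h
    rw [h] at hd1
    omega
  rw [Fin.lt_def] at *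
  omega

lemma Filling.IsRST.content_ne {f : Filling n lam} (hf : f.IsRST) {a b : Fin (n + 1)}
    (hab : a ≠ b) (h1 : (a : ℕ) ≤ b + 2) (h2 : (b : ℕ) ≤ a + 2) : f.content a ≠ f.content b := by
  intro h
  rcases hab.lt_or_gt with hlt | hlt
  · have := hf.add_three_le hlt h
    omega
  · have := hf.add_three_le hlt h.symm
    omega

/-- If the cell of `k` lies weakly above and to the right of the cell of `k + 1`, then these cells
are adjacent. -/
lemma Filling.IsRST.adjacent {f : Filling n lam} (hf : f.IsRST) {a b : Fin (n + 1)}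
    (hab : (b : ℕ) = a + 1) (hr : f.row b ≤ f.row a) (hc : f.col b ≤ f.col a) :
    f.row a = f.row b ∧ f.col a = f.col b + 1 ∨ f.row a = f.row b + 1 ∧ f.col a = f.col b := by
  by_contra hcon
  have hne : a ≠ b := fun h => by rw [h] at hab; omega
  have hne' : ¬ (f.row a = f.row b ∧ f.col a = f.col b) := fun h =>
    hne (Filling.ext_row_col h.1 h.2)
  have key : ∀ r c, f.row b ≤ r → f.col b ≤ c → r ≤ f.row a → c ≤ f.col a →
      (r ≠ f.row b ∨ c ≠ f.col b) → (r ≠ f.row a ∨ c ≠ f.col a) → False := by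
    intro r c h1 h2 h3 h4 h5 h6
    obtain ⟨d, hd1, hd2⟩ := f.exists_label h3 h4
    have h1 := hf.lt (a := b) (b := d) (by rintro rfl; omega) (by omega) (by omega)
    have h2 := hf.lt (a := d) (b := a) (by rintro rfl; omega) (by omega) (by omega)
    rw [Fin.lt_def] at *
    omega
  by_cases h : f.row b < f.row a
  · exact key (f.row b + 1) (f.col b) (by omega) (by omega) (by omega) (by omega) (by omega)
      (by omega)
  · exact key (f.row b) (f.col b + 1) (by omega) (by omega) (by omega) (by omega) (by omega)
      (by omega)

/-- Consecutive labels whose contents differ by one are adjacent. -/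
lemma Filling.IsRST.adjacent_of_content {f : Filling n lam} (hf : f.IsRST) {a b : Fin (n + 1)}
    (hab : (b : ℕ) = a + 1) (h : |f.content a - f.content b| = 1) :
    f.row a = f.row b ∧ f.col a = f.col b + 1 ∨ f.row a = f.row b + 1 ∧ f.col a = f.col b := by
  have hne : a ≠ b := fun h => by rw [h] at hab; omega
  have hnot : ¬ (f.row a ≤ f.row b ∧ f.col a ≤ f.col b) := fun h => by
    have := hf.lt hne h.1 h.2
    rw [Fin.lt_def] at this
    omega
  rw [Filling.content_def, Filling.content_def, abs_eq one_pos.le] at h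
  exact hf.adjacent hab (by omega) (by omega)

lemma Filling.exchange_row (f : Filling n lam) (a b x : Fin (n + 1)) :
    (f.exchange a b).row x = f.row (Equiv.swap a b x) := rfl

lemma Filling.exchange_col (f : Filling n lam) (a b x : Fin (n + 1)) :
    (f.exchange a b).col x = f.col (Equiv.swap a b x) := rfl

lemma Filling.exchange_content (f : Filling n lam) (a b x : Fin (n + 1)) :
    (f.exchange a b).content x = f.content (Equiv.swap a b x) := rfl

lemma Filling.exchange_exchange (f : Filling n lam) (a b : Fin (n + 1)) :
    (f.exchange a b).exchange a b = f := by
  refine Equiv.ext fun x => ?_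
  simp [Filling.exchange]

/-- Exchanging two consecutive labels preserves reverse standard tableaux if and only if their
contents do not differ by one. -/
lemma Filling.IsRST.exchange_iff {f : Filling n lam} (hf : f.IsRST) {a b : Fin (n + 1)}
    (hab : (b : ℕ) = a + 1) : (f.exchange a b).IsRST ↔ |f.content a - f.content b| ≠ 1 := by
  have hne : a ≠ b := fun h => by rw [h] at hab; omega
  constructor
  · intro hex hcon
    have h1 := hex.lt (a := a) (b := b) hne
    rw [Filling.exchange_row, Filling.exchange_row, Filling.exchange_col, Filling.exchange_col,
      Equiv.swap_apply_left, Equiv.swap_apply_right, Fin.lt_def] at h1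
    have h2 := hf.adjacent_of_content hab hcon
    have := h1 (by omega) (by omega)
    omega
  · intro h
    rw [Filling.isRST_iff]
    intro x y hxy hr hc
    rw [Filling.exchange_row, Filling.exchange_row] at hr
    rw [Filling.exchange_col, Filling.exchange_col] at hc
    have h1 := hf.lt (fun e => hxy ((Equiv.swap a b).injective e)) hr hc
    by_contra hcon
    have hx : x = a ∧ y = b := by
      have hxy' : (x : ℕ) ≠ y := fun e => hxy (Fin.ext e)
      rw [Fin.lt_def] at hcon h1
      rw [Equiv.swap_apply_def, Equiv.swap_apply_def] at h1
      simp only [Fin.ext_iff]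
      split_ifs at h1 <;> simp only [Fin.ext_iff] at * <;> omega
    rw [hx.1, hx.2, Equiv.swap_apply_left, Equiv.swap_apply_right] at hr hc
    have h2 := hf.adjacent hab hr hc
    apply h
    rw [Filling.content_def, Filling.content_def, abs_eq one_pos.le]
    omega

end Tableaux

/-! ### The operators `murphy` satisfy the relations of the symmetric group -/

section Murphy

variable (K : Type*) [Field K] {n : ℕ} {lam : YoungDiagram}

/-- The inclusion of `V_λ` in the space with basis all the fillings. -/
def tabIncl : TabSpace K n lam →ₗ[K] (Filling n lam →₀ K) :=
  Finsupp.lmapDomain K K Subtype.val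

lemma tabIncl_single (τ : RST n lam) (x : K) :
    tabIncl K (Finsupp.single τ x) = Finsupp.single τ.1 x := by
  rw [tabIncl, Finsupp.lmapDomain_apply, Finsupp.mapDomain_single]

lemma tabIncl_injective : Function.Injective (tabIncl K (n := n) (lam := lam)) :=
  Finsupp.mapDomain_injective Subtype.val_injective

/-- The off-diagonal coefficient of the seminormal representation. -/
def murphyC (b : ℚ) : ℚ := if 0 < b ∧ b ≤ 1 / 2 then 1 else 1 - b ^ 2

lemma murphyC_mul_neg {m : ℤ} (hm : m ≠ 0) :
    murphyC (1 / m) * murphyC (-(1 / m)) = 1 - (1 / (m : ℚ)) ^ 2 := by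
  have hb : ((1 / (m : ℚ)) = 1 ∨ (1 / (m : ℚ)) = -1) ∨ (0 < 1 / (m : ℚ) ∧ 1 / (m : ℚ) ≤ 1 / 2) ∨
      (0 < -(1 / (m : ℚ)) ∧ -(1 / (m : ℚ)) ≤ 1 / 2) := by
    rcases (show m = 1 ∨ m = -1 ∨ 2 ≤ m ∨ m ≤ -2 by omega) with rfl | rfl | h | h
    · norm_num
    · norm_num
    · have : (2 : ℚ) ≤ m := by exact_mod_cast h
      exact Or.inr (Or.inl ⟨by positivity, one_div_le_one_div_of_le (by norm_num) this⟩)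
    · have : (2 : ℚ) ≤ -m := by exact_mod_cast (by omega : 2 ≤ -m)
      rw [← one_div_neg_eq_neg_one_div]
      exact Or.inr (Or.inr ⟨by positivity, one_div_le_one_div_of_le (by norm_num) this⟩)
  generalize 1 / (m : ℚ) = b at hb
  rcases hb with (rfl | rfl) | h | h
  · norm_num [murphyC]
  · norm_num [murphyC]
  · rw [murphyC, murphyC, if_pos h, if_neg (fun h' => by linarith [h.1, h'.1])]
    ring
  · rw [murphyC, murphyC, if_pos h, if_neg (fun h' => by linarith [h.1, h'.1])]
    ring

/-- The number `1 / (c - d)` attached to contents `c` and `d`. -/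
def invDiff (c d : ℤ) : ℚ := 1 / ((c : ℚ) - d)

lemma invDiff_swap (c d : ℤ) : invDiff d c = -invDiff c d := by
  rw [invDiff, invDiff, ← one_div_neg_eq_neg_one_div, neg_sub]

lemma murphyC_mul_murphyC {c d : ℤ} (h : c ≠ d) :
    murphyC (invDiff c d) * murphyC (invDiff d c) = 1 - invDiff c d ^ 2 := by
  rw [invDiff_swap c d, invDiff, ← Int.cast_sub]
  exact murphyC_mul_neg (sub_ne_zero.mpr h)

variable [Algebra ℚ K]

/-- The seminormal operator which exchanges the labels `a` and `b`, on the space with basis all the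
fillings. -/
def fillOp (a b : Fin (n + 1)) : (Filling n lam →₀ K) →ₗ[K] (Filling n lam →₀ K) :=
  Finsupp.linearCombination K fun f =>
    algebraMap ℚ K (invDiff (f.content a) (f.content b)) • Finsupp.single f 1 +
      algebraMap ℚ K (murphyC (invDiff (f.content a) (f.content b))) •
        Finsupp.single (f.exchange a b) 1

lemma fillOp_single (a b : Fin (n + 1)) (f : Filling n lam) :
    fillOp K a b (Finsupp.single f 1) =
      algebraMap ℚ K (invDiff (f.content a) (f.content b)) • Finsupp.single f 1 +
      algebraMap ℚ K (murphyC (invDiff (f.content a) (f.content b))) •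
        Finsupp.single (f.exchange a b) 1 := by
  rw [fillOp, Finsupp.linearCombination_single, one_smul]

lemma murphyB_eq (τ : RST n lam) (i : Fin n) :
    murphyB τ i = invDiff (τ.1.content i.castSucc) (τ.1.content i.succ) := rfl

lemma val_succ_eq (i : Fin n) : ((i.succ : Fin (n + 1)) : ℕ) = (i.castSucc : Fin (n + 1)) + 1 := by
  simp

lemma RST.content_ne (τ : RST n lam) (i : Fin n) :
    τ.1.content i.castSucc ≠ τ.1.content i.succ :=
  τ.2.content_ne (Fin.castSucc_lt_succ).ne (by simp; omega) (by simp)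

lemma invDiff_sq_eq_one_iff {c d : ℤ} : invDiff c d ^ 2 = 1 ↔ |c - d| = 1 := by
  rw [invDiff, one_div, inv_pow, inv_eq_one, ← Int.cast_sub, ← sq_abs, ← Int.cast_abs]
  norm_cast
  exact pow_eq_one_iff_of_nonneg (abs_nonneg _) two_ne_zero

lemma tabIncl_murphy (i : Fin n) (u : TabSpace K n lam) :
    tabIncl K (murphy K i u) = fillOp K i.castSucc i.succ (tabIncl K u) := by
  have : tabIncl K ∘ₗ murphy K i = fillOp K i.castSucc i.succ ∘ₗ tabIncl K (lam := lam) := by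
    refine Finsupp.lhom_ext' fun τ => LinearMap.ext_ring ?_
    simp only [LinearMap.comp_apply, Finsupp.lsingle_apply]
    rw [murphy, Finsupp.linearCombination_single, one_smul, tabIncl_single, fillOp_single,
      ← murphyB_eq, murphyVec, exchangeVec]
    have hiff := (τ.2.exchange_iff (val_succ_eq i))
    by_cases h1 : murphyB τ i ^ 2 = 1
    · rw [if_pos h1, tabIncl_single, murphyC, if_neg, h1]
      · simp
      · rintro ⟨h2, h3⟩
        nlinarith
    · rw [if_neg h1]
      rw [murphyB_eq, invDiff_sq_eq_one_iff] at h1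
      rw [dif_pos (hiff.mpr h1), murphyC]
      split_ifs with h2 <;> simp [tabIncl_single]
  exact LinearMap.congr_fun this u

lemma fillOp_sq {a b : Fin (n + 1)} {f : Filling n lam} (hab : f.content a ≠ f.content b) :
    fillOp K a b (fillOp K a b (Finsupp.single f 1)) = Finsupp.single f 1 := by
  have h := congrArg (algebraMap ℚ K) (murphyC_mul_murphyC hab)
  simp only [map_mul, map_sub, map_one, map_pow] at h
  simp only [fillOp_single, map_add, map_smul, Filling.exchange_content, Equiv.swap_apply_left,
    Equiv.swap_apply_right, Filling.exchange_exchange, invDiff_swap (f.content a) (f.content b),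
    map_neg] at h ⊢
  generalize algebraMap ℚ K (invDiff (f.content a) (f.content b)) = x at *
  generalize algebraMap ℚ K (murphyC (invDiff (f.content a) (f.content b))) = p at *
  generalize algebraMap ℚ K (murphyC (-invDiff (f.content a) (f.content b))) = q at *
  match_scalars
  · linear_combination h
  · ring

lemma fillOp_comm {a b c d : Fin (n + 1)} {f : Filling n lam} (hab : a ≠ b) (hcd : c ≠ d)
    (hac : a ≠ c) (had : a ≠ d) (hbc : b ≠ c) (hbd : b ≠ d) :
    fillOp K a b (fillOp K c d (Finsupp.single f 1)) =
      fillOp K c d (fillOp K a b (Finsupp.single f 1)) := by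
  have h : (f.exchange a b).exchange c d = (f.exchange c d).exchange a b := by
    have hd : Equiv.swap a b * Equiv.swap c d = Equiv.swap c d * Equiv.swap a b :=
      (Equiv.Perm.disjoint_swap_swap (by simp_all)).commute
    exact Equiv.ext fun x => congrArg f (DFunLike.congr_fun hd x)
  simp only [fillOp_single, map_add, map_smul, Filling.exchange_content,
    Equiv.swap_apply_of_ne_of_ne hac had, Equiv.swap_apply_of_ne_of_ne hbc hbd,
    Equiv.swap_apply_of_ne_of_ne hac.symm hbc.symm, Equiv.swap_apply_of_ne_of_ne had.symm hbd.symm,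
    h]
  match_scalars <;> ring

lemma invDiff_mul_invDiff {x y z : ℤ} (hxy : x ≠ y) (hyz : y ≠ z) (hxz : x ≠ z) :
    invDiff x y * invDiff y z = invDiff x z * (invDiff x y + invDiff y z) := by
  have h1 : (x : ℚ) - y ≠ 0 := sub_ne_zero.mpr (by exact_mod_cast hxy)
  have h2 : (y : ℚ) - z ≠ 0 := sub_ne_zero.mpr (by exact_mod_cast hyz)
  have h3 : (x : ℚ) - z ≠ 0 := sub_ne_zero.mpr (by exact_mod_cast hxz)
  rw [invDiff, invDiff, invDiff]
  field_simp
  ring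

lemma fillOp_braid {a b c : Fin (n + 1)} {f : Filling n lam} (hab : a ≠ b) (hac : a ≠ c)
    (hbc : b ≠ c) (h1 : f.content a ≠ f.content b) (h2 : f.content b ≠ f.content c)
    (h3 : f.content a ≠ f.content c) :
    fillOp K a b (fillOp K b c (fillOp K a b (Finsupp.single f 1))) =
      fillOp K b c (fillOp K a b (fillOp K b c (Finsupp.single f 1))) := by
  have h : ((f.exchange a b).exchange b c).exchange a b =
      ((f.exchange b c).exchange a b).exchange b c := by
    have hd : Equiv.swap a b * Equiv.swap b c * Equiv.swap a b =
        Equiv.swap b c * Equiv.swap a b * Equiv.swap b c := by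
      rw [Equiv.swap_mul_swap_mul_swap hab hac, Equiv.swap_comm a b, Equiv.swap_comm b c,
        Equiv.swap_mul_swap_mul_swap hbc.symm hac.symm, Equiv.swap_comm]
    exact Equiv.ext fun x => congrArg f (DFunLike.congr_fun hd x)
  have e1 := congrArg (algebraMap ℚ K) (murphyC_mul_murphyC h1)
  have e2 := congrArg (algebraMap ℚ K) (murphyC_mul_murphyC h2)
  have e3 := congrArg (algebraMap ℚ K) (invDiff_mul_invDiff h1 h2 h3)
  simp only [fillOp_single, map_add, map_smul, Filling.exchange_content, Equiv.swap_apply_left,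
    Equiv.swap_apply_right, Equiv.swap_apply_of_ne_of_ne hac.symm hbc.symm,
    Equiv.swap_apply_of_ne_of_ne hab hac,
    Filling.exchange_exchange, invDiff_swap (f.content a) (f.content b),
    invDiff_swap (f.content b) (f.content c), h,
    map_neg, map_mul, map_sub, map_one, map_pow] at e1 e2 e3 ⊢
  generalize algebraMap ℚ K (invDiff (f.content a) (f.content b)) = x at *
  generalize algebraMap ℚ K (invDiff (f.content b) (f.content c)) = y at *
  generalize algebraMap ℚ K (invDiff (f.content a) (f.content c)) = z at *
  generalize algebraMap ℚ K (murphyC (invDiff (f.content a) (f.content b))) = p1 at *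
  generalize algebraMap ℚ K (murphyC (-invDiff (f.content a) (f.content b))) = p2 at *
  generalize algebraMap ℚ K (murphyC (invDiff (f.content b) (f.content c))) = q1 at *
  generalize algebraMap ℚ K (murphyC (-invDiff (f.content b) (f.content c))) = q2 at *
  match_scalars
  · linear_combination z * e1 - z * e2 + (x - y) * e3
  · linear_combination p1 * e3
  · linear_combination -q1 * e3
  all_goals ring

lemma murphy_sq (i : Fin n) (u : TabSpace K n lam) : murphy K i (murphy K i u) = u := by
  have : murphy K i ∘ₗ murphy K i = LinearMap.id (M := TabSpace K n lam) := by
    refine Finsupp.lhom_ext' fun τ => LinearMap.ext_ring (tabIncl_injective K ?_)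
    simp only [LinearMap.comp_apply, Finsupp.lsingle_apply, tabIncl_murphy, tabIncl_single,
      LinearMap.id_apply]
    exact fillOp_sq K (τ.content_ne i)
  exact LinearMap.congr_fun this u

lemma murphy_comm {i j : Fin n} (hij : (i : ℕ) + 1 < j) (u : TabSpace K n lam) :
    murphy K i (murphy K j u) = murphy K j (murphy K i u) := by
  have : murphy K i ∘ₗ murphy K j = murphy K j ∘ₗ murphy K i (lam := lam) := by
    refine Finsupp.lhom_ext' fun τ => LinearMap.ext_ring (tabIncl_injective K ?_)
    simp only [LinearMap.comp_apply, Finsupp.lsingle_apply, tabIncl_murphy, tabIncl_single]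
    apply fillOp_comm <;> simp only [ne_eq, Fin.ext_iff, Fin.val_castSucc, Fin.val_succ] <;> omega
  exact LinearMap.congr_fun this u

lemma murphy_braid {i j : Fin n} (hij : (j : ℕ) = i + 1) (u : TabSpace K n lam) :
    murphy K i (murphy K j (murphy K i u)) = murphy K j (murphy K i (murphy K j u)) := by
  have : murphy K i ∘ₗ murphy K j ∘ₗ murphy K i =
      murphy K j ∘ₗ murphy K i ∘ₗ murphy K j (lam := lam) := by
    refine Finsupp.lhom_ext' fun τ => LinearMap.ext_ring (tabIncl_injective K ?_)
    simp only [LinearMap.comp_apply, Finsupp.lsingle_apply, tabIncl_murphy, tabIncl_single]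
    have hj : j.castSucc = i.succ := by simp [Fin.ext_iff, hij]
    rw [hj]
    have h1 : i.castSucc ≠ i.succ := by simp [Fin.ext_iff]
    have h2 : i.castSucc ≠ j.succ := by simp [Fin.ext_iff, hij]; omega
    have h3 : i.succ ≠ j.succ := by simp [Fin.ext_iff, hij]
    apply fillOp_braid K h1 h2 h3 <;> apply τ.2.content_ne <;>
      first | assumption | (simp; done) | (simp; omega)
  exact LinearMap.congr_fun this u

end Murphy

section GroupAction

variable (K : Type*) [Field K] [Algebra ℚ K] {n : ℕ} {lam : YoungDiagram}

/-- The operators `murphy K i` as elements of the opposite of the algebra of endomorphisms. -/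
def murphyGen (n : ℕ) (lam : YoungDiagram) (k : ℕ) : (Module.End K (TabSpace K n lam))ᵐᵒᵖ :=
  if h : k < n then MulOpposite.op (murphy K ⟨k, h⟩) else 1

lemma murphyGen_coxeterRel : CoxeterRel n (murphyGen K n lam) where
  sq i hi := by
    rw [murphyGen, dif_pos hi, ← MulOpposite.op_mul, ← MulOpposite.op_one]
    exact congrArg _ (LinearMap.ext fun u => murphy_sq K _ u)
  comm i j hij hj := by
    rw [murphyGen, murphyGen, dif_pos hj, dif_pos (by omega), ← MulOpposite.op_mul,
      ← MulOpposite.op_mul]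
    exact congrArg _ (LinearMap.ext fun u => (murphy_comm K (by simpa using hij) u).symm)
  braid i hi := by
    rw [murphyGen, murphyGen, dif_pos hi, dif_pos (by omega)]
    simp only [← MulOpposite.op_mul]
    exact congrArg _ (LinearMap.ext fun u => murphy_braid K (by simp) u)

lemma murphyGen_prod (w : List (Fin n)) :
    (w.map fun i : Fin n => murphyGen K n lam i).prod = MulOpposite.op (wordAct K w) := by
  induction w with
  | nil => rfl
  | cons i w ih =>
    rw [List.map_cons, List.prod_cons, ih, murphyGen, dif_pos i.2, ← MulOpposite.op_mul]
    rfl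

lemma wordAct_eq {w w' : List (Fin n)} (e : (w.map sPerm).prod = (w'.map sPerm).prod) :
    wordAct K w = wordAct K w' (lam := lam) := by
  have := (murphyGen_coxeterRel K (lam := lam)).prod_eq_of_sPerm_prod_eq e
  rw [murphyGen_prod, murphyGen_prod] at this
  exact MulOpposite.op_injective this

lemma tabAct_prod (w : List (Fin n)) :
    tabAct K (w.map sPerm).prod = wordAct K w (lam := lam) :=
  wordAct_eq K (exists_word _).choose_spec

lemma wordAct_append (w w' : List (Fin n)) :
    wordAct K (w ++ w') = wordAct K w' ∘ₗ wordAct K w (lam := lam) := by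
  induction w with
  | nil => rfl
  | cons i w ih => rw [List.cons_append, wordAct, ih, wordAct]; rfl

lemma tabAct_mul (a b : Equiv.Perm (Fin (n + 1))) :
    tabAct K (a * b) = tabAct K b ∘ₗ tabAct K a (lam := lam) := by
  obtain ⟨u, rfl⟩ := exists_word a
  obtain ⟨w, rfl⟩ := exists_word b
  rw [← List.prod_append, ← List.map_append, tabAct_prod, tabAct_prod, tabAct_prod, wordAct_append]

lemma tabAct_one : tabAct K (1 : Equiv.Perm (Fin (n + 1))) = LinearMap.id (M := TabSpace K n lam) :=
  tabAct_prod K []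

lemma tabAct_sPerm (i : Fin n) : tabAct K (sPerm i) = murphy K i (lam := lam) := by
  have := tabAct_prod K [i] (lam := lam)
  rw [List.map_singleton, List.prod_singleton] at this
  rw [this]
  rfl

lemma tabAct_injective (a : Equiv.Perm (Fin (n + 1))) :
    Function.Injective (tabAct K a (lam := lam)) := by
  refine Function.LeftInverse.injective (g := tabAct K a⁻¹) fun u => ?_
  rw [← LinearMap.comp_apply, ← tabAct_mul, mul_inv_cancel, tabAct_one, LinearMap.id_apply]

omit [Algebra ℚ K] in
lemma polyAct_mul (a b : Equiv.Perm (Fin (n + 1))) :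
    polyAct K (a * b) = polyAct K b ∘ₗ polyAct K a := by
  refine LinearMap.ext fun p => ?_
  simp only [polyAct, LinearMap.comp_apply, AlgHom.toLinearMap_apply, MvPolynomial.rename_rename,
    mul_inv_rev]
  rfl

omit [Algebra ℚ K] in
lemma polyAct_one : polyAct K (1 : Equiv.Perm (Fin (n + 1))) = LinearMap.id := by
  refine LinearMap.ext fun p => ?_
  simp only [polyAct, AlgHom.toLinearMap_apply, inv_one, LinearMap.id_apply]
  exact MvPolynomial.rename_id_apply p

/-- The operator `ω ⊗ ω`. -/
def permOp (ω : Equiv.Perm (Fin (n + 1))) : VPoly K n lam →ₗ[K] VPoly K n lam :=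
  TensorProduct.map (polyAct K ω) (tabAct K ω)

lemma permOp_mul (a b : Equiv.Perm (Fin (n + 1))) :
    permOp K (a * b) = permOp K b ∘ₗ permOp K a (lam := lam) := by
  rw [permOp, polyAct_mul, tabAct_mul, TensorProduct.map_comp, permOp, permOp]

lemma permOp_mul_apply (a b : Equiv.Perm (Fin (n + 1))) (p : VPoly K n lam) :
    permOp K (a * b) p = permOp K b (permOp K a p) := by
  rw [permOp_mul, LinearMap.comp_apply]

lemma permOp_one : permOp K (1 : Equiv.Perm (Fin (n + 1))) = LinearMap.id (M := VPoly K n lam) := by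
  rw [permOp, polyAct_one, tabAct_one, TensorProduct.map_id]

lemma sOp_eq_permOp (i : Fin n) : sOp K i = permOp K (sPerm i) (lam := lam) := by
  rw [permOp, tabAct_sPerm, sOp]

lemma symOp_apply (p : VPoly K n lam) : symOp K p = ∑ ω, permOp K ω p := by
  rw [symOp, LinearMap.sum_apply]
  rfl

lemma symOp_sOp (i : Fin n) (p : VPoly K n lam) : symOp K (sOp K i p) = symOp K p := by
  rw [symOp_apply, symOp_apply, sOp_eq_permOp,
    ← Equiv.sum_comp (Equiv.mulLeft (sPerm i)) fun ω => permOp K ω p]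
  exact Finset.sum_congr rfl fun ω _ => (permOp_mul_apply K _ _ p).symm

lemma IsSymmetric.permOp_eq {p : VPoly K n lam} (h : IsSymmetric p)
    (ω : Equiv.Perm (Fin (n + 1))) : permOp K ω p = p := by
  obtain ⟨w, rfl⟩ := exists_word ω
  induction w with
  | nil => exact LinearMap.congr_fun (permOp_one K) p
  | cons i w ih => rw [List.map_cons, List.prod_cons, permOp_mul_apply, ← sOp_eq_permOp, h i, ih]

lemma IsSymmetric.symOp_eq {p : VPoly K n lam} (h : IsSymmetric p) :
    symOp K p = ((n + 1).factorial : K) • p := by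
  rw [symOp_apply, Finset.sum_congr rfl fun ω _ => h.permOp_eq K ω, Finset.sum_const,
    Finset.card_univ, Fintype.card_perm, Fintype.card_fin, Nat.cast_smul_eq_nsmul]

lemma sPerm_mul_self (i : Fin n) : sPerm i * sPerm i = 1 := Equiv.swap_mul_self _ _

lemma sPerm_comm {i j : Fin n} (hij : (i : ℕ) + 1 < j) :
    sPerm i * sPerm j = sPerm j * sPerm i :=
  (Equiv.Perm.disjoint_swap_swap (by simp [Fin.ext_iff]; omega)).commute

lemma sPerm_braid {i j : Fin n} (hij : (j : ℕ) = i + 1) :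
    sPerm i * sPerm j * sPerm i = sPerm j * sPerm i * sPerm j := by
  have hj : j.castSucc = i.succ := by simp [Fin.ext_iff, hij]
  have h1 : i.castSucc ≠ i.succ := by simp [Fin.ext_iff]
  have h2 : i.castSucc ≠ j.succ := by simp [Fin.ext_iff, hij]; omega
  have h3 : i.succ ≠ j.succ := by simp [Fin.ext_iff, hij]
  rw [sPerm, sPerm, hj, Equiv.swap_mul_swap_mul_swap h1 h2, Equiv.swap_comm i.castSucc i.succ,
    Equiv.swap_comm i.succ j.succ, Equiv.swap_mul_swap_mul_swap h3.symm h2.symm, Equiv.swap_comm]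

lemma sOp_sOp (i : Fin n) (p : VPoly K n lam) : sOp K i (sOp K i p) = p := by
  rw [sOp_eq_permOp, ← permOp_mul_apply, sPerm_mul_self, permOp_one, LinearMap.id_apply]

lemma sOp_comm {i j : Fin n} (hij : (i : ℕ) + 1 < j) (p : VPoly K n lam) :
    sOp K i (sOp K j p) = sOp K j (sOp K i p) := by
  rw [sOp_eq_permOp, sOp_eq_permOp, ← permOp_mul_apply, ← permOp_mul_apply, sPerm_comm hij]

lemma sOp_braid {i j : Fin n} (hij : (j : ℕ) = i + 1) (p : VPoly K n lam) :
    sOp K i (sOp K j (sOp K i p)) = sOp K j (sOp K i (sOp K j p)) := by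
  rw [sOp_eq_permOp, sOp_eq_permOp]
  simp only [← permOp_mul_apply]
  rw [sPerm_braid hij]

/-! ### The affine operator -/

lemma natSwap_range_prod (m x : ℕ) : ((List.range m).map natSwap).prod x =
    if x < m then x + 1 else if x = m then 0 else x := by
  induction m generalizing x with
  | zero => simp
  | succ m ih =>
    rw [List.range_succ, List.map_append, List.prod_append, Equiv.Perm.mul_apply, List.map_singleton,
      List.prod_singleton, ih, natSwap, Equiv.swap_apply_def]
    split_ifs <;> omega

lemma finRotate_castSucc (i : Fin n) : finRotate (n + 1) i.castSucc = i.succ := by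
  rw [Fin.ext_iff, coe_finRotate, if_neg (Fin.castSucc_lt_last i).ne]
  simp

lemma sPerm_finRange_prod : ((List.finRange n).map sPerm).prod = finRotate (n + 1) := by
  ext x
  rw [val_sPerm_prod, List.map_coe_finRange_eq_range, natSwap_range_prod]
  refine Fin.lastCases ?_ (fun i => ?_) x
  · simp
  · simp

lemma sPerm_mul_finRotate {i j : Fin n} (hij : (j : ℕ) = i + 1) :
    sPerm j * finRotate (n + 1) = finRotate (n + 1) * sPerm i := by
  have hj : i.succ = j.castSucc := by simp [Fin.ext_iff, hij]
  have : sPerm j = finRotate (n + 1) * sPerm i * (finRotate (n + 1))⁻¹ := by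
    rw [sPerm, sPerm, ← Equiv.swap_apply_apply, finRotate_castSucc, hj, finRotate_castSucc]
  rw [this, inv_mul_cancel_right]

lemma sPerm_mul_finRotate_sq {i j : Fin n} (hi : (i : ℕ) = 0) (hj : (j : ℕ) + 1 = n) :
    sPerm i * (finRotate (n + 1) * finRotate (n + 1)) =
      finRotate (n + 1) * finRotate (n + 1) * sPerm j := by
  have hj' : j.succ = Fin.last n := by simp [Fin.ext_iff, hj]
  have hi' : (0 : Fin (n + 1)) = i.castSucc := by simp [Fin.ext_iff, hi]
  have : sPerm i = (finRotate (n + 1) * finRotate (n + 1)) * sPerm j *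
      (finRotate (n + 1) * finRotate (n + 1))⁻¹ := by
    rw [sPerm, sPerm, ← Equiv.swap_apply_apply, Equiv.Perm.mul_apply, Equiv.Perm.mul_apply,
      finRotate_castSucc, hj', finRotate_last, hi', finRotate_castSucc]
  rw [this, inv_mul_cancel_right]

/-- Multiplication by the variable `x_k`. -/
def mulX (k : Fin (n + 1)) : VPoly K n lam →ₗ[K] VPoly K n lam :=
  TensorProduct.map (LinearMap.mulLeft K (MvPolynomial.X k)) LinearMap.id

omit [Algebra ℚ K] in
lemma mulX_comm (k l : Fin (n + 1)) (p : VPoly K n lam) :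
    mulX K k (mulX K l p) = mulX K l (mulX K k p) := by
  rw [mulX, mulX, ← LinearMap.comp_apply, ← LinearMap.comp_apply, ← TensorProduct.map_comp,
    ← TensorProduct.map_comp, ← LinearMap.mulLeft_mul, ← LinearMap.mulLeft_mul, mul_comm]

lemma permOp_mulX (ω : Equiv.Perm (Fin (n + 1))) (k : Fin (n + 1)) (p : VPoly K n lam) :
    permOp K ω (mulX K k p) = mulX K (ω⁻¹ k) (permOp K ω p) := by
  rw [mulX, mulX, permOp, ← LinearMap.comp_apply, ← LinearMap.comp_apply, ← TensorProduct.map_comp,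
    ← TensorProduct.map_comp, LinearMap.id_comp, LinearMap.comp_id]
  congr 2
  refine LinearMap.ext fun q => ?_
  simp [polyAct]

lemma psiOp_apply (p : VPoly K n lam) :
    psiOp K p = mulX K (Fin.last n) (permOp K (finRotate (n + 1)) p) := by
  rw [mulX, permOp, ← LinearMap.comp_apply, ← TensorProduct.map_comp, LinearMap.id_comp, psiOp,
    ← tabAct_prod, sPerm_finRange_prod]

lemma psiOp_sOp {i j : Fin n} (hij : (j : ℕ) = i + 1) (p : VPoly K n lam) :
    psiOp K (sOp K j p) = sOp K i (psiOp K p) := by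
  rw [psiOp_apply, psiOp_apply, sOp_eq_permOp, sOp_eq_permOp, permOp_mulX, ← permOp_mul_apply,
    ← permOp_mul_apply, sPerm_mul_finRotate hij]
  congr 1
  rw [sPerm, Equiv.swap_inv, Equiv.swap_apply_of_ne_of_ne] <;> simp [Fin.ext_iff] <;> omega

lemma psiOp_psiOp_sOp {i j : Fin n} (hi : (i : ℕ) = 0) (hj : (j : ℕ) + 1 = n) (p : VPoly K n lam) :
    psiOp K (psiOp K (sOp K i p)) = sOp K j (psiOp K (psiOp K p)) := by
  simp only [psiOp_apply, sOp_eq_permOp, permOp_mulX, ← permOp_mul_apply]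
  rw [mul_assoc, sPerm_mul_finRotate_sq hi hj]
  have h1 : (finRotate (n + 1))⁻¹ (Fin.last n) = j.castSucc := by
    rw [Equiv.Perm.inv_eq_iff_eq, finRotate_castSucc, Fin.ext_iff]
    simpa using hj.symm
  have h2 : (sPerm j)⁻¹ j.castSucc = Fin.last n := by
    rw [sPerm, Equiv.swap_inv, Equiv.swap_apply_left, Fin.ext_iff]
    simpa using hj
  have h3 : (sPerm j)⁻¹ (Fin.last n) = j.castSucc := by
    rw [← h2, sPerm, Equiv.swap_inv, Equiv.swap_apply_self]
  rw [h1, h2, h3, mulX_comm]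

end GroupAction

/-! ### Coefficients -/

section Coeff

variable (K : Type*) [Field K] {n : ℕ} {lam : YoungDiagram}

/-- The coefficient of the monomial `x^w`, an element of `V_λ`. -/
def coeffV (w : Fin (n + 1) → ℕ) : VPoly K n lam →ₗ[K] TabSpace K n lam :=
  (TensorProduct.lid K _).toLinearMap ∘ₗ
    LinearMap.rTensor _ (MvPolynomial.lcoeff K (Finsupp.equivFunOnFinite.symm w))

lemma coeffV_tmul (w : Fin (n + 1) → ℕ) (p : MvPolynomial (Fin (n + 1)) K) (u : TabSpace K n lam) :
    coeffV K w (p ⊗ₜ u) = p.coeff (Finsupp.equivFunOnFinite.symm w) • u := by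
  simp [coeffV]

variable [Algebra ℚ K]

lemma coeffV_permOp (w : Fin (n + 1) → ℕ) (ω : Equiv.Perm (Fin (n + 1))) (p : VPoly K n lam) :
    coeffV K (w ∘ ω) (permOp K ω p) = tabAct K ω (coeffV K w p) := by
  induction p using TensorProduct.induction_on with
  | zero => simp
  | add x y hx hy => simp only [map_add, hx, hy]
  | tmul p u =>
    rw [permOp, TensorProduct.map_tmul, coeffV_tmul, coeffV_tmul, map_smul, polyAct,
      AlgHom.toLinearMap_apply]
    congr 1
    rw [← MvPolynomial.coeff_rename_mapDomain (ω⁻¹ : Equiv.Perm (Fin (n + 1)))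
      (Equiv.injective _) p]
    congr 1
    ext x
    simp

lemma coeffV_sOp (w : Fin (n + 1) → ℕ) (i : Fin n) (p : VPoly K n lam) :
    coeffV K w (sOp K i p) = murphy K i (coeffV K (w ∘ sPerm i) p) := by
  rw [← tabAct_sPerm, ← coeffV_permOp, sOp_eq_permOp]
  congr 2
  funext x
  simp [sPerm]

omit [Algebra ℚ K] in
lemma coeffV_mulX (w : Fin (n + 1) → ℕ) (k : Fin (n + 1)) (p : VPoly K n lam) :
    coeffV K w (mulX K k p) =
      if w k = 0 then 0 else coeffV K (Function.update w k (w k - 1)) p := by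
  induction p using TensorProduct.induction_on with
  | zero => simp
  | add x y hx hy =>
    simp only [map_add, hx, hy]
    split_ifs <;> simp
  | tmul p u =>
    rw [mulX, TensorProduct.map_tmul, coeffV_tmul, coeffV_tmul, LinearMap.mulLeft_apply,
      MvPolynomial.coeff_X_mul', LinearMap.id_apply]
    by_cases h : w k = 0
    · simp [h]
    · rw [if_pos (by simpa using h), if_neg h]
      congr 2
      ext x
      by_cases hx : x = k
      · subst hx
        simp
      · simp [hx]

/-- The action of `Ψ` on the exponents. -/
def psiWt (u : Fin (n + 1) → ℕ) : Fin (n + 1) → ℕ :=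
  Fin.snoc (α := fun _ => ℕ) (Fin.tail u) (u 0 + 1)

/-- The inverse of `psiWt` on the exponents with nonzero last entry. -/
def psiWtInv (w : Fin (n + 1) → ℕ) : Fin (n + 1) → ℕ :=
  Fin.cons (α := fun _ => ℕ) (w (Fin.last n) - 1) (Fin.init w)

lemma psiWt_castSucc (u : Fin (n + 1) → ℕ) (i : Fin n) : psiWt u i.castSucc = u i.succ := by
  simp [psiWt, Fin.tail]

lemma psiWt_last (u : Fin (n + 1) → ℕ) : psiWt u (Fin.last n) = u 0 + 1 := by
  simp [psiWt]

lemma psiWt_psiWtInv {w : Fin (n + 1) → ℕ} (h : w (Fin.last n) ≠ 0) : psiWt (psiWtInv w) = w := by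
  ext x
  refine Fin.lastCases ?_ (fun i => ?_) x
  · rw [psiWt_last, psiWtInv, Fin.cons_zero]
    omega
  · rw [psiWt_castSucc, psiWtInv, Fin.cons_succ, Fin.init]

lemma psiWt_injective : Function.Injective (psiWt (n := n)) := by
  intro u v h
  ext x
  refine Fin.cases ?_ (fun i => ?_) x
  · have := congrFun h (Fin.last n)
    rw [psiWt_last, psiWt_last] at this
    omega
  · rw [← psiWt_castSucc u, ← psiWt_castSucc v, h]

lemma coeffV_psiOp (u : Fin (n + 1) → ℕ) (p : VPoly K n lam) :
    coeffV K (psiWt u) (psiOp K p) = tabAct K (finRotate (n + 1)) (coeffV K u p) := by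
  rw [psiOp_apply, coeffV_mulX, if_neg (by rw [psiWt_last]; omega), ← coeffV_permOp]
  congr 2
  ext x
  refine Fin.lastCases ?_ (fun i => ?_) x
  · rw [Function.update_self, psiWt_last, Function.comp_apply, finRotate_last]
    rfl
  · rw [Function.update_of_ne (Fin.castSucc_lt_last i).ne, psiWt_castSucc, Function.comp_apply,
      finRotate_castSucc]

lemma coeffV_psiOp_of_eq_zero {w : Fin (n + 1) → ℕ} (h : w (Fin.last n) = 0) (p : VPoly K n lam) :
    coeffV K w (psiOp K p) = 0 := by
  rw [psiOp_apply, coeffV_mulX, if_pos h]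

end Coeff

/-! ### The vertices of the Yang--Baxter graph -/

section Vertices

variable {n : ℕ} {lam : YoungDiagram}

lemma Filling.IsRST.not_row_lt {f g : Filling n lam} (hg : g.IsRST) {a : Fin (n + 1)}
    (hc : f.content a = g.content a) (h : ∀ b, a < b → f b = g b) : ¬ f.row a < g.row a := by
  intro hlt
  rw [Filling.content_def, Filling.content_def] at hc
  obtain ⟨b, hb1, hb2⟩ := g.exists_label hlt.le (show f.col a ≤ g.col a by omega)
  have hab : a < b := hg.lt (by rintro rfl; omega) (by omega) (by omega)
  have : f b = f a := (h b hab).trans (Subtype.ext (Prod.ext hb1 hb2))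
  exact hab.ne' (f.injective this)

/-- A reverse standard tableau is determined by its contents. -/
lemma RST.ext_content {τ τ' : RST n lam} (h : ∀ a, τ.1.content a = τ'.1.content a) : τ = τ' := by
  have key : ∀ m : ℕ, ∀ a : Fin (n + 1), n - (a : ℕ) = m → τ.1 a = τ'.1 a := by
    intro m
    induction m using Nat.strong_induction_on with
    | _ m ih =>
      intro a ha
      have hb : ∀ b, a < b → τ.1 b = τ'.1 b := fun b hb => ih (n - b) (by omega) b rfl
      have h1 := τ'.2.not_row_lt (h a) hb
      have h2 := τ.2.not_row_lt (h a).symm fun b hab => (hb b hab).symm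
      have h3 := h a
      rw [Filling.content_def, Filling.content_def] at h3
      exact Subtype.ext (Prod.ext (show τ.1.row a = τ'.1.row a by omega)
        (show τ.1.col a = τ'.1.col a by omega))
  exact Subtype.ext (Equiv.ext fun a => key _ a rfl)

/-- The pair formed of an entry of `v` and of the corresponding content; it determines the entry of
the spectral vector. -/
def Quad.key {K : Type*} (q : Quad K n lam) (i : Fin (n + 1)) : ℕ × ℤ :=
  (q.wt i, q.tab.1.content (q.perm i))

/-- The entry of the spectral vector attached to a pair `(v[i], CT)`. -/
def keyVal {K : Type*} [Field K] (α : K) (x : ℕ × ℤ) : K := α * x.1 + x.2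

/-- The condition on the pairs in positions `i`, `i + 1` for an arrow `s_i` to start at a vertex. -/
def KeyUp (x y : ℕ × ℤ) : Prop := x.1 < y.1 ∨ x.1 = y.1 ∧ y.2 + 2 ≤ x.2

/-- The condition on the pairs in positions `i`, `i + 1` for a fall. -/
def KeyFall (x y : ℕ × ℤ) : Prop := x.1 = y.1 ∧ |x.2 - y.2| = 1

lemma KeyUp.trans {x y z : ℕ × ℤ} (h1 : KeyUp x y) (h2 : KeyUp y z) : KeyUp x z := by
  rw [KeyUp] at *
  omega

lemma KeyUp.not_fall {x y : ℕ × ℤ} (h : KeyUp x y) : ¬ KeyFall x y := by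
  rw [KeyUp] at h
  rw [KeyFall, abs_eq one_pos.le]
  omega

lemma KeyFall.symm {x y : ℕ × ℤ} (h : KeyFall x y) : KeyFall y x :=
  ⟨h.1.symm, by rw [abs_sub_comm]; exact h.2⟩

lemma KeyUp.not_fall' {x y : ℕ × ℤ} (h : KeyUp x y) : ¬ KeyFall y x := fun h' => h.not_fall h'.symm

lemma KeyUp.ne {x y : ℕ × ℤ} (h : KeyUp x y) : x ≠ y := by
  rintro rfl
  rw [KeyUp] at h
  omega

lemma KeyFall.ne {x y : ℕ × ℤ} (h : KeyFall x y) : x ≠ y := by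
  rintro rfl
  rw [KeyFall, sub_self] at h
  simp at h

lemma keyVal_injective {K : Type*} [Field K] [Algebra ℚ K] {α : K} (hα : Transcendental ℚ α) :
    Function.Injective (keyVal α) := by
  have := algebraRat.charZero K
  intro x y h
  rw [keyVal, keyVal] at h
  have h0 : ((x.1 : ℤ) - y.1 : ℤ) = 0 := by
    by_contra hne
    have hne' : (((x.1 : ℤ) - y.1 : ℤ) : K) ≠ 0 := by exact_mod_cast hne
    have e : α = algebraMap ℚ K (((y.2 - x.2 : ℤ) : ℚ) / (((x.1 : ℤ) - y.1 : ℤ) : ℚ)) := by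
      rw [map_div₀, map_intCast, map_intCast, eq_div_iff hne']
      push_cast
      linear_combination h
    exact hα (e ▸ isAlgebraic_algebraMap _)
  have h1 : x.1 = y.1 := by omega
  rw [h1] at h
  have h2 : (x.2 : K) = y.2 := by linear_combination h
  exact Prod.ext h1 (by exact_mod_cast h2)

/-- The conditions which characterize the vertices of `G_λ`. -/
structure Quad.Good {K : Type*} [Field K] (α : K) (q : Quad K n lam) : Prop where
  spec_eq : ∀ i, q.spec i = keyVal α (q.key i)
  perm_lt_iff : ∀ i j, q.perm i < q.perm j ↔ q.wt j < q.wt i ∨ q.wt i = q.wt j ∧ i < j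

lemma perm_ext_of_lt_iff {m : ℕ} {σ σ' : Equiv.Perm (Fin m)}
    (h : ∀ i j, σ i < σ j ↔ σ' i < σ' j) : σ = σ' := by
  have hmono : StrictMono (σ' ∘ σ.symm) := fun a b hab => by
    rw [Function.comp_apply, Function.comp_apply, ← h, σ.apply_symm_apply, σ.apply_symm_apply]
    exact hab
  have := (hmono.range_inj strictMono_id).mp (by
    rw [Set.range_id, (σ'.surjective.comp σ.symm.surjective).range_eq])
  ext x
  have h2 := congrFun this (σ x)
  rw [Function.comp_apply, σ.symm_apply_apply, id] at h2
  rw [h2]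

lemma sPerm_castSucc (i : Fin n) : sPerm i i.castSucc = i.succ := Equiv.swap_apply_left _ _

lemma sPerm_succ (i : Fin n) : sPerm i i.succ = i.castSucc := Equiv.swap_apply_right _ _

lemma sPerm_sPerm (i : Fin n) (x : Fin (n + 1)) : sPerm i (sPerm i x) = x :=
  Equiv.swap_apply_self _ _ _

lemma sPerm_of_ne {i : Fin n} {x : Fin (n + 1)} (h1 : x ≠ i.castSucc) (h2 : x ≠ i.succ) :
    sPerm i x = x := Equiv.swap_apply_of_ne_of_ne h1 h2

lemma sPerm_lt_iff {i : Fin n} {a b : Fin (n + 1)} (h1 : ¬ (a = i.castSucc ∧ b = i.succ))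
    (h2 : ¬ (a = i.succ ∧ b = i.castSucc)) : sPerm i a < sPerm i b ↔ a < b := by
  rw [Fin.lt_def, Fin.lt_def, sPerm, Equiv.swap_apply_def, Equiv.swap_apply_def]
  simp only [Fin.ext_iff, Fin.val_castSucc, Fin.val_succ] at *
  split_ifs <;> simp only [Fin.val_castSucc, Fin.val_succ] <;> omega

variable {K : Type*} [Field K] {α : K}

lemma Quad.Good.ext_key {q q' : Quad K n lam} (h : q.Good α) (h' : q'.Good α)
    (e : q.key = q'.key) : q = q' := by
  have hwt : q.wt = q'.wt := funext fun i => congrArg Prod.fst (congrFun e i)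
  have hperm : q.perm = q'.perm := perm_ext_of_lt_iff fun i j => by
    rw [h.perm_lt_iff, h'.perm_lt_iff, hwt]
  refine Quad.ext (RST.ext_content fun a => ?_) (funext fun i => ?_) hwt hperm
  · have h1 := congrArg Prod.snd (congrFun e (q.perm.symm a))
    rw [Quad.key, Quad.key, ← hperm, Equiv.apply_symm_apply] at h1
    exact h1
  · rw [h.spec_eq, h'.spec_eq, e]

lemma Quad.Good.ext_wt_tab {q q' : Quad K n lam} (h : q.Good α) (h' : q'.Good α)
    (hwt : q.wt = q'.wt) (htab : q.tab = q'.tab) : q = q' := by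
  have hperm : q.perm = q'.perm := perm_ext_of_lt_iff fun i j => by
    rw [h.perm_lt_iff, h'.perm_lt_iff, hwt]
  refine h.ext_key h' (funext fun i => ?_)
  rw [Quad.key, Quad.key, hwt, htab, hperm]

lemma Quad.Good.perm_succ {q : Quad K n lam} (h : q.Good α) {i : Fin n}
    (hv : q.wt i.castSucc = q.wt i.succ) :
    (q.perm i.succ : ℕ) = q.perm i.castSucc + 1 := by
  have h1 : q.perm i.castSucc < q.perm i.succ :=
    (h.perm_lt_iff _ _).mpr (Or.inr ⟨hv, Fin.castSucc_lt_succ⟩)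
  by_contra hne
  rw [Fin.lt_def] at h1
  obtain ⟨p, hp⟩ := q.perm.surjective
    ⟨(q.perm i.castSucc : ℕ) + 1, by have := (q.perm i.succ).2; omega⟩
  have h2 := (h.perm_lt_iff i.castSucc p).mp (by rw [hp, Fin.lt_def]; simp)
  have h3 := (h.perm_lt_iff p i.succ).mp (by rw [hp, Fin.lt_def]; simp; omega)
  simp only [Fin.lt_def, Fin.val_castSucc, Fin.val_succ] at h2 h3
  omega

lemma Quad.Good.trichotomy {q : Quad K n lam} (h : q.Good α) (i : Fin n) :
    KeyUp (q.key i.castSucc) (q.key i.succ) ∨ KeyUp (q.key i.succ) (q.key i.castSucc) ∨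
      KeyFall (q.key i.castSucc) (q.key i.succ) := by
  have hc : q.wt i.castSucc = q.wt i.succ →
      q.tab.1.content (q.perm i.castSucc) ≠ q.tab.1.content (q.perm i.succ) := fun hv => by
    have := h.perm_succ hv
    exact q.tab.2.content_ne (fun e => by rw [e] at this; omega) (by omega) (by omega)
  rw [KeyUp, KeyUp, KeyFall, abs_eq one_pos.le]
  simp only [Quad.key] at *
  omega

/-- The action of `s_i` away from the falls. -/
lemma Quad.Good.actS {q : Quad K n lam} (h : q.Good α) {i : Fin n}
    (hf : ¬ KeyFall (q.key i.castSucc) (q.key i.succ)) :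
    (q.actS i).Good α ∧ (q.actS i).key = q.key ∘ sPerm i := by
  by_cases hv : q.wt i.castSucc = q.wt i.succ
  · have hex := (q.tab.2.exchange_iff (h.perm_succ hv)).mpr fun hc => hf ⟨hv, hc⟩
    have e : q.actS i = ⟨⟨q.tab.1.exchange (q.perm i.castSucc) (q.perm i.succ), hex⟩,
        q.spec ∘ sPerm i, q.wt, q.perm⟩ := by
      rw [Quad.actS, if_neg (not_not.mpr hv), dif_pos hex]
    have hkey : (q.actS i).key = q.key ∘ sPerm i := by
      rw [e]
      funext x
      refine Prod.ext ?_ ?_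
      · change q.wt x = q.wt (sPerm i x)
        by_cases h1 : x = i.castSucc
        · rw [h1, sPerm_castSucc, hv]
        · by_cases h2 : x = i.succ
          · rw [h2, sPerm_succ, hv]
          · rw [sPerm_of_ne h1 h2]
      · change q.tab.1.content (Equiv.swap (q.perm i.castSucc) (q.perm i.succ) (q.perm x)) = _
        rw [q.perm.injective.swap_apply]
        rfl
    refine ⟨⟨fun x => ?_, ?_⟩, hkey⟩
    · rw [hkey, e]
      exact h.spec_eq _
    · rw [e]
      exact h.perm_lt_iff
  · have e : q.actS i = ⟨q.tab, q.spec ∘ sPerm i, q.wt ∘ sPerm i, q.perm * sPerm i⟩ := by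
      rw [Quad.actS, if_pos hv]
    have hkey : (q.actS i).key = q.key ∘ sPerm i := by
      rw [e]
      rfl
    refine ⟨⟨fun x => ?_, fun a b => ?_⟩, hkey⟩
    · rw [hkey, e]
      exact h.spec_eq _
    · rw [e]
      change q.perm (sPerm i a) < q.perm (sPerm i b) ↔
        q.wt (sPerm i b) < q.wt (sPerm i a) ∨ q.wt (sPerm i a) = q.wt (sPerm i b) ∧ a < b
      rw [h.perm_lt_iff]
      refine or_congr_right (and_congr_right fun hab => sPerm_lt_iff ?_ ?_)
      · rintro ⟨rfl, rfl⟩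
        rw [sPerm_castSucc, sPerm_succ] at hab
        exact hv hab.symm
      · rintro ⟨rfl, rfl⟩
        rw [sPerm_castSucc, sPerm_succ] at hab
        exact hv hab

lemma Quad.Good.actS_of_fall {q : Quad K n lam} (h : q.Good α) {i : Fin n}
    (hf : KeyFall (q.key i.castSucc) (q.key i.succ)) : q.actS i = q := by
  have hv : q.wt i.castSucc = q.wt i.succ := hf.1
  have hex := mt (q.tab.2.exchange_iff (h.perm_succ hv)).mp (not_not.mpr hf.2)
  rw [Quad.actS, if_neg (not_not.mpr hv), dif_neg hex]

lemma Quad.Good.actS_actS {q : Quad K n lam} (h : q.Good α) {i : Fin n}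
    (hf : ¬ KeyFall (q.key i.castSucc) (q.key i.succ)) : (q.actS i).actS i = q := by
  obtain ⟨h1, h2⟩ := h.actS hf
  have hf' : ¬ KeyFall ((q.actS i).key i.castSucc) ((q.actS i).key i.succ) := by
    rw [h2, Function.comp_apply, Function.comp_apply, sPerm_castSucc, sPerm_succ]
    exact fun h' => hf h'.symm
  obtain ⟨h3, h4⟩ := h1.actS hf'
  refine h3.ext_key h (funext fun x => ?_)
  rw [h4, h2, Function.comp_apply, Function.comp_apply, sPerm_sPerm]

lemma exchange_injective {f : Filling n lam} {a b c d : Fin (n + 1)} (hab : a < b) (hcd : c < d)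
    (h : f.exchange a b = f.exchange c d) : a = c ∧ b = d := by
  have hs : ∀ x, Equiv.swap a b x = Equiv.swap c d x := fun x =>
    f.injective (DFunLike.congr_fun h x)
  have h1 := hs a
  have h2 := hs b
  rw [Equiv.swap_apply_left, Equiv.swap_apply_def] at h1
  rw [Equiv.swap_apply_right, Equiv.swap_apply_def] at h2
  split_ifs at h1 h2 <;> omega

lemma Quad.Good.arrow_iff {q : Quad K n lam} (h : q.Good α) {i : Fin n} {q' : Quad K n lam} :
    Arrow α q (.s i) (some q') ↔ q' = q.actS i ∧ KeyUp (q.key i.castSucc) (q.key i.succ) := by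
  constructor
  · intro ha
    cases ha with
    | step _ hv => exact ⟨rfl, Or.inl hv⟩
    | jump _ hv k l hkl htab hct =>
      refine ⟨rfl, Or.inr ⟨hv, ?_⟩⟩
      have hp := h.perm_succ hv
      rw [Quad.actS, if_neg (not_not.mpr hv)] at htab
      split_ifs at htab with hex
      · obtain ⟨rfl, rfl⟩ := exchange_injective (by rw [Fin.lt_def]; omega) hkl htab
        exact hct
      · have := DFunLike.congr_fun htab k
        rw [Filling.exchange, Equiv.trans_apply, Equiv.swap_apply_left] at this
        exact absurd (q.tab.1.injective this) hkl.ne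
  · rintro ⟨rfl, hup⟩
    rcases hup with hv | ⟨hv, hc⟩
    · exact Arrow.step q i hv
    · replace hv : q.wt i.castSucc = q.wt i.succ := hv
      have hex := (q.tab.2.exchange_iff (h.perm_succ hv)).mpr fun hcon => by
        simp only [Quad.key] at hc
        rw [abs_eq one_pos.le] at hcon
        omega
      refine Arrow.jump q i hv (q.perm i.castSucc) (q.perm i.succ) ?_ ?_ hc
      · rw [Fin.lt_def, h.perm_succ hv]
        omega
      · rw [Quad.actS, if_neg (not_not.mpr hv), dif_pos hex]

/-! The affine arrows. -/

lemma Quad.actPsi_key_castSucc (q : Quad K n lam) (i : Fin n) :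
    (q.actPsi α).key i.castSucc = q.key i.succ := by
  simp [Quad.actPsi, Quad.key, Fin.tail]

lemma Quad.actPsi_key_last (q : Quad K n lam) :
    (q.actPsi α).key (Fin.last n) = ((q.key 0).1 + 1, (q.key 0).2) := by
  simp [Quad.actPsi, Quad.key]

lemma Quad.actPsi_wt (q : Quad K n lam) : (q.actPsi α).wt = psiWt q.wt := rfl

lemma keyVal_succ (x : ℕ × ℤ) : keyVal α (x.1 + 1, x.2) = keyVal α x + α := by
  simp only [keyVal]
  push_cast
  ring

lemma Quad.Good.actPsi {q : Quad K n lam} (h : q.Good α) : (q.actPsi α).Good α where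
  spec_eq x := by
    refine Fin.lastCases ?_ (fun i => ?_) x
    · rw [Quad.actPsi_key_last, keyVal_succ, ← h.spec_eq]
      simp [Quad.actPsi]
    · rw [Quad.actPsi_key_castSucc, ← h.spec_eq]
      simp [Quad.actPsi, Fin.tail]
  perm_lt_iff a b := by
    rw [Quad.actPsi_wt]
    change q.perm (finRotate (n + 1) a) < q.perm (finRotate (n + 1) b) ↔ _
    rw [h.perm_lt_iff]
    refine Fin.lastCases ?_ (fun i => ?_) a <;> refine Fin.lastCases ?_ (fun j => ?_) b
    · simp
    · rw [psiWt_last, psiWt_castSucc, finRotate_last, finRotate_castSucc]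
      simp only [Fin.lt_def, Fin.val_last, Fin.val_castSucc, Fin.val_succ, Fin.val_zero]
      omega
    · rw [psiWt_last, psiWt_castSucc, finRotate_last, finRotate_castSucc]
      simp only [Fin.lt_def, Fin.val_last, Fin.val_castSucc, Fin.val_succ, Fin.val_zero]
      omega
    · rw [psiWt_castSucc, psiWt_castSucc, finRotate_castSucc, finRotate_castSucc]
      simp only [Fin.lt_def, Fin.val_castSucc, Fin.val_succ]
      omega

lemma finRotate_inv_succ (i : Fin n) : (finRotate (n + 1))⁻¹ i.succ = i.castSucc := by
  rw [Equiv.Perm.inv_eq_iff_eq, finRotate_castSucc]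

lemma finRotate_inv_zero : (finRotate (n + 1))⁻¹ 0 = Fin.last n := by
  rw [Equiv.Perm.inv_eq_iff_eq, finRotate_last]

lemma Quad.Good.exists_actPsi_eq {q : Quad K n lam} (h : q.Good α)
    (hv : q.wt (Fin.last n) ≠ 0) : ∃ q' : Quad K n lam, q'.Good α ∧ q'.actPsi α = q := by
  let q' : Quad K n lam := ⟨q.tab, Fin.cons (α := fun _ => K) (q.spec (Fin.last n) - α)
    (Fin.init q.spec), psiWtInv q.wt, q.perm * (finRotate (n + 1))⁻¹⟩
  have h1 : q'.wt 0 = q.wt (Fin.last n) - 1 := rfl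
  have h2 : ∀ i : Fin n, q'.wt i.succ = q.wt i.castSucc := fun i => by
    simp [q', psiWtInv, Fin.init]
  have h3 : q'.perm 0 = q.perm (Fin.last n) := by
    rw [← finRotate_inv_zero]
    rfl
  have h4 : ∀ i : Fin n, q'.perm i.succ = q.perm i.castSucc := fun i => by
    rw [← finRotate_inv_succ]
    rfl
  refine ⟨q', ⟨fun x => ?_, fun a b => ?_⟩, ?_⟩
  · refine Fin.cases ?_ (fun i => ?_) x
    · have := h.spec_eq (Fin.last n)
      have hk : q.key (Fin.last n) = ((q'.key 0).1 + 1, (q'.key 0).2) := by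
        simp only [Quad.key, h1, h3]
        rw [Nat.sub_add_cancel (by omega)]
      rw [hk, keyVal_succ] at this
      change q.spec (Fin.last n) - α = _
      rw [this, add_sub_cancel_right]
    · have hk : q'.key i.succ = q.key i.castSucc := by
        simp only [Quad.key, h2, h4]
        rfl
      rw [hk, ← h.spec_eq]
      simp [q', Fin.init]
  · refine Fin.cases ?_ (fun i => ?_) a <;> refine Fin.cases ?_ (fun j => ?_) b
    · simp
    · rw [h1, h2, h3, h4, h.perm_lt_iff]
      simp only [Fin.lt_def, Fin.val_last, Fin.val_castSucc, Fin.val_succ, Fin.val_zero]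
      omega
    · rw [h1, h2, h3, h4, h.perm_lt_iff]
      simp only [Fin.lt_def, Fin.val_last, Fin.val_castSucc, Fin.val_succ, Fin.val_zero]
      omega
    · rw [h2, h2, h4, h4, h.perm_lt_iff]
      simp only [Fin.lt_def, Fin.val_castSucc, Fin.val_succ]
      omega
  · refine Quad.ext rfl ?_ (psiWt_psiWtInv hv) ?_
    · funext x
      refine Fin.lastCases ?_ (fun i => ?_) x
      · simp [Quad.actPsi, q']
      · simp [Quad.actPsi, q']
    · simp [Quad.actPsi, q']

lemma Quad.Good.actPsi_injective {q q' : Quad K n lam} (h : q.Good α) (h' : q'.Good α)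
    (e : q.actPsi α = q'.actPsi α) : q = q' :=
  have htab : (q.actPsi α).tab = (q'.actPsi α).tab := by rw [e]
  h.ext_wt_tab h' (psiWt_injective (congrArg Quad.wt e)) htab

lemma rootQuad_good (hlam : lam.card = n + 1) : (rootQuad K hlam).Good α where
  spec_eq i := by simp [rootQuad, keyVal, Quad.key]
  perm_lt_iff i j := by simp [rootQuad]

lemma IsPath.good {hlam : lam.card = n + 1} {P : List (Label n)} {q : Quad K n lam}
    (h : IsPath α hlam P q) : q.Good α := by
  induction h with
  | nil => exact rootQuad_good hlam
  | @snoc P q q' a hP ha ih =>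
    cases a with
    | s i =>
      obtain ⟨rfl, hup⟩ := ih.arrow_iff.mp ha
      exact (ih.actS hup.not_fall).1
    | psi =>
      cases ha
      exact ih.actPsi

end Vertices

/-! ### Products over the pairs of positions -/

/-- The product of `g (x a) (x b)` over the pairs of positions `a < b`. -/
@[to_additive]
def prodPairs {N : ℕ} {X M : Type*} [CommMonoid M] (g : X → X → M) (x : Fin N → X) : M :=
  ∏ p : Fin N × Fin N, if p.1 < p.2 then g (x p.1) (x p.2) else 1

@[to_additive]
lemma prodPairs_comp_sPerm {n : ℕ} {X M : Type*} [CommMonoid M] (g : X → X → M)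
    (x : Fin (n + 1) → X) (i : Fin n) :
    prodPairs g (x ∘ sPerm i) * g (x i.castSucc) (x i.succ) =
      prodPairs g x * g (x i.succ) (x i.castSucc) := by
  rw [prodPairs, prodPairs, ← Equiv.prod_comp ((sPerm i).prodCongr (sPerm i))]
  simp only [Equiv.prodCongr_apply, Prod.map_fst, Prod.map_snd, Function.comp_apply, sPerm_sPerm]
  have h1 := Finset.prod_ite_eq' (Finset.univ : Finset (Fin (n + 1) × Fin (n + 1)))
    (i.castSucc, i.succ) fun p => g (x p.1) (x p.2)
  have h2 := Finset.prod_ite_eq' (Finset.univ : Finset (Fin (n + 1) × Fin (n + 1)))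
    (i.succ, i.castSucc) fun p => g (x p.1) (x p.2)
  rw [if_pos (Finset.mem_univ _)] at h1 h2
  rw [← h1, ← h2, ← Finset.prod_mul_distrib, ← Finset.prod_mul_distrib]
  refine Finset.prod_congr rfl fun p _ => ?_
  have hlt : i.castSucc < i.succ := Fin.castSucc_lt_succ
  by_cases hp : p = (i.castSucc, i.succ)
  · subst hp
    rw [if_neg (by rw [sPerm_castSucc, sPerm_succ]; exact hlt.not_gt), if_pos rfl, if_pos hlt,
      if_neg (by rw [Prod.mk.injEq]; exact fun h => hlt.ne h.1), one_mul, mul_one]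
  · by_cases hp' : p = (i.succ, i.castSucc)
    · subst hp'
      rw [if_pos (by rw [sPerm_castSucc, sPerm_succ]; exact hlt), if_neg hp, if_neg hlt.not_gt,
        if_pos rfl, one_mul, mul_one]
    · rw [if_neg hp, if_neg hp']
      simp only [sPerm_lt_iff (fun h => hp (Prod.ext h.1 h.2)) (fun h => hp' (Prod.ext h.1 h.2))]

/-! ### A well-founded order on the vertices -/

section Order

variable {n : ℕ} {lam : YoungDiagram}

/-- The pairs in positions `i < j` are inverted with respect to the direction of the arrows. -/
def KeyInv (x y : ℕ × ℤ) : Prop := y.1 < x.1 ∨ x.1 = y.1 ∧ x.2 < y.2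

lemma KeyUp.keyInv {x y : ℕ × ℤ} (h : KeyUp x y) : KeyInv y x := by
  rw [KeyUp] at h
  rw [KeyInv]
  omega

lemma KeyUp.not_keyInv {x y : ℕ × ℤ} (h : KeyUp x y) : ¬ KeyInv x y := by
  rw [KeyUp] at h
  rw [KeyInv]
  omega

variable {K : Type*}

open Classical in
/-- The number of inverted pairs of positions. -/
def Quad.invNum (q : Quad K n lam) : ℕ := sumPairs (fun x y => if KeyInv x y then 1 else 0) q.key

lemma Quad.invNum_le (q : Quad K n lam) : q.invNum ≤ (n + 1) * (n + 1) := by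
  classical
  rw [Quad.invNum, sumPairs]
  refine (Finset.sum_le_card_nsmul _ _ 1 fun p _ => ?_).trans (by simp)
  split_ifs <;> simp

/-- The sum of the entries of `v`. -/
def Quad.wtSum (q : Quad K n lam) : ℕ := ∑ i, q.wt i

/-- The order along which the inductions on the vertices are made. -/
def Quad.Prec (q' q : Quad K n lam) : Prop :=
  q'.wtSum < q.wtSum ∨ q'.wtSum = q.wtSum ∧ q'.invNum < q.invNum

lemma Quad.Prec.trans {q q' q'' : Quad K n lam} (h : q.Prec q') (h' : q'.Prec q'') :
    q.Prec q'' := by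
  rw [Quad.Prec] at *
  omega

lemma Quad.prec_induction {P : Quad K n lam → Prop}
    (h : ∀ q, (∀ q' : Quad K n lam, q'.Prec q → P q') → P q)
    (q : Quad K n lam) : P q := by
  have hwf : WellFounded fun q' q : Quad K n lam =>
      toLex (q'.wtSum, q'.invNum) < toLex (q.wtSum, q.invNum) :=
    InvImage.wf (fun q : Quad K n lam => toLex (q.wtSum, q.invNum)) wellFounded_lt
  induction q using hwf.induction with
  | _ q ih => exact h q fun q' hq => ih q' (Prod.Lex.toLex_lt_toLex.mpr hq)

variable [Field K] {α : K}

lemma Quad.Good.wt_actS {q : Quad K n lam} (h : q.Good α) {i : Fin n}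
    (hf : ¬ KeyFall (q.key i.castSucc) (q.key i.succ)) : (q.actS i).wt = q.wt ∘ sPerm i :=
  funext fun x => congrArg Prod.fst (congrFun (h.actS hf).2 x)

lemma Quad.Good.wtSum_actS {q : Quad K n lam} (h : q.Good α) {i : Fin n}
    (hf : ¬ KeyFall (q.key i.castSucc) (q.key i.succ)) : (q.actS i).wtSum = q.wtSum := by
  rw [Quad.wtSum, h.wt_actS hf]
  exact Equiv.sum_comp (sPerm i) q.wt

lemma Quad.Good.invNum_actS {q : Quad K n lam} (h : q.Good α) {i : Fin n}
    (hup : KeyUp (q.key i.castSucc) (q.key i.succ)) : (q.actS i).invNum = q.invNum + 1 := by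
  have := sumPairs_comp_sPerm (fun x y => open Classical in if KeyInv x y then 1 else 0) q.key i
  rw [if_neg hup.not_keyInv, if_pos hup.keyInv, add_zero] at this
  rw [Quad.invNum, (h.actS hup.not_fall).2, this]
  rfl

lemma Quad.Good.prec_actS {q : Quad K n lam} (h : q.Good α) {i : Fin n}
    (hup : KeyUp (q.key i.castSucc) (q.key i.succ)) : q.Prec (q.actS i) :=
  Or.inr ⟨(h.wtSum_actS hup.not_fall).symm, by rw [h.invNum_actS hup]; omega⟩

lemma Quad.prec_actPsi (q : Quad K n lam) : q.Prec (q.actPsi α) := by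
  left
  rw [Quad.wtSum, Quad.wtSum, Fin.sum_univ_succ, Fin.sum_univ_castSucc, Quad.actPsi_wt, psiWt_last,
    Finset.sum_congr rfl fun i _ => psiWt_castSucc q.wt i]
  omega

/-- The vertex `q s_i` is the origin of an arrow `s_i` with target `q`. -/
lemma Quad.Good.actS_of_down {q : Quad K n lam} (h : q.Good α) {i : Fin n}
    (hd : KeyUp (q.key i.succ) (q.key i.castSucc)) :
    (q.actS i).Good α ∧ (q.actS i).key = q.key ∘ sPerm i ∧ (q.actS i).Prec q ∧
      KeyUp ((q.actS i).key i.castSucc) ((q.actS i).key i.succ) ∧ (q.actS i).actS i = q := by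
  obtain ⟨h1, h2⟩ := h.actS hd.not_fall'
  have h3 : KeyUp ((q.actS i).key i.castSucc) ((q.actS i).key i.succ) := by
    rw [h2, Function.comp_apply, Function.comp_apply, sPerm_castSucc, sPerm_succ]
    exact hd
  have h4 := h.actS_actS hd.not_fall'
  refine ⟨h1, h2, ?_, h3, h4⟩
  have := h1.prec_actS h3
  rwa [h4] at this

/-- The arrows `s_i` with target `q`. -/
lemma Quad.Good.arrow_to {q q' : Quad K n lam} (h' : q'.Good α) {i : Fin n}
    (ha : Arrow α q' (.s i) (some q)) :
    q.Good α ∧ q' = q.actS i ∧ KeyUp (q.key i.succ) (q.key i.castSucc) := by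
  obtain ⟨rfl, hup⟩ := h'.arrow_iff.mp ha
  obtain ⟨h1, h2⟩ := h'.actS hup.not_fall
  refine ⟨h1, (h'.actS_actS hup.not_fall).symm, ?_⟩
  rw [h2, Function.comp_apply, Function.comp_apply, sPerm_castSucc, sPerm_succ]
  exact hup

lemma Quad.Good.arrow_of_down {q : Quad K n lam} (h : q.Good α) {i : Fin n}
    (hd : KeyUp (q.key i.succ) (q.key i.castSucc)) : Arrow α (q.actS i) (.s i) (some q) := by
  obtain ⟨h1, -, -, h3, h4⟩ := h.actS_of_down hd
  exact h1.arrow_iff.mpr ⟨h4.symm, h3⟩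

end Order

/-! ### Sorting -/

section Sorting

variable {n : ℕ} {lam : YoungDiagram}

lemma sortDesc_comp_perm {N : ℕ} (v : Fin N → ℕ) (σ : Equiv.Perm (Fin N)) :
    sortDesc (v ∘ σ) = sortDesc v :=
  funext fun i => congrFun (Tuple.comp_perm_comp_sort_eq_comp_sort (f := v) (σ := σ)) (Fin.rev i)

lemma sortDesc_eq {N : ℕ} (v : Fin N → ℕ) (σ : Equiv.Perm (Fin N)) (h : Antitone (v ∘ σ)) :
    sortDesc v = v ∘ σ := by
  refine Tuple.unique_antitone (σ := Fin.revPerm.trans (Tuple.sort v)) ?_ h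
  exact fun _ _ hab => sortDesc_antitone v hab

lemma Filling.eq_of_strictMono {L : Type*} [LinearOrder L] {key : lam.cells → L}
    (hkey : Function.Injective key) {f g : Filling n lam} (hf : StrictMono fun a => key (f a))
    (hg : StrictMono fun a => key (g a)) : f = g := by
  have h := (hf.range_inj hg).mp (by
    rw [show (fun a => key (f a)) = key ∘ f from rfl, show (fun a => key (g a)) = key ∘ g from rfl,
      Set.range_comp, Set.range_comp, f.surjective.range_eq, g.surjective.range_eq])
  exact Equiv.ext fun a => hkey (congrFun h a)

lemma fillingOfKey_strictMono (hlam : lam.card = n + 1) {L : Type*} [LinearOrder L]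
    (key : lam.cells → L) (hkey : Function.Injective key) :
    StrictMono fun a => key (fillingOfKey hlam key hkey a) := fun _ _ hab =>
  lt_of_le_of_ne (le_of_not_gt fun h => (fillingOfKey_lt hlam key hkey h).not_gt hab)
    fun h => hab.ne ((fillingOfKey hlam key hkey).injective (hkey h))

variable {K : Type*} [Field K] {α : K}

lemma Quad.Good.sortDesc_wt {q : Quad K n lam} (h : q.Good α) :
    sortDesc q.wt = q.wt ∘ q.perm.symm := by
  refine sortDesc_eq q.wt q.perm.symm fun a b hab => ?_
  by_contra hcon
  have := (h.perm_lt_iff (q.perm.symm b) (q.perm.symm a)).mpr (Or.inl (not_le.mp hcon))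
  rw [Equiv.apply_symm_apply, Equiv.apply_symm_apply] at this
  exact this.not_ge hab

lemma tabOf_entry (τ : RST n lam) (v : Fin (n + 1) → ℕ) (a : Fin (n + 1)) :
    (tabOf τ v).entry (τ.1 a) = sortDesc v a := by
  change sortDesc v (τ.1.symm (τ.1 a)) = _
  rw [Equiv.symm_apply_apply]

lemma Filling.IsRST.col_row_of_content_le {f : Filling n lam} (hf : f.IsRST) {a b : Fin (n + 1)}
    (hab : (b : ℕ) = a + 1) (h : f.content b ≤ f.content a + 1) :
    f.col b < f.col a ∨ f.col b = f.col a ∧ f.row b < f.row a := by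
  have hne : a ≠ b := fun h => by rw [h] at hab; omega
  have hc := hf.content_ne hne (by omega) (by omega)
  have h1 : ¬ (f.row a ≤ f.row b ∧ f.col a ≤ f.col b) := fun h2 => by
    have := hf.lt hne h2.1 h2.2
    rw [Fin.lt_def] at this
    omega
  by_cases h2 : f.content b = f.content a + 1
  · have := hf.adjacent_of_content hab (by rw [h2, abs_eq one_pos.le]; omega)
    rw [Filling.content_def, Filling.content_def] at h2
    omega
  · rw [Filling.content_def, Filling.content_def] at *
    omega

lemma Filling.IsRST.row_col_of_content_le {f : Filling n lam} (hf : f.IsRST) {a b : Fin (n + 1)}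
    (hab : (b : ℕ) = a + 1) (h : f.content a ≤ f.content b + 1) :
    f.row b < f.row a ∨ f.row b = f.row a ∧ f.col b < f.col a := by
  have hne : a ≠ b := fun h => by rw [h] at hab; omega
  have hc := hf.content_ne hne (by omega) (by omega)
  have h1 : ¬ (f.row a ≤ f.row b ∧ f.col a ≤ f.col b) := fun h2 => by
    have := hf.lt hne h2.1 h2.2
    rw [Fin.lt_def] at this
    omega
  by_cases h2 : f.content a = f.content b + 1
  · have := hf.adjacent_of_content hab (by rw [h2, abs_eq one_pos.le]; omega)
    rw [Filling.content_def, Filling.content_def] at h2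
    omega
  · rw [Filling.content_def, Filling.content_def] at *
    omega

/-- The key with respect to which the tableau of a vertex without inward arrow is sorted. -/
def Tableau.colKey (T : Tableau lam) (c : lam.cells) : (ℕ ×ₗ (ℕ ×ₗ ℕ))ᵒᵈ :=
  OrderDual.toDual (toLex (T.entry c, toLex (c.1.2, c.1.1)))

lemma Tableau.colKey_injective (T : Tableau lam) : Function.Injective T.colKey := by
  intro c d h
  have h' : (T.entry c, toLex (c.1.2, c.1.1)) = (T.entry d, toLex (d.1.2, d.1.1)) :=
    toLex.injective (OrderDual.toDual.injective h)
  rw [Prod.mk.injEq] at h'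
  have h2 := toLex.injective h'.2
  rw [Prod.mk.injEq] at h2
  exact Subtype.ext (Prod.ext h2.2 h2.1)

/-- The vertex has no inward arrow `s_i`. -/
def Quad.IsSource (q : Quad K n lam) : Prop := ∀ i : Fin n, ¬ KeyUp (q.key i.succ) (q.key i.castSucc)

/-- The vertex has no outward arrow `s_i`. -/
def Quad.IsSink (q : Quad K n lam) : Prop := ∀ i : Fin n, ¬ KeyUp (q.key i.castSucc) (q.key i.succ)

omit [Field K] in
lemma Quad.IsSource.monotone {q : Quad K n lam} (h : q.IsSource) : Monotone q.wt :=
  Fin.monotone_iff_le_succ.mpr fun i => by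
    have := h i
    rw [KeyUp] at this
    simp only [Quad.key] at this
    omega

omit [Field K] in
lemma Quad.IsSink.antitone {q : Quad K n lam} (h : q.IsSink) : Antitone q.wt :=
  Fin.antitone_iff_succ_le.mpr fun i => by
    have := h i
    rw [KeyUp] at this
    simp only [Quad.key] at this
    omega

/-- Along the labels with equal entries, the tableau of a vertex without inward arrow is read column
by column. -/
lemma Quad.Good.col_row_of_isSource {q : Quad K n lam} (h : q.Good α) (hs : q.IsSource)
    {k : Fin n} (hk : sortDesc q.wt k.castSucc = sortDesc q.wt k.succ) :
    ∃ i : Fin n, q.perm i.castSucc = k.castSucc ∧ q.perm i.succ = k.succ ∧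
      q.wt i.castSucc = q.wt i.succ ∧
      (q.tab.1.col k.succ < q.tab.1.col k.castSucc ∨
        q.tab.1.col k.succ = q.tab.1.col k.castSucc ∧
          q.tab.1.row k.succ < q.tab.1.row k.castSucc) := by
  rw [h.sortDesc_wt, Function.comp_apply, Function.comp_apply] at hk
  obtain ⟨a, ha⟩ := q.perm.surjective k.castSucc
  obtain ⟨b, hb⟩ := q.perm.surjective k.succ
  rw [← ha, ← hb, Equiv.symm_apply_apply, Equiv.symm_apply_apply] at hk
  have hab : a < b := by
    have h1 : q.perm a < q.perm b := by
      rw [ha, hb]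
      exact Fin.castSucc_lt_succ
    rw [h.perm_lt_iff] at h1
    rcases h1 with h1 | h1
    · omega
    · exact h1.2
  obtain ⟨i, rfl⟩ : ∃ i : Fin n, i.castSucc = a :=
    ⟨a.castPred (ne_of_lt (hab.trans_le (Fin.le_last b))), Fin.castSucc_castPred _ _⟩
  have hle : i.succ ≤ b := Fin.castSucc_lt_iff_succ_le.mp hab
  have hv : q.wt i.castSucc = q.wt i.succ :=
    le_antisymm (hs.monotone Fin.castSucc_lt_succ.le) ((hs.monotone hle).trans hk.ge)
  have hp := h.perm_succ hv
  have hb' : q.perm i.succ = k.succ := by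
    rw [Fin.ext_iff, hp, ha]
    simp
  refine ⟨i, ha, hb', hv, q.tab.2.col_row_of_content_le (val_succ_eq k) ?_⟩
  have := hs i
  rw [KeyUp] at this
  simp only [Quad.key, ha, hb'] at this
  omega

lemma Quad.Good.strictMono_colKey {q : Quad K n lam} (h : q.Good α) (hs : q.IsSource) :
    StrictMono fun a => (tabOf q.tab q.wt).colKey (q.tab.1 a) := by
  refine Fin.strictMono_iff_lt_succ.mpr fun k => ?_
  refine OrderDual.toDual_lt_toDual.mpr (Prod.Lex.toLex_lt_toLex.mpr ?_)
  rw [tabOf_entry, tabOf_entry]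
  have hle : sortDesc q.wt k.succ ≤ sortDesc q.wt k.castSucc :=
    sortDesc_antitone _ Fin.castSucc_lt_succ.le
  rcases hle.lt_or_eq with hlt | heq
  · exact Or.inl hlt
  · obtain ⟨-, -, -, -, h1⟩ := h.col_row_of_isSource hs heq.symm
    exact Or.inr ⟨heq, Prod.Lex.toLex_lt_toLex.mpr h1⟩

lemma Quad.Good.perm_eq_one {q : Quad K n lam} (h : q.Good α) (hv : Antitone q.wt) :
    q.perm = 1 := by
  refine perm_ext_of_lt_iff fun i j => ?_
  rw [h.perm_lt_iff, Equiv.Perm.one_apply, Equiv.Perm.one_apply]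
  constructor
  · rintro (h1 | h1)
    · by_contra hcon
      exact absurd (hv (not_lt.mp hcon)) (by omega)
    · exact h1.2
  · intro hij
    have := hv hij.le
    omega

lemma Quad.Good.tab_eq_std {q : Quad K n lam} (h : q.Good α) (hs : q.IsSink)
    (hlam : lam.card = n + 1) : q.tab = (tabOf q.tab q.wt).std hlam := by
  have hperm := h.perm_eq_one hs.antitone
  refine Subtype.ext (Filling.eq_of_strictMono (tabOf q.tab q.wt).stdKey_injective ?_
    (fillingOfKey_strictMono hlam _ _))
  refine Fin.strictMono_iff_lt_succ.mpr fun k => ?_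
  refine OrderDual.toDual_lt_toDual.mpr (Prod.Lex.toLex_lt_toLex.mpr ?_)
  rw [tabOf_entry, tabOf_entry, h.sortDesc_wt, hperm]
  change q.wt k.succ < q.wt k.castSucc ∨ q.wt k.succ = q.wt k.castSucc ∧ _
  have hle := hs.antitone (Fin.castSucc_lt_succ (i := k)).le
  rcases hle.lt_or_eq with hlt | heq
  · exact Or.inl hlt
  · refine Or.inr ⟨heq, Prod.Lex.toLex_lt_toLex.mpr
      (q.tab.2.row_col_of_content_le (val_succ_eq k) ?_)⟩
    have := hs k
    rw [KeyUp] at this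
    simp only [Quad.key, hperm, Equiv.Perm.one_apply] at this
    omega

lemma Quad.Good.sorted_tabOf {q : Quad K n lam} (h : q.Good α) (hlam : lam.card = n + 1) :
    (tabOf q.tab q.wt).sorted hlam = sortDesc q.wt := by
  rw [Tableau.sorted]
  have : (fun i => (tabOf q.tab q.wt).entry (((tabOf q.tab q.wt).std hlam).1 i)) =
      q.wt ∘ ((((tabOf q.tab q.wt).std hlam).1.trans q.tab.1.symm).trans q.perm.symm) := by
    funext i
    exact congrFun h.sortDesc_wt _
  rw [this, sortDesc_comp_perm]

/-- The root is the only vertex without inward arrow in `G_λ`. -/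
lemma Quad.Good.eq_root_or {q : Quad K n lam} (h : q.Good α) (hlam : lam.card = n + 1) :
    q = rootQuad K hlam ∨ q.wt (Fin.last n) ≠ 0 ∨
      ∃ i : Fin n, KeyUp (q.key i.succ) (q.key i.castSucc) := by
  by_contra hcon
  push Not at hcon
  obtain ⟨hne, hlast, hs⟩ := hcon
  have hs' : q.IsSource := hs
  have hv : ∀ i, q.wt i = 0 := fun i => by
    have := hs'.monotone (Fin.le_last i)
    omega
  have hv0 : sortDesc q.wt = fun _ => 0 := by
    rw [h.sortDesc_wt]
    exact funext fun i => hv _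
  refine hne (h.ext_wt_tab (rootQuad_good hlam) (funext hv) ?_)
  refine Subtype.ext (Filling.eq_of_strictMono rootKey_injective ?_
    (fillingOfKey_strictMono hlam _ _))
  refine Fin.strictMono_iff_lt_succ.mpr fun k => ?_
  obtain ⟨-, -, -, -, h1⟩ := h.col_row_of_isSource hs' (k := k) (by rw [hv0])
  exact OrderDual.toDual_lt_toDual.mpr (Prod.Lex.toLex_lt_toLex.mpr h1)

/-- The vertices of `G_λ` are the quads which satisfy `Quad.Good`. -/
theorem Quad.Good.exists_path {q : Quad K n lam} (h : q.Good α) (hlam : lam.card = n + 1) :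
    ∃ P, IsPath α hlam P q := by
  induction q using Quad.prec_induction with
  | _ q ih =>
    rcases h.eq_root_or hlam with rfl | hv | ⟨i, hd⟩
    · exact ⟨[], IsPath.nil⟩
    · obtain ⟨q', h', rfl⟩ := h.exists_actPsi_eq hv
      obtain ⟨P, hP⟩ := ih q' q'.prec_actPsi h'
      exact ⟨_, hP.snoc (Arrow.affine q')⟩
    · obtain ⟨h1, -, h3, -, -⟩ := h.actS_of_down hd
      obtain ⟨P, hP⟩ := ih _ h3 h1
      exact ⟨_, hP.snoc (h.arrow_of_down hd)⟩

end Sorting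

section Values

variable {K : Type*} [Field K] [Algebra ℚ K] {n : ℕ} {lam : YoungDiagram}

/-! ### The Yang--Baxter operators -/

/-- The operator `s_i ⊗ s_i + 1 / d`. -/
def tOp (i : Fin n) (d : K) (p : VPoly K n lam) : VPoly K n lam := sOp K i p + (1 / d) • p

lemma tOp_zero (i : Fin n) (d : K) : tOp i d (0 : VPoly K n lam) = 0 := by simp [tOp]

lemma tOp_comm {i j : Fin n} (hij : (i : ℕ) + 1 < j) (c d : K) (p : VPoly K n lam) :
    tOp i c (tOp j d p) = tOp j d (tOp i c p) := by
  simp only [tOp, map_add, map_smul, sOp_comm K hij]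
  module

lemma tOp_braid {i j : Fin n} (hij : (j : ℕ) = i + 1) {a b : K} (ha : a ≠ 0) (hb : b ≠ 0)
    (hab : a + b ≠ 0) (p : VPoly K n lam) :
    tOp i a (tOp j (a + b) (tOp i b p)) = tOp j b (tOp i (a + b) (tOp j a p)) := by
  have h : 1 / a * (1 / b) = 1 / (a + b) * (1 / a + 1 / b) := by
    field_simp
    ring
  simp only [tOp, map_add, map_smul, sOp_sOp, sOp_braid K hij]
  generalize 1 / a = x at *
  generalize 1 / b = y at *
  generalize 1 / (a + b) = z at *
  match_scalars
  · ring
  · ring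
  · ring
  · linear_combination -h
  · ring
  · linear_combination h

lemma psiOp_tOp {i j : Fin n} (hij : (j : ℕ) = i + 1) (d : K) (p : VPoly K n lam) :
    psiOp K (tOp j d p) = tOp i d (psiOp K p) := by
  rw [tOp, tOp, map_add, map_smul, psiOp_sOp K hij]

lemma psiOp_psiOp_tOp {i j : Fin n} (hi : (i : ℕ) = 0) (hj : (j : ℕ) + 1 = n) (d : K)
    (p : VPoly K n lam) : psiOp K (psiOp K (tOp i d p)) = tOp j d (psiOp K (psiOp K p)) := by
  rw [tOp, tOp, map_add, map_add, map_smul, map_smul, psiOp_psiOp_sOp K hi hj]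

/-! ### The values of the paths -/

/-- `Val α hlam q p`: the polynomial `p` is the value of a path from the root to `q`. -/
inductive Val (α : K) (hlam : lam.card = n + 1) : Quad K n lam → VPoly K n lam → Prop
  | root : Val α hlam (rootQuad K hlam) (1 ⊗ₜ[K] Finsupp.single (rootTab hlam) 1)
  | s {q q' : Quad K n lam} {p : VPoly K n lam} {i : Fin n} (h : Val α hlam q p)
      (ha : Arrow α q (.s i) (some q')) :
      Val α hlam q' (tOp i (q.spec i.succ - q.spec i.castSucc) p)
  | psi {q : Quad K n lam} {p : VPoly K n lam} (h : Val α hlam q p) :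
      Val α hlam (q.actPsi α) (psiOp K p)

variable {α : K} {hlam : lam.card = n + 1}

lemma Val.good {q : Quad K n lam} {p : VPoly K n lam} (h : Val α hlam q p) : q.Good α := by
  induction h with
  | root => exact rootQuad_good hlam
  | s _ ha ih => exact (ih.arrow_to ha).1
  | psi _ ih => exact ih.actPsi

lemma IsPath.val {P : List (Label n)} {q : Quad K n lam} (h : IsPath α hlam P q) :
    Val α hlam q (pathJack α hlam P) := by
  have key : (P.foldl (jackStep α) (rootQuad K hlam, 1 ⊗ₜ[K] Finsupp.single (rootTab hlam) 1)).1 = q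
      ∧ Val α hlam q (pathJack α hlam P) := by
    induction h with
    | nil => exact ⟨rfl, Val.root⟩
    | @snoc P q q' a hP ha ih =>
      rw [pathJack] at ih
      rw [pathJack, List.foldl_append, List.foldl_cons, List.foldl_nil]
      generalize P.foldl (jackStep α) (rootQuad K hlam, 1 ⊗ₜ[K] Finsupp.single (rootTab hlam) 1) = x
        at ih
      obtain ⟨x1, x2⟩ := x
      obtain ⟨rfl, hx⟩ := ih
      cases a with
      | s i => exact ⟨(hP.good.arrow_iff.mp ha).1.symm, hx.s ha⟩
      | psi =>
        cases ha
        exact ⟨rfl, hx.psi⟩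
  exact key.2

lemma Quad.Good.exists_val {q : Quad K n lam} (h : q.Good α) (hlam : lam.card = n + 1) :
    ∃ p, Val α hlam q p := by
  obtain ⟨P, hP⟩ := h.exists_path hlam
  exact ⟨_, hP.val⟩

omit [Algebra ℚ K] in
lemma Quad.Good.actS_spec_sub {q : Quad K n lam} (h : q.Good α) {i : Fin n}
    (hf : ¬ KeyFall (q.key i.castSucc) (q.key i.succ)) :
    (q.actS i).spec i.succ - (q.actS i).spec i.castSucc =
      keyVal α (q.key i.castSucc) - keyVal α (q.key i.succ) := by
  obtain ⟨h1, h2⟩ := h.actS hf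
  rw [h1.spec_eq, h1.spec_eq, h2, Function.comp_apply, Function.comp_apply, sPerm_castSucc,
    sPerm_succ]

lemma Val.of_actS {q : Quad K n lam} {p : VPoly K n lam} {i : Fin n} (h : Val α hlam (q.actS i) p)
    (hq : q.Good α) (hd : KeyUp (q.key i.succ) (q.key i.castSucc)) :
    Val α hlam q (tOp i (keyVal α (q.key i.castSucc) - keyVal α (q.key i.succ)) p) := by
  have := h.s (hq.arrow_of_down hd)
  rwa [hq.actS_spec_sub hd.not_fall'] at this

lemma Val.cases_last {q : Quad K n lam} {p : VPoly K n lam} (h : Val α hlam q p) :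
    (q = rootQuad K hlam ∧ p = 1 ⊗ₜ[K] Finsupp.single (rootTab hlam) 1) ∨
    (∃ (i : Fin n) (p' : VPoly K n lam), KeyUp (q.key i.succ) (q.key i.castSucc) ∧
      Val α hlam (q.actS i) p' ∧
      p = tOp i (keyVal α (q.key i.castSucc) - keyVal α (q.key i.succ)) p') ∨
    (∃ (q' : Quad K n lam) (p' : VPoly K n lam), q'.actPsi α = q ∧ Val α hlam q' p' ∧
      p = psiOp K p') := by
  cases h with
  | root => exact Or.inl ⟨rfl, rfl⟩
  | @s q' _ p' i h ha =>
    obtain ⟨h1, rfl, h3⟩ := h.good.arrow_to ha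
    exact Or.inr (Or.inl ⟨i, p', h3, h, by rw [h1.actS_spec_sub h3.not_fall']⟩)
  | @psi q' p' h => exact Or.inr (Or.inr ⟨q', p', rfl, h, rfl⟩)

lemma sPerm_apply_of_far {i j : Fin n} (h : (i : ℕ) + 1 < j ∨ (j : ℕ) + 1 < i) :
    sPerm i j.castSucc = j.castSucc ∧ sPerm i j.succ = j.succ := by
  constructor <;> apply sPerm_of_ne <;> simp only [ne_eq, Fin.ext_iff, Fin.val_castSucc,
    Fin.val_succ] <;> omega

lemma sPerm_apply_of_next {i j : Fin n} (h : (j : ℕ) = i + 1) :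
    j.castSucc = i.succ ∧ sPerm i j.succ = j.succ ∧ sPerm j i.castSucc = i.castSucc := by
  refine ⟨by simp [Fin.ext_iff, h], ?_, ?_⟩ <;> apply sPerm_of_ne <;>
    simp only [ne_eq, Fin.ext_iff, Fin.val_castSucc, Fin.val_succ] <;> omega

/-- The value of a path to `q` only depends on `q`. -/
def Quad.ValUnique (α : K) (hlam : lam.card = n + 1) (q : Quad K n lam) : Prop :=
  ∀ p p' : VPoly K n lam, Val α hlam q p → Val α hlam q p' → p = p'

lemma valUnique_far {q : Quad K n lam} (hq : q.Good α)
    (ih : ∀ q' : Quad K n lam, q'.Prec q → q'.ValUnique α hlam) {i j : Fin n}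
    (hij : (i : ℕ) + 1 < j) (hi : KeyUp (q.key i.succ) (q.key i.castSucc))
    (hj : KeyUp (q.key j.succ) (q.key j.castSucc)) {p p' : VPoly K n lam}
    (hp : Val α hlam (q.actS i) p) (hp' : Val α hlam (q.actS j) p') :
    tOp i (keyVal α (q.key i.castSucc) - keyVal α (q.key i.succ)) p =
      tOp j (keyVal α (q.key j.castSucc) - keyVal α (q.key j.succ)) p' := by
  obtain ⟨g1, k1, l1, -, -⟩ := hq.actS_of_down hi
  obtain ⟨g2, k2, l2, -, -⟩ := hq.actS_of_down hj
  obtain ⟨e1, e2⟩ := sPerm_apply_of_far (i := i) (j := j) (Or.inl hij)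
  obtain ⟨e3, e4⟩ := sPerm_apply_of_far (i := j) (j := i) (Or.inr hij)
  have d1 : (q.actS i).key j.castSucc = q.key j.castSucc ∧ (q.actS i).key j.succ = q.key j.succ := by
    rw [k1, Function.comp_apply, Function.comp_apply, e1, e2]
    exact ⟨rfl, rfl⟩
  have d2 : (q.actS j).key i.castSucc = q.key i.castSucc ∧ (q.actS j).key i.succ = q.key i.succ := by
    rw [k2, Function.comp_apply, Function.comp_apply, e3, e4]
    exact ⟨rfl, rfl⟩
  have u1 : KeyUp ((q.actS i).key j.succ) ((q.actS i).key j.castSucc) := by rwa [d1.1, d1.2]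
  have u2 : KeyUp ((q.actS j).key i.succ) ((q.actS j).key i.castSucc) := by rwa [d2.1, d2.2]
  obtain ⟨g3, k3, -, -, -⟩ := g1.actS_of_down u1
  obtain ⟨g4, k4, -, -, -⟩ := g2.actS_of_down u2
  have e : (q.actS i).actS j = (q.actS j).actS i := by
    refine g3.ext_key g4 ?_
    rw [k3, k4, k1, k2, Function.comp_assoc, Function.comp_assoc, ← Equiv.Perm.coe_mul,
      ← Equiv.Perm.coe_mul, sPerm_comm hij]
  obtain ⟨p0, h0⟩ := g3.exists_val hlam
  have v1 := h0.of_actS g1 u1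
  rw [e] at h0
  have v2 := h0.of_actS g2 u2
  rw [ih _ l1 _ _ hp v1, ih _ l2 _ _ hp' v2, d1.1, d1.2, d2.1, d2.2, tOp_comm hij]

lemma valUnique_next (hα : Transcendental ℚ α) {q : Quad K n lam} (hq : q.Good α)
    (ih : ∀ q' : Quad K n lam, q'.Prec q → q'.ValUnique α hlam) {i j : Fin n}
    (hij : (j : ℕ) = i + 1) (hi : KeyUp (q.key i.succ) (q.key i.castSucc))
    (hj : KeyUp (q.key j.succ) (q.key j.castSucc)) {p p' : VPoly K n lam}
    (hp : Val α hlam (q.actS i) p) (hp' : Val α hlam (q.actS j) p') :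
    tOp i (keyVal α (q.key i.castSucc) - keyVal α (q.key i.succ)) p =
      tOp j (keyVal α (q.key j.castSucc) - keyVal α (q.key j.succ)) p' := by
  obtain ⟨g1, k1, l1, -, -⟩ := hq.actS_of_down hi
  obtain ⟨g2, k2, l2, -, -⟩ := hq.actS_of_down hj
  obtain ⟨e1, e2, e3⟩ := sPerm_apply_of_next hij
  have f1 : sPerm j i.succ = j.succ := by rw [← e1, sPerm_castSucc]
  have f2 : sPerm j j.succ = i.succ := by rw [sPerm_succ, e1]
  rw [e1] at hj ⊢
  have hij' := hj.trans hi
  have c1 : (q.actS i).key j.castSucc = q.key i.castSucc ∧ (q.actS i).key j.succ = q.key j.succ := by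
    rw [k1, e1, Function.comp_apply, Function.comp_apply, sPerm_succ, e2]
    exact ⟨rfl, rfl⟩
  have u1 : KeyUp ((q.actS i).key j.succ) ((q.actS i).key j.castSucc) := by rwa [c1.1, c1.2]
  obtain ⟨g3, k3, l3, -, -⟩ := g1.actS_of_down u1
  have c3 : ((q.actS i).actS j).key i.castSucc = q.key i.succ ∧
      ((q.actS i).actS j).key i.succ = q.key j.succ := by
    rw [k3, k1]
    simp only [Function.comp_apply, e3, f1, e2, sPerm_castSucc, and_self]
  have u3 : KeyUp (((q.actS i).actS j).key i.succ) (((q.actS i).actS j).key i.castSucc) := by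
    rwa [c3.1, c3.2]
  obtain ⟨g5, k5, -, -, -⟩ := g3.actS_of_down u3
  have c2 : (q.actS j).key i.castSucc = q.key i.castSucc ∧ (q.actS j).key i.succ = q.key j.succ := by
    rw [k2, Function.comp_apply, Function.comp_apply, e3, f1]
    exact ⟨rfl, rfl⟩
  have u2 : KeyUp ((q.actS j).key i.succ) ((q.actS j).key i.castSucc) := by rwa [c2.1, c2.2]
  obtain ⟨g4, k4, l4, -, -⟩ := g2.actS_of_down u2
  have c4 : ((q.actS j).actS i).key j.castSucc = q.key i.castSucc ∧
      ((q.actS j).actS i).key j.succ = q.key i.succ := by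
    rw [k4, k2, e1]
    simp only [Function.comp_apply, e3, f2, e2, sPerm_succ, and_self]
  have u4 : KeyUp (((q.actS j).actS i).key j.succ) (((q.actS j).actS i).key j.castSucc) := by
    rwa [c4.1, c4.2]
  obtain ⟨g6, k6, -, -, -⟩ := g4.actS_of_down u4
  have e : ((q.actS i).actS j).actS i = ((q.actS j).actS i).actS j := by
    refine g5.ext_key g6 ?_
    rw [k5, k6, k3, k4, k1, k2]
    simp only [Function.comp_assoc, ← Equiv.Perm.coe_mul]
    rw [sPerm_braid hij]
  obtain ⟨p0, h0⟩ := g5.exists_val hlam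
  have v1 := (h0.of_actS g3 u3).of_actS g1 u1
  rw [e] at h0
  have v2 := (h0.of_actS g4 u4).of_actS g2 u2
  rw [ih _ l1 _ _ hp v1, ih _ l2 _ _ hp' v2, c1.1, c1.2, c2.1, c2.2, c3.1, c3.2, c4.1, c4.2]
  have hinj := keyVal_injective hα
  have := tOp_braid hij (a := keyVal α (q.key i.castSucc) - keyVal α (q.key i.succ))
    (b := keyVal α (q.key i.succ) - keyVal α (q.key j.succ))
    (sub_ne_zero.mpr fun h => hi.ne (hinj h).symm) (sub_ne_zero.mpr fun h => hj.ne (hinj h).symm)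
    (by rw [sub_add_sub_cancel]; exact sub_ne_zero.mpr fun h => hij'.ne (hinj h).symm) p0
  rwa [sub_add_sub_cancel] at this

omit [Algebra ℚ K] in
lemma Quad.actPsi_key (q : Quad K n lam) (x : Fin (n + 1)) :
    (q.actPsi α).key x = if x = Fin.last n then
      ((q.key (finRotate (n + 1) x)).1 + 1, (q.key (finRotate (n + 1) x)).2)
      else q.key (finRotate (n + 1) x) := by
  refine Fin.lastCases ?_ (fun i => ?_) x
  · rw [if_pos rfl, Quad.actPsi_key_last, finRotate_last]
  · rw [if_neg (Fin.castSucc_lt_last i).ne, Quad.actPsi_key_castSucc, finRotate_castSucc]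

omit [Algebra ℚ K] in
lemma Quad.actPsi_key_next (q : Quad K n lam) {i j : Fin n} (hij : (j : ℕ) = i + 1) :
    (q.actPsi α).key i.castSucc = q.key j.castSucc ∧ (q.actPsi α).key i.succ = q.key j.succ := by
  obtain ⟨e1, -, -⟩ := sPerm_apply_of_next hij
  rw [Quad.actPsi_key_castSucc, ← e1, Quad.actPsi_key_castSucc]
  exact ⟨rfl, rfl⟩

omit [Algebra ℚ K] in
lemma Quad.Good.actS_actPsi {q : Quad K n lam} (hq : q.Good α) {i j : Fin n}
    (hij : (j : ℕ) = i + 1) (hf : ¬ KeyFall (q.key j.castSucc) (q.key j.succ)) :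
    (q.actS j).actPsi α = (q.actPsi α).actS i := by
  obtain ⟨c1, c2⟩ := q.actPsi_key_next (α := α) hij
  obtain ⟨g1, k1⟩ := hq.actS hf
  obtain ⟨g2, k2⟩ := hq.actPsi.actS (i := i) (by rwa [c1, c2])
  refine g1.actPsi.ext_key g2 (funext fun x => ?_)
  have hl : sPerm i (Fin.last n) = Fin.last n := by
    apply sPerm_of_ne <;> simp only [ne_eq, Fin.ext_iff, Fin.val_last, Fin.val_castSucc,
      Fin.val_succ] <;> omega
  have hx : sPerm i x = Fin.last n ↔ x = Fin.last n := by
    rw [← hl, (sPerm i).injective.eq_iff, hl]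
  have hc : finRotate (n + 1) (sPerm i x) = sPerm j (finRotate (n + 1) x) :=
    (DFunLike.congr_fun (sPerm_mul_finRotate hij) x).symm
  rw [k2, Function.comp_apply, Quad.actPsi_key, Quad.actPsi_key, k1, hc]
  simp only [hx, Function.comp_apply]

/-- The pair `(v[i], CT)` after an affine arrow which moves it to the last position. -/
def keyShift (x : ℕ × ℤ) : ℕ × ℤ := (x.1 + 1, x.2)

omit [Algebra ℚ K] in
lemma keyVal_keyShift_sub (x y : ℕ × ℤ) :
    keyVal α (keyShift x) - keyVal α (keyShift y) = keyVal α x - keyVal α y := by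
  rw [keyShift, keyShift, keyVal_succ, keyVal_succ, add_sub_add_right_eq_sub]

lemma keyUp_keyShift {x y : ℕ × ℤ} : KeyUp (keyShift x) (keyShift y) ↔ KeyUp x y := by
  simp only [KeyUp, keyShift]
  omega

lemma keyFall_keyShift {x y : ℕ × ℤ} : KeyFall (keyShift x) (keyShift y) ↔ KeyFall x y := by
  simp only [KeyFall, keyShift]
  omega

omit [Algebra ℚ K] in
lemma Quad.actPsi_actPsi_key (q : Quad K n lam) {i j : Fin n} (hi : (i : ℕ) = 0)
    (hj : (j : ℕ) + 1 = n) :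
    ((q.actPsi α).actPsi α).key j.castSucc = keyShift (q.key i.castSucc) ∧
      ((q.actPsi α).actPsi α).key j.succ = keyShift (q.key i.succ) := by
  have hj' : j.succ = Fin.last n := by simp [Fin.ext_iff, hj]
  have hi' : i.castSucc = (0 : Fin (n + 1)) := by simp [Fin.ext_iff, hi]
  rw [Quad.actPsi_key_castSucc, hj', Quad.actPsi_key_last, Quad.actPsi_key_last, ← hi',
    Quad.actPsi_key_castSucc]
  exact ⟨rfl, rfl⟩

omit [Algebra ℚ K] in
lemma Quad.Good.actS_actPsi_actPsi {q : Quad K n lam} (hq : q.Good α) {i j : Fin n}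
    (hi : (i : ℕ) = 0) (hj : (j : ℕ) + 1 = n)
    (hf : ¬ KeyFall (q.key i.castSucc) (q.key i.succ)) :
    ((q.actS i).actPsi α).actPsi α = ((q.actPsi α).actPsi α).actS j := by
  obtain ⟨c1, c2⟩ := q.actPsi_actPsi_key (α := α) hi hj
  obtain ⟨g1, k1⟩ := hq.actS hf
  obtain ⟨c3, c4⟩ := (q.actS i).actPsi_actPsi_key (α := α) hi hj
  obtain ⟨g2, k2⟩ := hq.actPsi.actPsi.actS (i := j) (by rwa [c1, c2, keyFall_keyShift])
  refine g1.actPsi.actPsi.ext_key g2 (funext fun x => ?_)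
  rw [k2, Function.comp_apply]
  by_cases h1 : x = j.castSucc
  · rw [h1, sPerm_castSucc, c3, c2, k1, Function.comp_apply, sPerm_castSucc]
  by_cases h2 : x = j.succ
  · rw [h2, sPerm_succ, c4, c1, k1, Function.comp_apply, sPerm_succ]
  have hj' : j.succ = Fin.last n := by simp [Fin.ext_iff, hj]
  have hx : x ≠ Fin.last n := hj' ▸ h2
  have hx' : finRotate (n + 1) x ≠ Fin.last n := by
    rw [← hj', ← finRotate_castSucc]
    exact fun h => h1 ((finRotate (n + 1)).injective h)
  have hc : finRotate (n + 1) (finRotate (n + 1) (sPerm j x)) =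
      sPerm i (finRotate (n + 1) (finRotate (n + 1) x)) :=
    (DFunLike.congr_fun (sPerm_mul_finRotate_sq hi hj) x).symm
  rw [sPerm_of_ne h1 h2] at hc ⊢
  rw [Quad.actPsi_key, if_neg hx, Quad.actPsi_key, if_neg hx', Quad.actPsi_key, if_neg hx,
    Quad.actPsi_key, if_neg hx', k1, Function.comp_apply, ← hc]

lemma valUnique_psi {q : Quad K n lam} (hq : q.Good α)
    (ih : ∀ q' : Quad K n lam, q'.Prec (q.actPsi α) → q'.ValUnique α hlam) {i : Fin n}
    (hi : KeyUp ((q.actPsi α).key i.succ) ((q.actPsi α).key i.castSucc)) {p p' : VPoly K n lam}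
    (hp : Val α hlam ((q.actPsi α).actS i) p) (hp' : Val α hlam q p') :
    tOp i (keyVal α ((q.actPsi α).key i.castSucc) - keyVal α ((q.actPsi α).key i.succ)) p =
      psiOp K p' := by
  obtain ⟨-, -, l1, -, -⟩ := hq.actPsi.actS_of_down hi
  by_cases hin : (i : ℕ) + 1 < n
  · obtain ⟨j, hij⟩ : ∃ j : Fin n, (j : ℕ) = i + 1 := ⟨⟨i + 1, hin⟩, rfl⟩
    obtain ⟨c1, c2⟩ := q.actPsi_key_next (α := α) hij
    have hj : KeyUp (q.key j.succ) (q.key j.castSucc) := by rwa [c1, c2] at hi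
    obtain ⟨p0, h0⟩ := (hq.actS_of_down hj).1.exists_val hlam
    have v1 := h0.psi
    rw [hq.actS_actPsi hij hj.not_fall'] at v1
    rw [ih _ l1 _ _ hp v1, ih _ q.prec_actPsi _ _ hp' (h0.of_actS hq hj), c1, c2, psiOp_tOp hij]
  · have hj : (i : ℕ) + 1 = n := by omega
    obtain ⟨k, hk⟩ : ∃ k : Fin n, (k : ℕ) = 0 := ⟨⟨0, by omega⟩, rfl⟩
    have hi' : i.succ = Fin.last n := by simp [Fin.ext_iff, hj]
    have hlast : q.wt (Fin.last n) ≠ 0 := by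
      have h1 := q.actPsi_key_castSucc (α := α) i
      have h2 := q.actPsi_key_last (α := α)
      rw [hi'] at h1 hi
      rw [h1, h2, KeyUp] at hi
      simp only [Quad.key] at hi
      omega
    obtain ⟨r, hr, rfl⟩ := hq.exists_actPsi_eq hlast
    obtain ⟨c1, c2⟩ := r.actPsi_actPsi_key (α := α) hk hj
    rw [c1, c2, keyUp_keyShift] at hi
    obtain ⟨p0, h0⟩ := (hr.actS_of_down hi).1.exists_val hlam
    have v1 := h0.psi.psi
    rw [hr.actS_actPsi_actPsi hk hj hi.not_fall'] at v1
    rw [ih _ l1 _ _ hp v1, ih _ (Quad.prec_actPsi _) _ _ hp' (h0.of_actS hr hi).psi, c1, c2,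
      keyVal_keyShift_sub, psiOp_psiOp_tOp hk hj]

omit [Algebra ℚ K] in
lemma rootQuad_not_down (i : Fin n) :
    ¬ KeyUp ((rootQuad K hlam).key i.succ) ((rootQuad K hlam).key i.castSucc) := by
  intro h
  have h1 := fillingOfKey_strictMono (n := n) hlam rootKey rootKey_injective
    (Fin.castSucc_lt_succ (i := i))
  have h2 := Prod.Lex.toLex_lt_toLex.mp (OrderDual.toDual_lt_toDual.mp h1)
  change (rootTab hlam).1.col i.succ < (rootTab hlam).1.col i.castSucc ∨
    (rootTab hlam).1.col i.succ = (rootTab hlam).1.col i.castSucc ∧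
    (rootTab hlam).1.row i.succ < (rootTab hlam).1.row i.castSucc at h2
  rw [KeyUp] at h
  simp only [Quad.key, rootQuad, Filling.content_def, Equiv.Perm.one_apply] at h
  have h3 := (rootTab hlam).2.adjacent (val_succ_eq i) (by omega) (by omega)
  omega

theorem Quad.valUnique (hα : Transcendental ℚ α) (hlam : lam.card = n + 1) (q : Quad K n lam) :
    q.ValUnique α hlam := by
  induction q using Quad.prec_induction with
  | _ q ih =>
    intro p p' h h'
    have hq := h.good
    rcases h.cases_last with ⟨rfl, rfl⟩ | ⟨i, p1, hi, v1, rfl⟩ | ⟨q1, p1, rfl, v1, rfl⟩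
    · rcases h'.cases_last with ⟨-, rfl⟩ | ⟨j, -, hj, -, -⟩ | ⟨q2, -, e, -, -⟩
      · rfl
      · exact absurd hj (rootQuad_not_down j)
      · have := congrFun (congrArg Quad.wt e) (Fin.last n)
        rw [Quad.actPsi_wt, psiWt_last] at this
        simp [rootQuad] at this
    · rcases h'.cases_last with ⟨rfl, rfl⟩ | ⟨j, p2, hj, v2, rfl⟩ | ⟨q2, p2, rfl, v2, rfl⟩
      · exact absurd hi (rootQuad_not_down i)
      · rcases (show (i : ℕ) = j ∨ (j : ℕ) = i + 1 ∨ (i : ℕ) = j + 1 ∨ (i : ℕ) + 1 < j ∨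
          (j : ℕ) + 1 < i by omega) with hij | hij | hij | hij | hij
        · obtain rfl := Fin.ext hij
          rw [ih _ (hq.actS_of_down hi).2.2.1 _ _ v1 v2]
        · exact valUnique_next hα hq ih hij hi hj v1 v2
        · exact (valUnique_next hα hq ih hij hj hi v2 v1).symm
        · exact valUnique_far hq ih hij hi hj v1 v2
        · exact (valUnique_far hq ih hij hj hi v2 v1).symm
      · exact valUnique_psi v2.good ih hi v1 v2
    · rcases h'.cases_last with ⟨e, -⟩ | ⟨j, p2, hj, v2, rfl⟩ | ⟨q2, p2, e, v2, rfl⟩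
      · have := congrFun (congrArg Quad.wt e) (Fin.last n)
        rw [Quad.actPsi_wt, psiWt_last] at this
        simp [rootQuad] at this
      · exact (valUnique_psi v1.good ih hj v2 v1).symm
      · obtain rfl := v2.good.actPsi_injective v1.good e
        rw [ih _ (Quad.prec_actPsi _) _ _ v1 v2]

end Values

section Jack

variable {K : Type*} [Field K] [Algebra ℚ K] {n : ℕ} {lam : YoungDiagram}

/-! ### The values at the vertices with `v = 0` -/

lemma murphy_single (i : Fin n) (τ : RST n lam) :
    murphy K i (Finsupp.single τ 1) = murphyVec K i τ := by
  rw [murphy, Finsupp.linearCombination_single, one_smul]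

lemma algebraMap_murphyB (i : Fin n) (τ : RST n lam) : algebraMap ℚ K (murphyB τ i) =
    1 / ((τ.1.content i.castSucc : K) - (τ.1.content i.succ : K)) := by
  simp only [murphyB, map_div₀, map_sub, map_one, map_intCast]

lemma murphy_single_of_up {i : Fin n} {τ : RST n lam}
    (h : τ.1.content i.succ + 2 ≤ τ.1.content i.castSucc)
    (hex : (τ.1.exchange i.castSucc i.succ).IsRST) :
    murphy K i (Finsupp.single τ 1) =
      (1 / ((τ.1.content i.castSucc : K) - (τ.1.content i.succ : K))) • Finsupp.single τ 1 +
        Finsupp.single ⟨τ.1.exchange i.castSucc i.succ, hex⟩ 1 := by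
  have h2 : (2 : ℚ) ≤ (τ.1.content i.castSucc : ℚ) - (τ.1.content i.succ : ℚ) := by
    exact_mod_cast (by omega : (2 : ℤ) ≤ τ.1.content i.castSucc - τ.1.content i.succ)
  have h3 : 0 < murphyB τ i := by
    rw [murphyB]
    positivity
  have h4 : murphyB τ i ≤ 1 / 2 := one_div_le_one_div_of_le (by norm_num) h2
  rw [murphy_single, murphyVec, if_neg (by nlinarith), if_pos ⟨h3, h4⟩, exchangeVec, dif_pos hex,
    algebraMap_murphyB, Finsupp.smul_single_one]

lemma murphy_single_of_fall {i : Fin n} {τ : RST n lam}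
    (h : |τ.1.content i.castSucc - τ.1.content i.succ| = 1) :
    murphy K i (Finsupp.single τ 1) =
      (1 / ((τ.1.content i.castSucc : K) - (τ.1.content i.succ : K))) • Finsupp.single τ 1 := by
  have : murphyB τ i ^ 2 = 1 := invDiff_sq_eq_one_iff.mpr h
  rw [murphy_single, murphyVec, if_pos this, algebraMap_murphyB, Finsupp.smul_single_one]

lemma sOp_one_tmul (i : Fin n) (u : TabSpace K n lam) :
    sOp K i (1 ⊗ₜ[K] u) = 1 ⊗ₜ[K] murphy K i u := by
  rw [sOp, TensorProduct.map_tmul, polyAct, AlgHom.toLinearMap_apply, map_one]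

variable {α : K} {hlam : lam.card = n + 1}

lemma Val.eq_of_wt_eq_zero {q : Quad K n lam} {p : VPoly K n lam} (h : Val α hlam q p)
    (hv : ∀ i, q.wt i = 0) : p = 1 ⊗ₜ[K] Finsupp.single q.tab 1 := by
  induction h with
  | root => rfl
  | @s q q' p i h ha ih =>
    obtain ⟨rfl, hup⟩ := h.good.arrow_iff.mp ha
    have hw := h.good.wt_actS hup.not_fall
    have hv' : ∀ x, q.wt x = 0 := fun x => by
      have := hv (sPerm i x)
      rwa [hw, Function.comp_apply, sPerm_sPerm] at this
    have hperm := h.good.perm_eq_one (fun a b _ => by rw [hv', hv'])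
    have hc : q.tab.1.content i.succ + 2 ≤ q.tab.1.content i.castSucc := by
      rw [KeyUp] at hup
      simp only [Quad.key, hv', hperm, Equiv.Perm.one_apply] at hup
      omega
    have hex := (q.tab.2.exchange_iff (val_succ_eq i)).mpr fun hcon => by
      rw [abs_eq one_pos.le] at hcon
      omega
    have htab : (q.actS i).tab = ⟨q.tab.1.exchange i.castSucc i.succ, hex⟩ := by
      have hex' : (q.tab.1.exchange (q.perm i.castSucc) (q.perm i.succ)).IsRST := by
        rwa [hperm]
      rw [Quad.actS, if_neg (by rw [hv', hv']; simp), dif_pos hex']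
      simp only [hperm, Equiv.Perm.one_apply]
    have hspec : q.spec i.succ - q.spec i.castSucc =
        -((q.tab.1.content i.castSucc : K) - q.tab.1.content i.succ) := by
      rw [h.good.spec_eq, h.good.spec_eq]
      simp only [Quad.key, keyVal, hv', hperm, Equiv.Perm.one_apply]
      ring
    rw [ih hv', tOp, sOp_one_tmul, murphy_single_of_up hc hex, htab, hspec, one_div_neg_eq_neg_one_div,
      TensorProduct.tmul_add, TensorProduct.tmul_smul]
    module
  | @psi q p h ih =>
    have := hv (Fin.last n)
    rw [Quad.actPsi_wt, psiWt_last] at this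
    omega

/-! ### Falls -/

lemma Quad.wt_cases (v : Fin (n + 1) → ℕ) : v (Fin.last n) ≠ 0 ∨
    (∃ j : Fin n, v j.succ < v j.castSucc) ∨ ∀ i, v i = 0 := by
  by_contra hcon
  push Not at hcon
  obtain ⟨h1, h2, i, h3⟩ := hcon
  have := (Fin.monotone_iff_le_succ.mpr h2) (Fin.le_last i)
  omega

/-- The Jack polynomials are eigenvectors of `s_i ⊗ s_i` at the falls. -/
theorem Val.tOp_eq_zero_of_fall (hα : Transcendental ℚ α) (q : Quad K n lam) :
    ∀ (i : Fin n) (p : VPoly K n lam), Val α hlam q p → KeyFall (q.key i.castSucc) (q.key i.succ) →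
      tOp i (keyVal α (q.key i.succ) - keyVal α (q.key i.castSucc)) p = 0 := by
  induction q using Quad.prec_induction with
  | _ q ih =>
    intro i p hp hf
    have hq := hp.good
    have huniq := Quad.valUnique (n := n) (lam := lam) hα hlam
    rcases Quad.wt_cases q.wt with hlast | ⟨j, hj⟩ | hv
    · obtain ⟨q', hq', rfl⟩ := hq.exists_actPsi_eq hlast
      by_cases hin : (i : ℕ) + 1 < n
      · obtain ⟨j, hij⟩ : ∃ j : Fin n, (j : ℕ) = i + 1 := ⟨⟨i + 1, hin⟩, rfl⟩
        obtain ⟨c1, c2⟩ := q'.actPsi_key_next (α := α) hij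
        rw [c1, c2] at hf ⊢
        obtain ⟨p0, h0⟩ := hq'.exists_val hlam
        rw [huniq _ _ _ hp h0.psi, ← psiOp_tOp hij, ih _ q'.prec_actPsi j p0 h0 hf, map_zero]
      · have hj : (i : ℕ) + 1 = n := by omega
        obtain ⟨k, hk⟩ : ∃ k : Fin n, (k : ℕ) = 0 := ⟨⟨0, by omega⟩, rfl⟩
        have hi' : i.succ = Fin.last n := by simp [Fin.ext_iff, hj]
        have hlast' : q'.wt (Fin.last n) ≠ 0 := by
          have h1 : ((q'.actPsi α).key i.castSucc).1 = ((q'.actPsi α).key i.succ).1 := hf.1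
          rw [Quad.actPsi_key_castSucc, hi', Quad.actPsi_key_last] at h1
          simp only [Quad.key] at h1
          omega
        obtain ⟨r, hr, rfl⟩ := hq'.exists_actPsi_eq hlast'
        obtain ⟨c1, c2⟩ := r.actPsi_actPsi_key (α := α) hk hj
        rw [c1, c2, keyFall_keyShift] at hf
        obtain ⟨p0, h0⟩ := hr.exists_val hlam
        rw [huniq _ _ _ hp h0.psi.psi, c1, c2, keyVal_keyShift_sub, ← psiOp_psiOp_tOp hk hj,
          ih _ (r.prec_actPsi.trans (Quad.prec_actPsi _)) k p0 h0 hf, map_zero, map_zero]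
    · have hjd : KeyUp (q.key j.succ) (q.key j.castSucc) := Or.inl hj
      obtain ⟨g1, k1, l1, -, -⟩ := hq.actS_of_down hjd
      have hfw : q.wt i.castSucc = q.wt i.succ := hf.1
      have hinj := keyVal_injective hα
      rcases (show (i : ℕ) = j ∨ (j : ℕ) = i + 1 ∨ (i : ℕ) = j + 1 ∨ (i : ℕ) + 1 < j ∨
          (j : ℕ) + 1 < i by omega) with hij | hij | hij | hij
      · obtain rfl := Fin.ext hij
        omega
      · obtain ⟨e1, e2, e3⟩ := sPerm_apply_of_next hij
        have f1 : sPerm j i.succ = j.succ := by rw [← e1, sPerm_castSucc]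
        have f2 : sPerm j j.succ = i.succ := by rw [sPerm_succ, e1]
        have hd : KeyUp (q.key j.succ) (q.key i.castSucc) := by
          rw [e1, ← hfw] at hj
          exact Or.inl hj
        have c2 : (q.actS j).key i.castSucc = q.key i.castSucc ∧
            (q.actS j).key i.succ = q.key j.succ := by
          rw [k1, Function.comp_apply, Function.comp_apply, e3, f1]
          exact ⟨rfl, rfl⟩
        have u2 : KeyUp ((q.actS j).key i.succ) ((q.actS j).key i.castSucc) := by rwa [c2.1, c2.2]
        obtain ⟨g4, k4, l4, -, -⟩ := g1.actS_of_down u2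
        have c4 : ((q.actS j).actS i).key j.castSucc = q.key i.castSucc ∧
            ((q.actS j).actS i).key j.succ = q.key i.succ := by
          rw [k4, k1, e1]
          simp only [Function.comp_apply, e3, f2, e2, sPerm_succ, and_self]
        obtain ⟨p0, h0⟩ := g4.exists_val hlam
        have hz := ih _ (l4.trans l1) j p0 h0 (by rwa [c4.1, c4.2])
        rw [c4.1, c4.2] at hz
        rw [huniq _ _ _ hp ((h0.of_actS g1 u2).of_actS hq hjd), c2.1, c2.2, e1]
        have := tOp_braid hij (a := keyVal α (q.key i.succ) - keyVal α (q.key i.castSucc))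
          (b := keyVal α (q.key i.castSucc) - keyVal α (q.key j.succ))
          (sub_ne_zero.mpr fun h => hf.ne (hinj h).symm)
          (sub_ne_zero.mpr fun h => hd.ne (hinj h).symm)
          (by rw [sub_add_sub_cancel, ← e1]
              exact sub_ne_zero.mpr fun h => hjd.ne (hinj h).symm) p0
        rw [sub_add_sub_cancel, hz, tOp_zero, tOp_zero] at this
        exact this
      · obtain ⟨e1, e2, e3⟩ := sPerm_apply_of_next hij
        have f1 : sPerm i j.succ = i.succ := by rw [← e1, sPerm_castSucc]
        have hd : KeyUp (q.key i.succ) (q.key j.castSucc) := by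
          rw [← e1, hfw] at hj
          exact Or.inl hj
        have c2 : (q.actS j).key i.castSucc = q.key j.castSucc ∧
            (q.actS j).key i.succ = q.key i.succ := by
          rw [k1, e1, Function.comp_apply, Function.comp_apply, sPerm_succ, e2]
          exact ⟨rfl, rfl⟩
        have u2 : KeyUp ((q.actS j).key i.succ) ((q.actS j).key i.castSucc) := by rwa [c2.1, c2.2]
        obtain ⟨g4, k4, l4, -, -⟩ := g1.actS_of_down u2
        have c4 : ((q.actS j).actS i).key j.castSucc = q.key i.castSucc ∧
            ((q.actS j).actS i).key j.succ = q.key i.succ := by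
          rw [k4, k1, e1]
          simp only [Function.comp_apply, e3, f1, e2, sPerm_castSucc, and_self]
        obtain ⟨p0, h0⟩ := g4.exists_val hlam
        have hz := ih _ (l4.trans l1) j p0 h0 (by rwa [c4.1, c4.2])
        rw [c4.1, c4.2] at hz
        rw [huniq _ _ _ hp ((h0.of_actS g1 u2).of_actS hq hjd), c2.1, c2.2, ← e1]
        have := tOp_braid hij (b := keyVal α (q.key i.succ) - keyVal α (q.key i.castSucc))
          (a := keyVal α (q.key j.castSucc) - keyVal α (q.key i.succ))
          (sub_ne_zero.mpr fun h => hd.ne (hinj h).symm)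
          (sub_ne_zero.mpr fun h => hf.ne (hinj h).symm)
          (by rw [sub_add_sub_cancel, e1]
              exact sub_ne_zero.mpr fun h => hjd.ne (hinj h).symm) p0
        rw [sub_add_sub_cancel, hz, tOp_zero, tOp_zero] at this
        exact this.symm
      · obtain ⟨e1, e2⟩ := sPerm_apply_of_far (i := j) (j := i) hij.symm
        have c1 : (q.actS j).key i.castSucc = q.key i.castSucc ∧
            (q.actS j).key i.succ = q.key i.succ := by
          rw [k1, Function.comp_apply, Function.comp_apply, e1, e2]
          exact ⟨rfl, rfl⟩
        obtain ⟨p0, h0⟩ := g1.exists_val hlam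
        have hz := ih _ l1 i p0 h0 (by rwa [c1.1, c1.2])
        rw [c1.1, c1.2] at hz
        rw [huniq _ _ _ hp (h0.of_actS hq hjd)]
        rcases hij with hij | hij
        · rw [tOp_comm hij, hz, tOp_zero]
        · rw [← tOp_comm hij, hz, tOp_zero]
    · have hperm := hq.perm_eq_one (fun a b _ => by rw [hv, hv])
      have hc := hf.2
      simp only [Quad.key, hperm, Equiv.Perm.one_apply] at hc
      have hspec : keyVal α (q.key i.succ) - keyVal α (q.key i.castSucc) =
          -((q.tab.1.content i.castSucc : K) - q.tab.1.content i.succ) := by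
        simp only [Quad.key, keyVal, hv, hperm, Equiv.Perm.one_apply]
        ring
      rw [hp.eq_of_wt_eq_zero hv, tOp, sOp_one_tmul, murphy_single_of_fall hc, hspec,
        one_div_neg_eq_neg_one_div, TensorProduct.tmul_smul]
      module

/-! ### Jack polynomials -/

lemma Val.jack_eq (hα : Transcendental ℚ α) {q : Quad K n lam} {p : VPoly K n lam}
    (h : Val α hlam q p) : jack α hlam q.wt q.tab = p := by
  obtain ⟨P, hP⟩ := h.good.exists_path hlam
  have hex : ∃ (P : List (Label n)) (q' : Quad K n lam), IsPath α hlam P q' ∧ q'.wt = q.wt ∧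
      q'.tab = q.tab := ⟨P, q, hP, rfl, rfl⟩
  rw [jack, dif_pos hex]
  obtain ⟨q', hP', hwt, htab⟩ := hex.choose_spec
  obtain rfl := hP'.good.ext_wt_tab h.good hwt htab
  exact Quad.valUnique hα hlam _ _ _ hP'.val h

/-- The Jack polynomial of a vertex. -/
def Quad.jack (α : K) (hlam : lam.card = n + 1) (q : Quad K n lam) : VPoly K n lam :=
  VVJack.jack α hlam q.wt q.tab

lemma Quad.Good.val_jack (hα : Transcendental ℚ α) {q : Quad K n lam} (h : q.Good α) :
    Val α hlam q (q.jack α hlam) := by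
  obtain ⟨p, hp⟩ := h.exists_val hlam
  rwa [Quad.jack, hp.jack_eq hα]

lemma Quad.Good.jack_actS (hα : Transcendental ℚ α) {q : Quad K n lam} (h : q.Good α) {i : Fin n}
    (hup : KeyUp (q.key i.castSucc) (q.key i.succ)) :
    (q.actS i).jack α hlam = tOp i (q.spec i.succ - q.spec i.castSucc) (q.jack α hlam) :=
  ((h.val_jack hα).s (h.arrow_iff.mpr ⟨rfl, hup⟩)).jack_eq hα

lemma Quad.Good.tOp_jack_of_fall (hα : Transcendental ℚ α) {q : Quad K n lam} (h : q.Good α)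
    {i : Fin n} (hf : KeyFall (q.key i.castSucc) (q.key i.succ)) :
    tOp i (q.spec i.succ - q.spec i.castSucc) (q.jack α hlam) = 0 := by
  rw [h.spec_eq, h.spec_eq]
  exact Val.tOp_eq_zero_of_fall hα q i _ (h.val_jack hα) hf

/-! ### Leading terms -/

/-- The number of steps of a path from `0` to `v`. -/
def wtLength (v : Fin (n + 1) → ℕ) : ℕ :=
  sumPairs (fun x y => if x < y then y - x - 1 else x - y) v

lemma wtLength_comp_sPerm_of_lt {v : Fin (n + 1) → ℕ} {i : Fin n} (h : v i.castSucc < v i.succ) :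
    wtLength (v ∘ sPerm i) = wtLength v + 1 := by
  have := sumPairs_comp_sPerm (fun x y => if x < y then y - x - 1 else x - y) v i
  rw [if_pos h, if_neg h.not_gt] at this
  rw [wtLength, wtLength]
  omega

lemma wtLength_comp_sPerm_le (v : Fin (n + 1) → ℕ) (i : Fin n) :
    wtLength (v ∘ sPerm i) ≤ wtLength v + 1 := by
  have := sumPairs_comp_sPerm (fun x y => if x < y then y - x - 1 else x - y) v i
  rw [wtLength, wtLength]
  split_ifs at this <;> omega

lemma sumPairs_psiWt (g : ℕ → ℕ → ℕ) (u : Fin (n + 1) → ℕ) :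
    sumPairs g (psiWt u) = ∑ i : Fin n, ((∑ j : Fin n, if i < j then g (u i.succ) (u j.succ) else 0)
      + g (u i.succ) (u 0 + 1)) := by
  have h1 : ∀ x : Fin (n + 1), ¬ Fin.last n < x := fun x => (Fin.le_last x).not_gt
  rw [sumPairs, Fintype.sum_prod_type, Fin.sum_univ_castSucc]
  simp only [h1, if_false, Finset.sum_const_zero, add_zero, Fin.sum_univ_castSucc, psiWt_castSucc,
    psiWt_last, Fin.castSucc_lt_last, if_true, Fin.castSucc_lt_castSucc_iff]

lemma sumPairs_eq_succ (g : ℕ → ℕ → ℕ) (u : Fin (n + 1) → ℕ) :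
    sumPairs g u = ∑ i : Fin n, ((∑ j : Fin n, if i < j then g (u i.succ) (u j.succ) else 0)
      + g (u 0) (u i.succ)) := by
  rw [sumPairs, Fintype.sum_prod_type, Fin.sum_univ_succ, Finset.sum_add_distrib, add_comm]
  simp only [Fin.sum_univ_succ (fun j : Fin (n + 1) => if _ < j then _ else _), Fin.succ_pos,
    if_true, Fin.not_lt_zero, if_false, zero_add, Fin.succ_lt_succ_iff]

lemma wtLength_psiWt (u : Fin (n + 1) → ℕ) : wtLength (psiWt u) = wtLength u := by
  rw [wtLength, wtLength, sumPairs_psiWt, sumPairs_eq_succ]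
  refine Finset.sum_congr rfl fun i _ => congrArg _ ?_
  split_ifs <;> omega

/-- The leading term of the Jack polynomials `J_{v,τ}` for a given `v`. -/
theorem exists_leading (hα : Transcendental ℚ α) (hlam : lam.card = n + 1)
    (v : Fin (n + 1) → ℕ) :
    ∃ A : TabSpace K n lam →ₗ[K] TabSpace K n lam, Function.Injective A ∧
      ∀ q : Quad K n lam, q.Good α → q.wt = v →
        coeffV K v (q.jack α hlam) = A (Finsupp.single q.tab 1) ∧
        ∀ w, w ≠ v → wtLength v ≤ wtLength w → coeffV K w (q.jack α hlam) = 0 := by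
  obtain ⟨m, hm⟩ : ∃ m, ∑ i, v i + wtLength v = m := ⟨_, rfl⟩
  induction m using Nat.strong_induction_on generalizing v with
  | _ m ih =>
    rcases Quad.wt_cases v with hlast | ⟨j, hj⟩ | hv
    · have hu := psiWt_psiWtInv hlast
      generalize psiWtInv v = u at hu
      subst hu
      have hlt : ∑ i, u i + wtLength u < m := by
        rw [wtLength_psiWt, Fin.sum_univ_castSucc, psiWt_last,
          Finset.sum_congr rfl fun i _ => psiWt_castSucc u i] at hm
        rw [Fin.sum_univ_succ]
        omega
      obtain ⟨A, hA, h⟩ := ih _ hlt u rfl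
      refine ⟨tabAct K (finRotate (n + 1)) ∘ₗ A, (tabAct_injective K _).comp hA, fun q hq hqv => ?_⟩
      obtain ⟨q', hq', rfl⟩ := hq.exists_actPsi_eq (by rwa [hqv])
      obtain ⟨h1, h2⟩ := h q' hq' (psiWt_injective hqv)
      have hp : (q'.actPsi α).jack α hlam = psiOp K (q'.jack α hlam) :=
        (hq'.val_jack hα).psi.jack_eq hα
      rw [hp]
      refine ⟨?_, fun w hw hle => ?_⟩
      · rw [coeffV_psiOp, h1]
        rfl
      · by_cases hw0 : w (Fin.last n) = 0
        · exact coeffV_psiOp_of_eq_zero K hw0 _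
        · have hw' := psiWt_psiWtInv hw0
          generalize psiWtInv w = w' at hw'
          subst hw'
          rw [wtLength_psiWt, wtLength_psiWt] at hle
          rw [coeffV_psiOp, h2 w' (fun e => hw (by rw [e])) hle, map_zero]
    · have hlen : wtLength v = wtLength (v ∘ sPerm j) + 1 := by
        have := wtLength_comp_sPerm_of_lt (v := v ∘ sPerm j) (i := j) (by
          rwa [Function.comp_apply, Function.comp_apply, sPerm_castSucc, sPerm_succ])
        rwa [Function.comp_assoc, ← Equiv.Perm.coe_mul, sPerm_mul_self, Equiv.Perm.coe_one,
          Function.comp_id] at this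
      have hlt : ∑ i, (v ∘ sPerm j) i + wtLength (v ∘ sPerm j) < m := by
        rw [show ∑ i, (v ∘ sPerm j) i = ∑ i, v i from Equiv.sum_comp (sPerm j) v]
        omega
      obtain ⟨A, hA, h⟩ := ih _ hlt _ rfl
      have hs : Function.Injective (murphy K j (lam := lam)) := by
        rw [← tabAct_sPerm]
        exact tabAct_injective K _
      refine ⟨murphy K j ∘ₗ A, hs.comp hA, fun q hq hqv => ?_⟩
      have hd : KeyUp (q.key j.succ) (q.key j.castSucc) := Or.inl (by
        simpa only [Quad.key, hqv] using hj)
      obtain ⟨g1, -, -, h3, h4⟩ := hq.actS_of_down hd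
      have hp := g1.jack_actS hα (hlam := hlam) h3
      rw [h4] at hp
      have hw1 := hq.wt_actS hd.not_fall'
      rw [hqv] at hw1
      have htab : (q.actS j).tab = q.tab := by
        rw [Quad.actS, if_pos (by rw [hqv]; exact hj.ne')]
      obtain ⟨h1, h2⟩ := h _ g1 hw1
      have hne : v ≠ v ∘ sPerm j := fun e => by
        have := congrArg wtLength e
        omega
      rw [hp]
      refine ⟨?_, fun w hw hle => ?_⟩
      · rw [tOp, map_add, map_smul, coeffV_sOp, h1, h2 v hne (by omega), smul_zero, add_zero, htab]
        rfl
      · have hlw : wtLength w ≤ wtLength (w ∘ sPerm j) + 1 := by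
          have := wtLength_comp_sPerm_le (w ∘ sPerm j) j
          rwa [Function.comp_assoc, ← Equiv.Perm.coe_mul, sPerm_mul_self, Equiv.Perm.coe_one,
            Function.comp_id] at this
        have hne1 : w ∘ sPerm j ≠ v ∘ sPerm j := fun e =>
          hw ((sPerm j).surjective.injective_comp_right e)
        have hne2 : w ≠ v ∘ sPerm j := fun e => by
          have := congrArg wtLength e
          omega
        rw [tOp, map_add, map_smul, coeffV_sOp, h2 _ hne1 (by omega), h2 _ hne2 (by omega),
          smul_zero, map_zero, add_zero]
    · refine ⟨LinearMap.id, Function.injective_id, fun q hq hqv => ?_⟩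
      rw [(hq.val_jack hα).eq_of_wt_eq_zero (by rw [hqv]; exact hv)]
      have hv0 : v = 0 := funext hv
      refine ⟨?_, fun w hw _ => ?_⟩
      · rw [coeffV_tmul, MvPolynomial.coeff_one, if_pos, one_smul, LinearMap.id_apply]
        ext x
        exact (hv x).symm
      · rw [coeffV_tmul, MvPolynomial.coeff_one, if_neg, zero_smul]
        intro e
        refine hw (funext fun x => ?_)
        rw [hv0]
        exact (DFunLike.congr_fun e x).symm

end Jack

section Components

variable {K : Type*} [Field K] {α : K} {n : ℕ} {lam : YoungDiagram}

/-! ### Invariance of the tableau `T(τ, v)` -/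

lemma tabOf_congr {τ : RST n lam} {v v' : Fin (n + 1) → ℕ} (h : sortDesc v = sortDesc v') :
    tabOf τ v = tabOf τ v' :=
  Tableau.ext (funext fun c => congrFun h (τ.1.symm c))

lemma Quad.Good.tabOf_actS {q : Quad K n lam} (h : q.Good α) (i : Fin n) :
    tabOf (q.actS i).tab (q.actS i).wt = tabOf q.tab q.wt := by
  by_cases hf : KeyFall (q.key i.castSucc) (q.key i.succ)
  · rw [h.actS_of_fall hf]
  rw [h.wt_actS hf, tabOf_congr (sortDesc_comp_perm q.wt (sPerm i))]
  by_cases hv : q.wt i.castSucc = q.wt i.succ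
  · have hex := (q.tab.2.exchange_iff (h.perm_succ hv)).mpr fun hc => hf ⟨hv, hc⟩
    rw [Quad.actS, if_neg (not_not.mpr hv), dif_pos hex]
    refine Tableau.ext (funext fun c => ?_)
    change sortDesc q.wt (Equiv.swap (q.perm i.castSucc) (q.perm i.succ) (q.tab.1.symm c)) =
      sortDesc q.wt (q.tab.1.symm c)
    generalize q.tab.1.symm c = a
    rw [h.sortDesc_wt, Function.comp_apply, Function.comp_apply, Equiv.swap_apply_def]
    split_ifs with h1 h2
    · rw [h1, Equiv.symm_apply_apply, Equiv.symm_apply_apply, hv]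
    · rw [h2, Equiv.symm_apply_apply, Equiv.symm_apply_apply, hv]
    · rfl
  · rw [Quad.actS, if_pos hv]

lemma Quad.Good.actS_good {q : Quad K n lam} (h : q.Good α) (i : Fin n) : (q.actS i).Good α := by
  by_cases hf : KeyFall (q.key i.castSucc) (q.key i.succ)
  · rwa [h.actS_of_fall hf]
  · exact (h.actS hf).1

/-- Upwards induction along the arrows `s_i`. -/
lemma Quad.Good.up_induction {P : Quad K n lam → Prop} (hsink : ∀ q : Quad K n lam, q.Good α → q.IsSink → P q)
    (hup : ∀ (q : Quad K n lam) (i : Fin n), q.Good α → KeyUp (q.key i.castSucc) (q.key i.succ) →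
      P (q.actS i) → P q) {q : Quad K n lam} (h : q.Good α) : P q := by
  obtain ⟨m, hm⟩ : ∃ m, (n + 1) * (n + 1) - q.invNum = m := ⟨_, rfl⟩
  induction m using Nat.strong_induction_on generalizing q with
  | _ m ih =>
    by_cases hs : q.IsSink
    · exact hsink q h hs
    · rw [Quad.IsSink] at hs
      push Not at hs
      obtain ⟨i, hi⟩ := hs
      refine hup q i h hi (ih _ ?_ (h.actS_good i) rfl)
      have h1 := h.invNum_actS hi
      have h2 := (q.actS i).invNum_le
      omega

/-- Downwards induction along the arrows `s_i`. -/
lemma Quad.Good.down_induction {P : Quad K n lam → Prop}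
    (hsource : ∀ q : Quad K n lam, q.Good α → q.IsSource → P q)
    (hdown : ∀ (q : Quad K n lam) (i : Fin n), q.Good α → KeyUp (q.key i.succ) (q.key i.castSucc) →
      P (q.actS i) → P q) {q : Quad K n lam} (h : q.Good α) : P q := by
  induction q using Quad.prec_induction with
  | _ q ih =>
    by_cases hs : q.IsSource
    · exact hsource q h hs
    · rw [Quad.IsSource] at hs
      push Not at hs
      obtain ⟨i, hi⟩ := hs
      obtain ⟨h1, -, h3, -, -⟩ := h.actS_of_down hi
      exact hdown q i h hi (ih _ h3 h1)

lemma Quad.Good.wt_tab_of_isSink {q : Quad K n lam} (h : q.Good α) (hs : q.IsSink)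
    (hlam : lam.card = n + 1) {T : Tableau lam} (hT : tabOf q.tab q.wt = T) :
    q.wt = T.sorted hlam ∧ q.tab = T.std hlam := by
  subst hT
  refine ⟨?_, h.tab_eq_std hs hlam⟩
  rw [h.sorted_tabOf hlam, sortDesc_eq q.wt 1 hs.antitone]
  rfl

lemma Quad.Good.eq_of_isSource {q q' : Quad K n lam} (h : q.Good α) (h' : q'.Good α)
    (hs : q.IsSource) (hs' : q'.IsSource) (hlam : lam.card = n + 1)
    (hT : tabOf q.tab q.wt = tabOf q'.tab q'.wt) : q = q' := by
  have hrev : ∀ r : Quad K n lam, r.IsSource → r.wt = sortDesc r.wt ∘ Fin.rev := fun r hr => by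
    rw [sortDesc_eq r.wt Fin.revPerm fun a b hab => hr.monotone (Fin.rev_le_rev.mpr hab)]
    funext x
    simp
  refine h.ext_wt_tab h' ?_ ?_
  · rw [hrev q hs, hrev q' hs', ← h.sorted_tabOf hlam, ← h'.sorted_tabOf hlam, hT]
  · have h1 := h.strictMono_colKey hs
    rw [hT] at h1
    exact Subtype.ext (Filling.eq_of_strictMono (Tableau.colKey_injective _) h1
      (h'.strictMono_colKey hs'))

lemma Quad.Good.tabOf_entry_perm {q : Quad K n lam} (h : q.Good α) (x : Fin (n + 1)) :
    (tabOf q.tab q.wt).entry (q.tab.1 (q.perm x)) = q.wt x := by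
  rw [tabOf_entry, h.sortDesc_wt, Function.comp_apply, Equiv.symm_apply_apply]

/-- In the column-strict case all the falls are horizontal. -/
lemma Quad.Good.spec_sub_of_fall {q : Quad K n lam} (h : q.Good α)
    (hT : (tabOf q.tab q.wt).ColumnStrict) {i : Fin n}
    (hf : KeyFall (q.key i.castSucc) (q.key i.succ)) : q.spec i.succ - q.spec i.castSucc = -1 := by
  have hv : q.wt i.castSucc = q.wt i.succ := hf.1
  have hadj := q.tab.2.adjacent_of_content (h.perm_succ hv) hf.2
  have hc : q.tab.1.content (q.perm i.castSucc) = q.tab.1.content (q.perm i.succ) + 1 := by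
    rw [Filling.content_def, Filling.content_def]
    rcases hadj with h1 | h1
    · omega
    · have h2 := hT (q.tab.1 (q.perm i.succ)) (q.tab.1 (q.perm i.castSucc)) h1.2.symm (by
        change q.tab.1.row _ < q.tab.1.row _
        omega)
      rw [h.tabOf_entry_perm, h.tabOf_entry_perm] at h2
      omega
  rw [h.spec_eq, h.spec_eq]
  simp only [Quad.key, keyVal, hv, hc]
  push_cast
  ring

/-- If `T` is not column-strict, then there is a vertical fall at the vertex without inward
arrow. -/
lemma Quad.Good.exists_vertical_fall {q : Quad K n lam} (h : q.Good α) (hs : q.IsSource)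
    (hT : ¬ (tabOf q.tab q.wt).ColumnStrict) :
    ∃ i : Fin n, KeyFall (q.key i.castSucc) (q.key i.succ) ∧
      q.spec i.succ - q.spec i.castSucc = 1 := by
  rw [Tableau.ColumnStrict] at hT
  push Not at hT
  obtain ⟨c, d, hcol, hrow, hle⟩ := hT
  have heq := le_antisymm ((tabOf q.tab q.wt).col_weak c d hcol hrow) hle
  obtain ⟨a, rfl⟩ := q.tab.1.surjective c
  obtain ⟨b, rfl⟩ := q.tab.1.surjective d
  have hba : b < a := (q.tab.2 a b).2 hcol hrow
  rw [tabOf_entry, tabOf_entry] at heq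
  obtain ⟨k, rfl⟩ : ∃ k : Fin n, k.castSucc = b :=
    ⟨b.castPred (ne_of_lt (hba.trans_le (Fin.le_last a))), Fin.castSucc_castPred _ _⟩
  have hka : k.succ ≤ a := Fin.castSucc_lt_iff_succ_le.mp hba
  have e1 := sortDesc_antitone q.wt hka
  have e2 := sortDesc_antitone q.wt (Fin.castSucc_lt_succ (i := k)).le
  have hcol' : q.tab.1.col a = q.tab.1.col k.castSucc := hcol
  have h1 : q.tab.1.col a ≤ q.tab.1.col k.succ := by
    rcases hka.eq_or_lt with rfl | hlt
    · exact le_rfl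
    · have h2 := h.strictMono_colKey hs hlt
      have h3 := Prod.Lex.toLex_lt_toLex.mp (OrderDual.toDual_lt_toDual.mp h2)
      rw [tabOf_entry, tabOf_entry] at h3
      rcases h3 with h3 | ⟨-, h3⟩
      · exact absurd h3 (by omega)
      · rcases Prod.Lex.toLex_lt_toLex.mp h3 with h4 | h4
        · exact h4.le
        · exact h4.1.le
  obtain ⟨i, hi1, hi2, hv, h2⟩ := h.col_row_of_isSource hs (k := k) (by omega)
  have hadj := q.tab.2.adjacent (val_succ_eq k) (by omega) (by omega)
  have hc : q.tab.1.content k.succ = q.tab.1.content k.castSucc + 1 := by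
    rw [Filling.content_def, Filling.content_def]
    omega
  refine ⟨i, ⟨hv, ?_⟩, ?_⟩
  · simp only [Quad.key, hi1, hi2, hc]
    rw [abs_eq one_pos.le]
    omega
  · rw [h.spec_eq, h.spec_eq]
    simp only [Quad.key, keyVal, hi1, hi2, hv, hc]
    push_cast
    ring

/-! ### Connected components -/

variable {hlam : lam.card = n + 1}

lemma Vertex.good (x : Vertex α hlam) : x.1.Good α := x.2.choose_spec.good

/-- The action of `s_i` on the vertices. -/
def Vertex.actS (x : Vertex α hlam) (i : Fin n) : Vertex α hlam :=
  ⟨x.1.actS i, (x.good.actS_good i).exists_path hlam⟩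

lemma Vertex.hArrow_iff {x y : Vertex α hlam} {i : Fin n} : HArrow x i y ↔
    y = x.actS i ∧ KeyUp (x.1.key i.castSucc) (x.1.key i.succ) := by
  rw [HArrow, x.good.arrow_iff, Subtype.ext_iff]
  rfl

lemma Vertex.hArrow_of_down {x : Vertex α hlam} {i : Fin n}
    (hd : KeyUp (x.1.key i.succ) (x.1.key i.castSucc)) : HArrow (x.actS i) i x :=
  x.good.arrow_of_down hd

lemma Vertex.actS_actS (x : Vertex α hlam) (i : Fin n) : (x.actS i).actS i = x := by
  refine Subtype.ext ?_
  by_cases hf : KeyFall (x.1.key i.castSucc) (x.1.key i.succ)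
  · change (x.1.actS i).actS i = x.1
    rw [x.good.actS_of_fall hf, x.good.actS_of_fall hf]
  · exact x.good.actS_actS hf

lemma Vertex.reachable_of_hArrow {x y : Vertex α hlam} {i : Fin n} (h : HArrow x i y) :
    (nonAffineGraph α hlam).Reachable x y := by
  refine SimpleGraph.Adj.reachable ?_
  rw [nonAffineGraph, SimpleGraph.fromRel_adj]
  refine ⟨?_, Or.inl ⟨i, h⟩⟩
  rintro rfl
  obtain ⟨h1, h2⟩ := Vertex.hArrow_iff.mp h
  have h3 := x.good.invNum_actS h2
  have h4 : x.1 = x.1.actS i := congrArg Subtype.val h1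
  rw [← h4] at h3
  omega

lemma Vertex.reachable_actS (x : Vertex α hlam) (i : Fin n) :
    (nonAffineGraph α hlam).Reachable x (x.actS i) := by
  rcases x.good.trichotomy i with h | h | h
  · exact Vertex.reachable_of_hArrow (Vertex.hArrow_iff.mpr ⟨rfl, h⟩)
  · exact (Vertex.reachable_of_hArrow (Vertex.hArrow_of_down h)).symm
  · have : x.actS i = x := Subtype.ext (x.good.actS_of_fall h)
    rw [this]

lemma Vertex.tabOf_eq_of_reachable {x y : Vertex α hlam}
    (h : (nonAffineGraph α hlam).Reachable x y) :
    tabOf x.1.tab x.1.wt = tabOf y.1.tab y.1.wt := by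
  obtain ⟨w⟩ := h
  induction w with
  | nil => rfl
  | cons hadj _ ih =>
    rw [← ih]
    rw [nonAffineGraph, SimpleGraph.fromRel_adj] at hadj
    rcases hadj.2 with ⟨i, hi⟩ | ⟨i, hi⟩
    · obtain ⟨rfl, -⟩ := Vertex.hArrow_iff.mp hi
      exact (Vertex.good _).tabOf_actS i |>.symm
    · obtain ⟨rfl, -⟩ := Vertex.hArrow_iff.mp hi
      exact (Vertex.good _).tabOf_actS i

lemma Vertex.exists_sink (x : Vertex α hlam) :
    ∃ z : Vertex α hlam, (nonAffineGraph α hlam).Reachable x z ∧ z.1.IsSink := by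
  have key : ∀ hx : ∃ P, IsPath α hlam P x.1, ∃ z : Vertex α hlam,
      (nonAffineGraph α hlam).Reachable ⟨x.1, hx⟩ z ∧ z.1.IsSink := by
    refine x.good.up_induction (P := fun q => ∀ hq : ∃ P, IsPath α hlam P q,
      ∃ z : Vertex α hlam, (nonAffineGraph α hlam).Reachable ⟨q, hq⟩ z ∧ z.1.IsSink) ?_ ?_
    · intro q _ hs hq
      exact ⟨⟨q, hq⟩, SimpleGraph.Reachable.refl _, hs⟩
    · intro q i h _ ih hq
      obtain ⟨z, hz, hs⟩ := ih ((h.actS_good i).exists_path hlam)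
      exact ⟨z, (Vertex.reachable_actS ⟨q, hq⟩ i).trans hz, hs⟩
  exact key x.2

lemma Vertex.exists_source (x : Vertex α hlam) :
    ∃ z : Vertex α hlam, (nonAffineGraph α hlam).Reachable x z ∧ z.1.IsSource := by
  have key : ∀ hx : ∃ P, IsPath α hlam P x.1, ∃ z : Vertex α hlam,
      (nonAffineGraph α hlam).Reachable ⟨x.1, hx⟩ z ∧ z.1.IsSource := by
    refine x.good.down_induction (P := fun q => ∀ hq : ∃ P, IsPath α hlam P q,
      ∃ z : Vertex α hlam, (nonAffineGraph α hlam).Reachable ⟨q, hq⟩ z ∧ z.1.IsSource) ?_ ?_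
    · intro q _ hs hq
      exact ⟨⟨q, hq⟩, SimpleGraph.Reachable.refl _, hs⟩
    · intro q i h _ ih hq
      obtain ⟨z, hz, hs⟩ := ih ((h.actS_good i).exists_path hlam)
      exact ⟨z, (Vertex.reachable_actS ⟨q, hq⟩ i).trans hz, hs⟩
  exact key x.2

lemma mem_supp_of_reachable {C : (nonAffineGraph α hlam).ConnectedComponent}
    {x y : Vertex α hlam} (h : (nonAffineGraph α hlam).Reachable x y) (hx : x ∈ C.supp) :
    y ∈ C.supp := by
  rw [SimpleGraph.ConnectedComponent.mem_supp_iff] at *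
  rw [← hx]
  exact (SimpleGraph.ConnectedComponent.sound h).symm

lemma tabOf_eq_of_mem_supp {C : (nonAffineGraph α hlam).ConnectedComponent} {x y : Vertex α hlam}
    (hx : x ∈ C.supp) (hy : y ∈ C.supp) : tabOf x.1.tab x.1.wt = tabOf y.1.tab y.1.wt := by
  rw [SimpleGraph.ConnectedComponent.mem_supp_iff] at *
  exact Vertex.tabOf_eq_of_reachable (SimpleGraph.ConnectedComponent.exact (hx.trans hy.symm))

lemma finite_supp (C : (nonAffineGraph α hlam).ConnectedComponent) : C.supp.Finite := by
  have hinj : Function.Injective fun x : C.supp => (x.1.1.tab, x.1.1.perm) := by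
    intro x y h
    rw [Prod.mk.injEq] at h
    have hwt : ∀ z : C.supp, z.1.1.wt = sortDesc z.1.1.wt ∘ z.1.1.perm := fun z => by
      rw [(Vertex.good z.1).sortDesc_wt, Function.comp_assoc, Equiv.symm_comp_self,
        Function.comp_id]
    refine Subtype.ext (Subtype.ext ((Vertex.good x.1).ext_wt_tab (Vertex.good y.1) ?_ h.1))
    rw [hwt x, hwt y, ← (Vertex.good x.1).sorted_tabOf hlam, ← (Vertex.good y.1).sorted_tabOf hlam,
      tabOf_eq_of_mem_supp x.2 y.2, h.2]
  have : Finite C.supp := Finite.of_injective _ hinj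
  exact Set.toFinite _

end Components

section Symmetrization

variable {K : Type*} [Field K] [Algebra ℚ K] {α : K} {n : ℕ} {lam : YoungDiagram}

/-! ### The values at the ends of an arrow -/

lemma KeyInv.keyVal_sub_ne_zero (hα : Transcendental ℚ α) {x y : ℕ × ℤ} (h : KeyInv x y) :
    keyVal α x - keyVal α y ≠ 0 := by
  intro e
  have e' := keyVal_injective hα (sub_eq_zero.mp e)
  subst e'
  rcases h with h | h <;> omega

lemma KeyInv.keyVal_sub_ne_one (hα : Transcendental ℚ α) {x y : ℕ × ℤ} (h : KeyInv x y) :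
    keyVal α x - keyVal α y - 1 ≠ 0 := by
  intro e
  have e' : x = (y.1, y.2 + 1) := keyVal_injective hα (by
    simp only [keyVal] at e ⊢
    push_cast
    linear_combination e)
  subst e'
  rcases h with h | h <;> simp at h

lemma KeyUp.keyVal_sub_ne_neg_one (hα : Transcendental ℚ α) {x y : ℕ × ℤ} (h : KeyUp x y) :
    keyVal α y - keyVal α x + 1 ≠ 0 := by
  intro e
  have e' : x = (y.1, y.2 + 1) := keyVal_injective hα (by
    simp only [keyVal] at e ⊢
    push_cast
    linear_combination -e)
  subst e'
  rcases h with h | h <;> simp at h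

lemma symOp_tOp (i : Fin n) (d : K) (p : VPoly K n lam) :
    symOp K (tOp i d p) = (1 + 1 / d) • symOp K p := by
  rw [tOp, map_add, map_smul, symOp_sOp, add_smul, one_smul]

/-- All the Jack polynomials of a component have proportional symmetrizations. -/
lemma Quad.Good.symOp_jack (hα : Transcendental ℚ α) (hlam : lam.card = n + 1) {q : Quad K n lam}
    (h : q.Good α) {T : Tableau lam} (hT : tabOf q.tab q.wt = T) :
    ∃ c : K, c ≠ 0 ∧ symOp K (q.jack α hlam) =
      c • symOp K (VVJack.jack α hlam (T.sorted hlam) (T.std hlam)) := by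
  revert hT
  refine h.up_induction (P := fun q => tabOf q.tab q.wt = T → ∃ c : K, c ≠ 0 ∧
    symOp K (q.jack α hlam) =
      c • symOp K (VVJack.jack α hlam (T.sorted hlam) (T.std hlam))) ?_ ?_
  · intro q h hs hT
    obtain ⟨h1, h2⟩ := h.wt_tab_of_isSink hs hlam hT
    exact ⟨1, one_ne_zero, by rw [Quad.jack, h1, h2, one_smul]⟩
  · intro q i h hup ih hT
    obtain ⟨c, hc, e⟩ := ih (by rw [h.tabOf_actS, hT])
    rw [h.jack_actS hα hup, symOp_tOp] at e
    have hd := hup.keyInv.keyVal_sub_ne_zero hα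
    have hd' := hup.keyVal_sub_ne_neg_one hα
    rw [← h.spec_eq, ← h.spec_eq] at hd hd'
    have hne : 1 + 1 / (q.spec i.succ - q.spec i.castSucc) ≠ 0 := by
      rw [one_add_div hd]
      exact div_ne_zero hd' hd
    refine ⟨(1 + 1 / (q.spec i.succ - q.spec i.castSucc))⁻¹ * c,
      mul_ne_zero (inv_ne_zero hne) hc, ?_⟩
    rw [mul_smul, ← e, smul_smul, inv_mul_cancel₀ hne, one_smul]

/-- A vertical fall kills the symmetrization. -/
lemma Quad.Good.symOp_jack_eq_zero (hα : Transcendental ℚ α) (hlam : lam.card = n + 1)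
    {q : Quad K n lam} (h : q.Good α) {i : Fin n}
    (hf : KeyFall (q.key i.castSucc) (q.key i.succ))
    (hd : q.spec i.succ - q.spec i.castSucc = 1) : symOp K (q.jack α hlam) = 0 := by
  have := algebraRat.charZero K
  have e := congrArg (symOp K) (h.tOp_jack_of_fall hα (hlam := hlam) hf)
  rw [symOp_tOp, hd, map_zero] at e
  exact (smul_eq_zero.mp e).resolve_left (by norm_num)

/-- A horizontal fall leaves the polynomial invariant. -/
lemma Quad.Good.sOp_jack_of_fall (hα : Transcendental ℚ α) (hlam : lam.card = n + 1)
    {q : Quad K n lam} (h : q.Good α) {i : Fin n}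
    (hf : KeyFall (q.key i.castSucc) (q.key i.succ))
    (hd : q.spec i.succ - q.spec i.castSucc = -1) :
    sOp K i (q.jack α hlam) = q.jack α hlam := by
  have e := h.tOp_jack_of_fall hα (hlam := hlam) hf
  rw [tOp, hd] at e
  rw [← sub_eq_zero, ← e]
  module

/-! ### The coefficients of the symmetric polynomial -/

open Classical in
/-- The product over the inversions which satisfies the recursive rule of the coefficients. -/
def Quad.invProd (α : K) (q : Quad K n lam) : K :=
  prodPairs (fun x y => if KeyInv x y then
    (keyVal α x - keyVal α y) / (keyVal α x - keyVal α y - 1) else 1) q.key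

lemma Quad.invProd_ne_zero (hα : Transcendental ℚ α) (q : Quad K n lam) : q.invProd α ≠ 0 := by
  rw [Quad.invProd, prodPairs]
  refine Finset.prod_ne_zero_iff.mpr fun p _ => ?_
  split_ifs with _ h
  · exact div_ne_zero (h.keyVal_sub_ne_zero hα) (h.keyVal_sub_ne_one hα)
  · exact one_ne_zero
  · exact one_ne_zero

omit [Algebra ℚ K] in
lemma Quad.Good.invProd_actS {q : Quad K n lam} (h : q.Good α) {i : Fin n}
    (hup : KeyUp (q.key i.castSucc) (q.key i.succ)) :
    (q.actS i).invProd α = (q.spec i.succ - q.spec i.castSucc) /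
      (q.spec i.succ - q.spec i.castSucc - 1) * q.invProd α := by
  have := prodPairs_comp_sPerm (fun x y => open Classical in if KeyInv x y then
    (keyVal α x - keyVal α y) / (keyVal α x - keyVal α y - 1) else 1) q.key i
  rw [if_neg hup.not_keyInv, if_pos hup.keyInv, mul_one] at this
  rw [Quad.invProd, (h.actS hup.not_fall).2, this, h.spec_eq, h.spec_eq, mul_comm]
  rfl

variable {hlam : lam.card = n + 1} {C : (nonAffineGraph α hlam).ConnectedComponent}

omit [Algebra ℚ K] in
lemma isSource_iff {x : C.supp} :
    x.1.1.IsSource ↔ ∀ (y : C.supp) (i : Fin n), ¬ HArrow y.1 i x.1 := by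
  constructor
  · intro hs y i hy
    obtain ⟨h1, h2⟩ := Vertex.hArrow_iff.mp hy
    refine hs i ?_
    have h3 : x.1.1 = y.1.1.actS i := congrArg Subtype.val h1
    rw [h3, ((Vertex.good y.1).actS h2.not_fall).2, Function.comp_apply, Function.comp_apply,
      sPerm_castSucc, sPerm_succ]
    exact h2
  · intro hx i hd
    exact hx ⟨x.1.actS i, mem_supp_of_reachable (x.1.reachable_actS i) x.2⟩ i
      (Vertex.hArrow_of_down hd)

omit [Algebra ℚ K] in
lemma IsSymCoeff.eq {E E' : C.supp → K} (h : IsSymCoeff C E) (h' : IsSymCoeff C E') : E' = E := by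
  have key : ∀ q : Quad K n lam, q.Good α → ∀ x : C.supp, x.1.1 = q → E' x = E x := by
    intro q hq
    refine hq.down_induction (P := fun q => ∀ x : C.supp, x.1.1 = q → E' x = E x) ?_ ?_
    · rintro q - hs x rfl
      rw [h.root x (isSource_iff.mp hs), h'.root x (isSource_iff.mp hs)]
    · rintro q i - hd ih x rfl
      have ha := Vertex.hArrow_of_down hd
      let y : C.supp := ⟨x.1.actS i, mem_supp_of_reachable (x.1.reachable_actS i) x.2⟩
      rw [h.arrow y x i ha, h'.arrow y x i ha, ih y rfl]
  exact funext fun x => key _ (Vertex.good x.1) x rfl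

lemma exists_isSymCoeff (hα : Transcendental ℚ α)
    (C : (nonAffineGraph α hlam).ConnectedComponent) :
    ∃ E : C.supp → K, IsSymCoeff C E ∧ ∀ x, E x ≠ 0 := by
  obtain ⟨x, hx⟩ := C.nonempty_supp
  obtain ⟨z, hxz, hz⟩ := x.exists_source
  have hzC := mem_supp_of_reachable hxz hx
  refine ⟨fun x => x.1.1.invProd α / z.1.invProd α, ⟨fun x hx => ?_, fun y x i ha => ?_⟩,
    fun x => div_ne_zero (Quad.invProd_ne_zero hα _) (Quad.invProd_ne_zero hα _)⟩
  · rw [(Vertex.good x.1).eq_of_isSource z.good (isSource_iff.mpr hx) hz hlam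
      (tabOf_eq_of_mem_supp x.2 hzC)]
    exact div_self (Quad.invProd_ne_zero hα _)
  · obtain ⟨h1, h2⟩ := Vertex.hArrow_iff.mp ha
    have h3 : x.1.1 = y.1.1.actS i := congrArg Subtype.val h1
    rw [h3, (Vertex.good y.1).invProd_actS h2, mul_div_assoc]

/-! ### Symmetry -/

/-- The involution `s_i` on the vertices of a component. -/
def suppPerm (C : (nonAffineGraph α hlam).ConnectedComponent) (i : Fin n) : Equiv.Perm C.supp :=
  Function.Involutive.toPerm
    (fun x => ⟨x.1.actS i, mem_supp_of_reachable (x.1.reachable_actS i) x.2⟩)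
    fun x => Subtype.ext (x.1.actS_actS i)

lemma sOp_pair_of_up (i : Fin n) {d e : K} (hd : d ≠ 0) (hd' : d - 1 ≠ 0) (p : VPoly K n lam) :
    sOp K i (e • p) + sOp K i ((d / (d - 1) * e) • tOp i d p) =
      e • p + (d / (d - 1) * e) • tOp i d p := by
  rw [tOp, map_smul, map_smul, map_add, map_smul, sOp_sOp]
  generalize sOp K i p = r
  have h : e + d / (d - 1) * e * (1 / d) = d / (d - 1) * e := by field_simp; ring
  calc e • r + (d / (d - 1) * e) • (p + (1 / d) • r)
      = (e + d / (d - 1) * e * (1 / d)) • r + (d / (d - 1) * e) • p := by module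
    _ = (d / (d - 1) * e) • r + (e + d / (d - 1) * e * (1 / d)) • p := by rw [h]
    _ = _ := by module

lemma sOp_pair_of_hArrow (hα : Transcendental ℚ α) {E : C.supp → K} (hE : IsSymCoeff C E)
    {x y : C.supp} {i : Fin n} (ha : HArrow x.1 i y.1) :
    sOp K i (E x • x.1.1.jack α hlam) + sOp K i (E y • y.1.1.jack α hlam) =
      E x • x.1.1.jack α hlam + E y • y.1.1.jack α hlam := by
  obtain ⟨h1, h2⟩ := Vertex.hArrow_iff.mp ha
  have h3 : y.1.1 = x.1.1.actS i := congrArg Subtype.val h1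
  have hd := h2.keyInv.keyVal_sub_ne_zero hα
  have hd' := h2.keyInv.keyVal_sub_ne_one hα
  rw [← (Vertex.good x.1).spec_eq, ← (Vertex.good x.1).spec_eq] at hd hd'
  rw [hE.arrow x y i ha, h3, (Vertex.good x.1).jack_actS hα h2]
  exact sOp_pair_of_up i hd hd' _

lemma sOp_pair (hα : Transcendental ℚ α) {E : C.supp → K} (hE : IsSymCoeff C E)
    {T : Tableau lam} (hT : ∀ x ∈ C.supp, tabOf x.1.tab x.1.wt = T) (hcs : T.ColumnStrict)
    (x : C.supp) (i : Fin n) :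
    sOp K i (E x • x.1.1.jack α hlam) +
        sOp K i (E (suppPerm C i x) • (suppPerm C i x).1.1.jack α hlam) =
      E x • x.1.1.jack α hlam + E (suppPerm C i x) • (suppPerm C i x).1.1.jack α hlam := by
  rcases (Vertex.good x.1).trichotomy i with h | h | h
  · exact sOp_pair_of_hArrow hα hE (Vertex.hArrow_iff.mpr ⟨rfl, h⟩)
  · rw [add_comm, add_comm (E x • _)]
    exact sOp_pair_of_hArrow hα hE (x := suppPerm C i x) (Vertex.hArrow_of_down h)
  · have hx : suppPerm C i x = x := Subtype.ext (Subtype.ext ((Vertex.good x.1).actS_of_fall h))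
    have hd := (Vertex.good x.1).spec_sub_of_fall (by rwa [hT x.1 x.2]) h
    rw [hx, map_smul, (Vertex.good x.1).sOp_jack_of_fall hα hlam h hd]

lemma isSymmetric_sum (hα : Transcendental ℚ α) [Fintype C.supp] {E : C.supp → K}
    (hE : IsSymCoeff C E) {T : Tableau lam} (hT : ∀ x ∈ C.supp, tabOf x.1.tab x.1.wt = T)
    (hcs : T.ColumnStrict) : IsSymmetric (∑ x : C.supp, E x • x.1.1.jack α hlam) := by
  have := algebraRat.charZero K
  intro i
  have h := Finset.sum_congr (rfl : (Finset.univ : Finset C.supp) = Finset.univ)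
    fun x _ => sOp_pair hα hE hT hcs x i
  rw [Finset.sum_add_distrib, Finset.sum_add_distrib,
    Equiv.sum_comp (suppPerm C i) fun x => sOp K i (E x • x.1.1.jack α hlam),
    Equiv.sum_comp (suppPerm C i) fun x => E x • x.1.1.jack α hlam, ← map_sum, ← two_smul K,
    ← two_smul K] at h
  exact smul_right_injective _ (two_ne_zero' K) h

/-! ### Non-vanishing -/

omit [Algebra ℚ K] in
lemma Quad.Good.wtLength_le {q : Quad K n lam} (h : q.Good α) :
    wtLength q.wt ≤ wtLength (sortDesc q.wt) := by
  refine h.up_induction (P := fun q => wtLength q.wt ≤ wtLength (sortDesc q.wt)) ?_ ?_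
  · intro q h hs
    rw [sortDesc_eq q.wt 1 hs.antitone]
    exact le_rfl
  · intro q i h hup ih
    rw [h.wt_actS hup.not_fall, sortDesc_comp_perm] at ih
    rcases hup with hv | ⟨hv, -⟩
    · have := wtLength_comp_sPerm_of_lt (v := q.wt) hv
      omega
    · have e : q.wt ∘ sPerm i = q.wt := by
        funext x
        rw [Function.comp_apply, sPerm, Equiv.swap_apply_def]
        split_ifs with h1 h2
        · rw [h1]; exact hv.symm
        · rw [h2]; exact hv
        · rfl
      rwa [e] at ih

lemma sum_jack_ne_zero (hα : Transcendental ℚ α) [Fintype C.supp] {E : C.supp → K}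
    (hE : ∀ x, E x ≠ 0) : ∑ x : C.supp, E x • x.1.1.jack α hlam ≠ 0 := by
  classical
  obtain ⟨x, hx⟩ := C.nonempty_supp
  obtain ⟨z, hxz, hz⟩ := x.exists_sink
  have hzC := mem_supp_of_reachable hxz hx
  have hwt : ∀ y : C.supp, sortDesc y.1.1.wt = z.1.wt := fun y => by
    rw [← (Vertex.good y.1).sorted_tabOf hlam, tabOf_eq_of_mem_supp y.2 hzC,
      z.good.sorted_tabOf hlam, sortDesc_eq z.1.wt 1 hz.antitone]
    rfl
  obtain ⟨A, hA, h⟩ := exists_leading hα hlam z.1.wt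
  intro e
  have hcoef : coeffV K z.1.wt (∑ y : C.supp, E y • y.1.1.jack α hlam) =
      A (∑ y : C.supp, if y.1.1.wt = z.1.wt then Finsupp.single y.1.1.tab (E y) else 0) := by
    rw [map_sum, map_sum]
    refine Finset.sum_congr rfl fun y _ => ?_
    rw [map_smul]
    split_ifs with hy
    · rw [(h _ (Vertex.good y.1) hy).1, ← map_smul, Finsupp.smul_single, smul_eq_mul, mul_one]
    · obtain ⟨B, -, hB⟩ := exists_leading hα hlam y.1.1.wt
      rw [(hB _ (Vertex.good y.1) rfl).2 _ (Ne.symm hy)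
        (by rw [← hwt y]; exact (Vertex.good y.1).wtLength_le), smul_zero, map_zero]
  rw [e, map_zero] at hcoef
  have h0 := hA (hcoef.symm.trans (map_zero A).symm)
  have h1 := congrArg (fun f => f z.1.tab) h0
  simp only [Finsupp.finsetSum_apply, Finsupp.coe_zero, Pi.zero_apply] at h1
  rw [Finset.sum_eq_single (⟨z, hzC⟩ : C.supp)] at h1
  · rw [if_pos rfl, Finsupp.single_eq_same] at h1
    exact hE _ h1
  · intro y _ hy
    split_ifs with hw
    · refine Finsupp.single_eq_of_ne fun ht => hy (Subtype.ext (Subtype.ext ?_))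
      exact (Vertex.good y.1).ext_wt_tab z.good hw ht.symm
    · rfl
  · intro hn
    exact absurd (Finset.mem_univ _) hn

/-- In the column-strict case the symmetrizations of the Jack polynomials do not vanish. -/
lemma symOp_jack_ne_zero (hα : Transcendental ℚ α) {T : Tableau lam}
    (hT : ∀ x ∈ C.supp, tabOf x.1.tab x.1.wt = T) (hcs : T.ColumnStrict) :
    symOp K (jack α hlam (T.sorted hlam) (T.std hlam)) ≠ 0 := by
  have := algebraRat.charZero K
  have := (finite_supp C).fintype
  obtain ⟨E, hE, hne⟩ := exists_isSymCoeff hα C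
  intro h0
  have hsym := (isSymmetric_sum hα hE hT hcs).symOp_eq
  rw [map_sum, Finset.sum_eq_zero fun x _ => ?_] at hsym
  · exact smul_ne_zero (Nat.cast_ne_zero.mpr (n + 1).factorial_ne_zero) (sum_jack_ne_zero hα hne)
      hsym.symm
  · obtain ⟨c, -, hc⟩ := (Vertex.good x.1).symOp_jack hα hlam (hT x.1 x.2)
    rw [map_smul, hc, h0, smul_zero, smul_zero]

lemma symOp_jack_eq_zero (hα : Transcendental ℚ α) {T : Tableau lam}
    (hT : ∀ x ∈ C.supp, tabOf x.1.tab x.1.wt = T) (hcs : ¬ T.ColumnStrict) :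
    symOp K (jack α hlam (T.sorted hlam) (T.std hlam)) = 0 := by
  obtain ⟨x, hx⟩ := C.nonempty_supp
  obtain ⟨z, hxz, hz⟩ := x.exists_source
  have hzT := hT z (mem_supp_of_reachable hxz hx)
  obtain ⟨i, hf, hd⟩ := z.good.exists_vertical_fall hz (by rwa [hzT])
  obtain ⟨c, hc, e⟩ := z.good.symOp_jack hα hlam hzT
  rw [z.good.symOp_jack_eq_zero hα hlam hf hd] at e
  exact (smul_eq_zero.mp e.symm).resolve_left hc

end Symmetrization

end VVJack

end

theorem mainTheorem2 {K : Type*} [Field K] [Algebra ℚ K] (α : K) (hα : Transcendental ℚ α)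
    (n : ℕ) (lam : YoungDiagram) (hlam : lam.card = n + 1)
    (C : (VVJack.nonAffineGraph α hlam).ConnectedComponent) (T : VVJack.Tableau lam)
    (hT : ∃ x ∈ C.supp, VVJack.tabOf x.1.tab x.1.wt = T) :
    (∀ x ∈ C.supp, ∃ c : K, c ≠ 0 ∧
      VVJack.symOp K (VVJack.jack α hlam x.1.wt x.1.tab) =
        c • VVJack.symOp K (VVJack.jack α hlam (T.sorted hlam) (T.std hlam))) ∧
    (VVJack.symOp K (VVJack.jack α hlam (T.sorted hlam) (T.std hlam)) ≠ 0 ↔ T.ColumnStrict) ∧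
    (T.ColumnStrict → C.supp.Finite ∧
      ∃ E : C.supp → K, VVJack.IsSymCoeff C E ∧
        (∀ E' : C.supp → K, VVJack.IsSymCoeff C E' → E' = E) ∧
        VVJack.IsSymmetric
          (∑ᶠ x : C.supp, E x • VVJack.jack α hlam x.1.1.wt x.1.1.tab)) := by
  obtain ⟨x₀, hx₀, hT₀⟩ := hT
  have hT : ∀ x ∈ C.supp, VVJack.tabOf x.1.tab x.1.wt = T := fun x hx =>
    (VVJack.tabOf_eq_of_mem_supp hx hx₀).trans hT₀
  refine ⟨fun x hx => x.good.symOp_jack hα hlam (hT x hx), ⟨fun h => ?_,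
    VVJack.symOp_jack_ne_zero hα hT⟩, fun hcs => ⟨VVJack.finite_supp C, ?_⟩⟩
  · by_contra hcs
    exact h (VVJack.symOp_jack_eq_zero hα hT hcs)
  · have := (VVJack.finite_supp C).fintype
    obtain ⟨E, hE, -⟩ := VVJack.exists_isSymCoeff hα C
    refine ⟨E, hE, fun E' hE' => hE.eq hE', ?_⟩
    rw [finsum_eq_sum_of_fintype]
    exact VVJack.isSymmetric_sum hα hE hT hcs
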